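/- Conventions. All Lie algebras are $\mathbb{Z}$-graded over $\mathbb{Q}$, with $[y,x]=-(-1)^{|x||y|}[x,y]$; free graded Lie algebras are completed in each degree with respect to the number of brackets, and $\partial$ is a derivation of degree $-1$ ($\partial[x,y]=[\partial x,y]+(-1)^{|x|}[x,\partial y]$) which respects the filtration by the number of brackets. Write $\mathrm{ad}_e(x)=[e,x]$ and $\mathrm{BCH}(x,y)=\log(e^xe^y)$, also for operators. A *point* is an element $p$ of degree $-1$ with $\partial p+\frac12[p,p]=0$; put $\partial_p=\partial+\mathrm{ad}_p$. For $e$ of degree $0$ and $p$ of degree $-1$ the unit time flow of $p$ by $e$ is $u_e(p)=e^{-\mathrm{ad}_e}p+\frac{1-e^{-\mathrm{ad}_e}}{\mathrm{ad}_e}\,\partial e$. A *DGLA model* of a regular cell complex is a differential ($\partial^2=0$) on the completed free graded Lie algebra with one generator of degree $k-1$ for each $k$-cell, such that vertices are points, the bracket-free part of $\partial c$ is the geometric boundary of the cell $c$, and $\partial c$ lies in the Lie subalgebra generated by the cells of the closure of $c$. A cell $c$ of dimension $>1$ is *localised at the point* $p$ if $\partial_p c$ lies in the Lie subalgebra generated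 by the cells of the closure of the boundary of $c$. A *universal average* of $n$ elements is a Lie series $\mu_n(x_1,\dots,x_n)$ over $\mathbb{Q}$ in variables of degree $0$ which is totally symmetric and such that, in any model, if $p,q$ are points and $u_{x_i}(p)=q$ for all $i$, then $u_{\mu_n(x_1,\dots,x_n)}(p)=q$. Let $\mu_2(x,y)=\mathrm{BCH}(x,\frac12\mathrm{BCH}(-x,y))$. Let $Q$ be a formal power series over $\mathbb{Q}$ in two non-commuting variables such that in the free Lie algebra on $x,y$ (of degree $0$) $$\mathrm{BCH}(x,y)=x+y+Q(\mathrm{ad}_x,\mathrm{ad}_y)\,y .$$ Such $\mu_n$ and $Q$ exist; fix any of them. **Theorem 1.** Let $n\ge2$, and consider the $n$-faceted banana with vertices $a,b$, edges $e_i$ from $a$ to $b$, bigons $f_i$ with boundary $e_i-e_{i+1}$ (indices $i$ modulo $n$) and one $3$-cell $h$ with boundary $\sum_i f_i$. Put $E_i=\mathrm{ad}_{e_i}$, $v_i=\mu_2(e_i,e_{i+1})$, $x_i=u_{\frac12v_i}(a)$, $v=\mu_n(e_1,\dots,e_n)$, $x=u_{\frac12v}(a)$ and $f_i'=e^{\frac12\mathrm{ad}_{v_i}}f_i$.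 Then $v$ and the $v_i$ are Lie series of degree $0$ in the generators, and there is exactly one derivation $\partial$ as above of the completed free graded Lie algebra on $a,b$ (degree $-1$), $e_i$ (degree $0$), $f_i$ (degree $1$), $h$ (degree $2$) such that $$\partial a=-\tfrac12[a,a],\qquad \partial b=-\tfrac12[b,b],\qquad \partial e_i=\frac{E_i}{1-e^{E_i}}\,a+\frac{E_i}{1-e^{-E_i}}\,b,$$ $$\partial f_i=\mathrm{BCH}(-\tfrac12v_i,\,e_i,\,-e_{i+1},\,\tfrac12v_i)-[x_i,f_i],$$ $$e^{\frac12\mathrm{ad}_v}\,\partial_xh=\sum_{i=1}^nf_i'+\frac1{2n}\sum_{\substack{i,j=1\\ j\ne i,i+1}}^n\Big(Q\big(\mathrm{BCH}(E_j,-E_i),\mathrm{BCH}(E_i,-E_{i+1})\big)+Q\big(\mathrm{BCH}(E_j,-E_{i+1}),\mathrm{BCH}(E_{i+1},-E_i)\big)\Big)f_i' .$$ This $\partial$ is a DGLA model of the banana. It is invariant under the dihedral group $D_n$ of symmetries fixing the vertices, generated by $\tau:\ e_i\mapsto e_{i+1},\ f_i\mapsto f_{i+1}$, with $a,b,h$ fixed,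 and $\sigma:\ e_i\mapsto e_{-i},\ f_i\mapsto-f_{-i-1},\ h\mapsto-h$, with $a,b$ fixed: each element of $D_n$ extends to a DGLA automorphism. In this model $h$ is localised at the point $x$ and each $f_i$ is localised at the point $x_i$. -/

import Mathlib

/-- Formal power series over `ℚ` in non-commuting variables indexed by `G`: the coefficient of
each word. -/
def NCSeries (G : Type) : Type := List G → ℚ

namespace NCSeries

variable {G : Type}

noncomputable instance : AddCommGroup (NCSeries G) := inferInstanceAs (AddCommGroup (List G → ℚ))

noncomputable instance : Module ℚ (NCSeries G) := inferInstanceAs (Module ℚ (List G → ℚ))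

/-- The Cauchy (concatenation) product. -/
def mul (p q : NCSeries G) : NCSeries G := fun w =>
  ∑ i ∈ Finset.range (w.length + 1), p (w.take i) * q (w.drop i)

instance : Mul (NCSeries G) := ⟨mul⟩

instance : One (NCSeries G) := ⟨fun w => if w.length = 0 then 1 else 0⟩

open Classical in
/-- The generator `g`, as a series. -/
noncomputable def of (g : G) : NCSeries G := fun w => if w = [g] then 1 else 0

/-- The part of a series consisting of words of length `m`; on Lie series this is the part with
exactly `m - 1` brackets. -/
def homPart (m : ℕ) (p : NCSeries G) : NCSeries G := fun w => if w.length = m then p w else 0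

/-- Only words of length at least `m` occur in `p`. -/
def OrderGE (m : ℕ) (p : NCSeries G) : Prop := ∀ w : List G, w.length < m → p w = 0

/-- The infinite sum `∑ t k` of a sequence of series in which every word of `t k` has length at
least `k` (so that the coefficient of a word `w` only receives contributions from
`k ≤ w.length`). -/
def seriesSum (t : ℕ → NCSeries G) : NCSeries G := fun w =>
  ∑ k ∈ Finset.range (w.length + 1), t k w

/-! ### Power series in operators

The operators below are always operators which raise the length of words by at least one, so that
all sums are locally finite. -/

/-- `∑ k, c k • T ^ k p`. -/
noncomputable def opSeries (c : ℕ → ℚ) (T : NCSeries G → NCSeries G) (p : NCSeries G) :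
    NCSeries G :=
  seriesSum fun k => c k • T^[k] p

/-- `exp T`. -/
noncomputable def expOp (T : NCSeries G → NCSeries G) : NCSeries G → NCSeries G :=
  opSeries (fun k => 1 / (k.factorial : ℚ)) T

/-- `log (1 + U)`; the term with `k = 0` vanishes. -/
noncomputable def logOnePlusOp (U : NCSeries G → NCSeries G) : NCSeries G → NCSeries G :=
  opSeries (fun k => (-1) ^ (k + 1) / (k : ℚ)) U

/-- The Baker-Campbell-Hausdorff series of two operators, `log (exp S ∘ exp T)`. -/
noncomputable def bchOp (S T : NCSeries G → NCSeries G) : NCSeries G → NCSeries G :=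
  logOnePlusOp fun p => expOp S (expOp T p) - p

/-- The result of substituting operators `T i` for the variables of a series `Q` in finitely many
non-commuting variables and applying the resulting operator to `p`. -/
noncomputable def evalOp {ι : Type} [Fintype ι] (T : ι → NCSeries G → NCSeries G)
    (Q : NCSeries ι) (p : NCSeries G) : NCSeries G :=
  seriesSum fun k => ∑ u : Fin k → ι, Q (List.ofFn u) • (List.ofFn u).foldr (fun i q => T i q) p

/-- The exponential of a series without constant term. -/
noncomputable def exp (x : NCSeries G) : NCSeries G := expOp (fun p => x * p) 1

/-- The Baker-Campbell-Hausdorff series of two series without constant term,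
`log (exp x * exp y)`. -/
noncomputable def bch (x y : NCSeries G) : NCSeries G :=
  logOnePlusOp (fun p => (exp x * exp y - 1) * p) 1

/-- Substitution of series `x i` without constant term for the variables of `μ`. -/
noncomputable def subst {ι : Type} [Fintype ι] (x : ι → NCSeries G) (μ : NCSeries ι) :
    NCSeries G :=
  evalOp (fun i p => x i * p) μ 1

/-! ### The completed free graded Lie algebra

In characteristic zero the free graded Lie algebra on graded generators is the graded Lie
subalgebra generated by them in the free associative algebra, with the graded commutator as
bracket. Its completion consists of the formal series whose parts with any given number of brackets
are elements of the free graded Lie algebra. -/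

variable (deg : G → ℤ)

/-- The degree of a word. -/
def wordDeg (w : List G) : ℤ := (w.map deg).sum

/-- The graded commutator: bilinear, with `[p, q] = p q - (-1) ^ (|p| |q|) q p` for homogeneous
`p` and `q`. -/
noncomputable def bracket (p q : NCSeries G) : NCSeries G := fun w =>
  ∑ i ∈ Finset.range (w.length + 1),
    (p (w.take i) * q (w.drop i) -
      (-1 : ℚ) ^ (wordDeg deg (w.take i) * wordDeg deg (w.drop i)) *
        (q (w.take i) * p (w.drop i)))

/-- The elements of the (non-completed) graded Lie algebra generated by the generators in `S`. -/
inductive IsLiePoly (S : Set G) : NCSeries G → Prop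
  | zero : IsLiePoly S 0
  | of (g : G) (hg : g ∈ S) : IsLiePoly S (NCSeries.of g)
  | add (p q : NCSeries G) : IsLiePoly S p → IsLiePoly S q → IsLiePoly S (p + q)
  | smul (c : ℚ) (p : NCSeries G) : IsLiePoly S p → IsLiePoly S (c • p)
  | bracket (p q : NCSeries G) : IsLiePoly S p → IsLiePoly S q →
      IsLiePoly S (NCSeries.bracket deg p q)

theorem homPart_zero (m : ℕ) : homPart m (0 : NCSeries G) = 0 := by
  funext w
  change (if w.length = m then (0 : ℚ) else 0) = 0
  simp

theorem homPart_add (m : ℕ) (p q : NCSeries G) :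
    homPart m (p + q) = homPart m p + homPart m q := by
  funext w
  change (if w.length = m then p w + q w else 0) =
    (if w.length = m then p w else 0) + (if w.length = m then q w else 0)
  split_ifs <;> simp

theorem homPart_smul (m : ℕ) (c : ℚ) (p : NCSeries G) :
    homPart m (c • p) = c • homPart m p := by
  funext w
  change (if w.length = m then c * p w else 0) = c * (if w.length = m then p w else 0)
  split_ifs <;> simp

/-- The Lie series in the generators of `S`: the completed graded Lie subalgebra generated
by `S`. -/
noncomputable def lieSeries (S : Set G) : Submodule ℚ (NCSeries G) where
  carrier := {p | ∀ m, IsLiePoly deg S (homPart m p)}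
  zero_mem' := fun m => by
    rw [homPart_zero]
    exact IsLiePoly.zero
  add_mem' := fun hp hq m => by
    rw [homPart_add]
    exact IsLiePoly.add _ _ (hp m) (hq m)
  smul_mem' := fun c _ hp m => by
    rw [homPart_smul]
    exact IsLiePoly.smul c _ (hp m)

/-- The homogeneous Lie series of degree `d`. -/
noncomputable def piece (d : ℤ) : Submodule ℚ (NCSeries G) where
  carrier := {p | p ∈ lieSeries deg Set.univ ∧ ∀ w, p w ≠ 0 → wordDeg deg w = d}
  zero_mem' := ⟨Submodule.zero_mem _, fun _ h => absurd rfl h⟩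
  add_mem' := fun {p q} hp hq => ⟨Submodule.add_mem _ hp.1 hq.1, fun w h => by
    by_cases hpw : p w = 0
    · refine hq.2 w fun hqw => h ?_
      change p w + q w = 0
      rw [hpw, hqw, add_zero]
    · exact hp.2 w hpw⟩
  smul_mem' := fun c p hp => ⟨Submodule.smul_mem _ c hp.1, fun w h => hp.2 w fun hpw => h (by
    change c * p w = 0
    rw [hpw, mul_zero])⟩

/-- The underlying space `⨁ d, piece deg d` of the completed free graded Lie algebra. -/
noncomputable def total : Submodule ℚ (NCSeries G) := ⨆ d, piece deg d

theorem piece_le_total (d : ℤ) : piece deg d ≤ total deg := le_iSup (piece deg) d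

theorem of_mem_piece (g : G) : of g ∈ piece deg (deg g) := by
  classical
  refine ⟨fun m => ?_, fun w h => ?_⟩
  · by_cases hm : m = 1
    · have : homPart m (of g) = of g := by
        funext w
        change (if w.length = m then of g w else 0) = of g w
        split_ifs with hw
        · rfl
        · have : w ≠ [g] := fun h => hw (by rw [h, hm]; rfl)
          simp [of, this]
      rw [this]
      exact IsLiePoly.of g (Set.mem_univ g)
    · have : homPart m (of g) = 0 := by
        funext w
        change (if w.length = m then of g w else 0) = 0
        split_ifs with hw
        · have : w ≠ [g] := fun h => hm (by rw [← hw, h]; rfl)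
          simp [of, this]
        · rfl
      rw [this]
      exact IsLiePoly.zero
  · have hw : w = [g] := by
      by_contra hne
      exact h (by simp [of, hne])
    simp [hw, wordDeg]

theorem bracket_add_left (p p' q : NCSeries G) :
    bracket deg (p + p') q = bracket deg p q + bracket deg p' q := by
  funext w
  change _ = bracket deg p q w + bracket deg p' q w
  simp only [bracket, ← Finset.sum_add_distrib]
  refine Finset.sum_congr rfl fun i _ => ?_
  change (p _ + p' _) * _ - _ * (_ * (p _ + p' _)) = _
  ring

theorem bracket_add_right (p q q' : NCSeries G) :
    bracket deg p (q + q') = bracket deg p q + bracket deg p q' := by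
  funext w
  change _ = bracket deg p q w + bracket deg p q' w
  simp only [bracket, ← Finset.sum_add_distrib]
  refine Finset.sum_congr rfl fun i _ => ?_
  change _ * (q _ + q' _) - _ * ((q _ + q' _) * _) = _
  ring

theorem bracket_smul_left (c : ℚ) (p q : NCSeries G) :
    bracket deg (c • p) q = c • bracket deg p q := by
  funext w
  change _ = c * bracket deg p q w
  simp only [bracket, Finset.mul_sum]
  refine Finset.sum_congr rfl fun i _ => ?_
  change (c * p _) * _ - _ * (_ * (c * p _)) = _
  ring

theorem bracket_smul_right (c : ℚ) (p q : NCSeries G) :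
    bracket deg p (c • q) = c • bracket deg p q := by
  funext w
  change _ = c * bracket deg p q w
  simp only [bracket, Finset.mul_sum]
  refine Finset.sum_congr rfl fun i _ => ?_
  change _ * (c * q _) - _ * ((c * q _) * _) = _
  ring

theorem isLiePoly_sum (S : Set G) {α : Type} (s : Finset α) (f : α → NCSeries G)
    (h : ∀ i ∈ s, IsLiePoly deg S (f i)) : IsLiePoly deg S (∑ i ∈ s, f i) := by
  classical
  induction s using Finset.induction_on with
  | empty =>
    rw [Finset.sum_empty]
    exact IsLiePoly.zero
  | insert i s hi ih =>
    rw [Finset.sum_insert hi]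
    exact IsLiePoly.add _ _ (h i (Finset.mem_insert_self i s))
      (ih fun j hj => h j (Finset.mem_insert_of_mem hj))

theorem sum_apply {α : Type} (s : Finset α) (f : α → NCSeries G) (w : List G) :
    (∑ i ∈ s, f i) w = ∑ i ∈ s, f i w :=
  Finset.sum_apply w s f

theorem sum_homPart_mul (m : ℕ) (p q : NCSeries G) (u v : List G) :
    ∑ ij ∈ Finset.HasAntidiagonal.antidiagonal m, homPart ij.1 p u * homPart ij.2 q v =
      if u.length + v.length = m then p u * q v else 0 := by
  split_ifs with h
  · rw [Finset.sum_eq_single (u.length, v.length)]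
    · simp [homPart]
    · rintro ⟨i, j⟩ - hij
      by_cases hi : u.length = i
      · have hj : v.length ≠ j := fun hj => hij (by rw [hi, hj])
        simp [homPart, hj]
      · simp [homPart, hi]
    · intro hn
      exact absurd (Finset.HasAntidiagonal.mem_antidiagonal.2 h) hn
  · refine Finset.sum_eq_zero fun ij hij => ?_
    rw [Finset.HasAntidiagonal.mem_antidiagonal] at hij
    by_cases hi : u.length = ij.1
    · have hj : v.length ≠ ij.2 := fun hj => h (by rw [hi, hj, hij])
      simp [homPart, hj]
    · simp [homPart, hi]

theorem homPart_bracket (m : ℕ) (p q : NCSeries G) :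
    homPart m (bracket deg p q) =
      ∑ ij ∈ Finset.HasAntidiagonal.antidiagonal m, bracket deg (homPart ij.1 p) (homPart ij.2 q) := by
  funext w
  rw [sum_apply]
  simp only [bracket]
  rw [Finset.sum_comm]
  change (if w.length = m then ∑ i ∈ Finset.range (w.length + 1), _ else 0) = _
  have key : ∀ i ∈ Finset.range (w.length + 1),
      (∑ ij ∈ Finset.HasAntidiagonal.antidiagonal m,
        (homPart ij.1 p (w.take i) * homPart ij.2 q (w.drop i) -
          (-1 : ℚ) ^ (wordDeg deg (w.take i) * wordDeg deg (w.drop i)) *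
            (homPart ij.2 q (w.take i) * homPart ij.1 p (w.drop i)))) =
        if w.length = m then p (w.take i) * q (w.drop i) -
          (-1 : ℚ) ^ (wordDeg deg (w.take i) * wordDeg deg (w.drop i)) *
            (q (w.take i) * p (w.drop i)) else 0 := by
    intro i _
    have hl : (w.take i).length + (w.drop i).length = w.length := by
      rw [← List.length_append, List.take_append_drop]
    have h2 := Finset.Nat.sum_antidiagonal_swap (n := m)
      (f := fun ij : ℕ × ℕ => homPart ij.1 q (w.take i) * homPart ij.2 p (w.drop i))
    simp only [Prod.fst_swap, Prod.snd_swap] at h2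
    rw [Finset.sum_sub_distrib, ← Finset.mul_sum, h2, sum_homPart_mul, sum_homPart_mul, hl]
    split_ifs <;> simp
  rw [Finset.sum_congr rfl key]
  split_ifs <;> simp

theorem bracket_mem_lieSeries {S : Set G} {p q : NCSeries G} (hp : p ∈ lieSeries deg S)
    (hq : q ∈ lieSeries deg S) : bracket deg p q ∈ lieSeries deg S := fun m => by
  rw [homPart_bracket]
  exact isLiePoly_sum deg S _ _ fun ij _ => IsLiePoly.bracket _ _ (hp ij.1) (hq ij.2)

theorem bracket_mem_piece {m n : ℤ} {p q : NCSeries G} (hp : p ∈ piece deg m)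
    (hq : q ∈ piece deg n) : bracket deg p q ∈ piece deg (m + n) := by
  refine ⟨bracket_mem_lieSeries deg hp.1 hq.1, fun w h => ?_⟩
  obtain ⟨i, -, hi⟩ := Finset.exists_ne_zero_of_sum_ne_zero h
  have hw : wordDeg deg w = wordDeg deg (w.take i) + wordDeg deg (w.drop i) := by
    rw [wordDeg, wordDeg, wordDeg, ← List.sum_append, ← List.map_append, List.take_append_drop]
  rw [hw]
  by_cases h1 : p (w.take i) * q (w.drop i) = 0
  · have h2 : q (w.take i) * p (w.drop i) ≠ 0 := fun h2 => hi (by rw [h1, h2]; simp)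
    rw [hq.2 _ (left_ne_zero_of_mul h2), hp.2 _ (right_ne_zero_of_mul h2), add_comm]
  · rw [hp.2 _ (left_ne_zero_of_mul h1), hq.2 _ (right_ne_zero_of_mul h1)]

theorem bracket_mem_total {p q : NCSeries G} (hp : p ∈ total deg) (hq : q ∈ total deg) :
    bracket deg p q ∈ total deg := by
  refine Submodule.iSup_induction (piece deg) (motive := fun p => bracket deg p q ∈ total deg)
    hp (fun m x hx => ?_) ?_ fun x y hx hy => ?_
  · refine Submodule.iSup_induction (piece deg) (motive := fun q => bracket deg x q ∈ total deg)
      hq (fun n y hy => ?_) ?_ fun y z hy hz => ?_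
    · exact piece_le_total deg _ (bracket_mem_piece deg hx hy)
    · have : bracket deg x 0 = 0 := by simpa using bracket_smul_right deg 0 x 0
      rw [this]
      exact Submodule.zero_mem _
    · rw [bracket_add_right]
      exact Submodule.add_mem _ hy hz
  · have : bracket deg 0 q = 0 := by simpa using bracket_smul_left deg 0 0 q
    rw [this]
    exact Submodule.zero_mem _
  · rw [bracket_add_left]
    exact Submodule.add_mem _ hx hy

end NCSeries

open NCSeries

/-- The completed free graded Lie algebra over `ℚ` on generators `g : G` of degree `deg g`. -/
abbrev FreeGLA {G : Type} (deg : G → ℤ) : Type := ↥(total deg)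

namespace FreeGLA

variable {G : Type} (deg : G → ℤ)

/-- The generators. -/
noncomputable def gen (g : G) : FreeGLA deg :=
  ⟨of g, piece_le_total deg _ (of_mem_piece deg g)⟩

/-- The part of degree `d`. -/
noncomputable def grade (d : ℤ) : Submodule ℚ (FreeGLA deg) := (piece deg d).comap (total deg).subtype

/-- The Lie bracket. -/
noncomputable def lie : FreeGLA deg →ₗ[ℚ] FreeGLA deg →ₗ[ℚ] FreeGLA deg :=
  LinearMap.mk₂ ℚ (fun x y => ⟨bracket deg x.1 y.1, bracket_mem_total deg x.2 y.2⟩)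
    (fun x y z => Subtype.ext (bracket_add_left deg x.1 y.1 z.1))
    (fun c x y => Subtype.ext (bracket_smul_left deg c x.1 y.1))
    (fun x y z => Subtype.ext (bracket_add_right deg x.1 y.1 z.1))
    (fun c x y => Subtype.ext (bracket_smul_right deg c x.1 y.1))

end FreeGLA

/-- `V = ⨁ d, 𝒜 d` with the bracket `br` and the differential `∂` is a differential graded Lie
algebra over `ℚ` (with differential of degree `-1`). -/
structure IsDGLA {V : Type} [AddCommGroup V] [Module ℚ V] (𝒜 : ℤ → Submodule ℚ V)
    (br : V →ₗ[ℚ] V →ₗ[ℚ] V) (d : V →ₗ[ℚ] V) : Prop where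
  isInternal : DirectSum.IsInternal 𝒜
  br_mem : ∀ (m n : ℤ) (x y : V), x ∈ 𝒜 m → y ∈ 𝒜 n → br x y ∈ 𝒜 (m + n)
  d_mem : ∀ (m : ℤ) (x : V), x ∈ 𝒜 m → d x ∈ 𝒜 (m - 1)
  d_d : ∀ x : V, d (d x) = 0
  br_symm : ∀ (m n : ℤ) (x y : V), x ∈ 𝒜 m → y ∈ 𝒜 n →
    br y x = -((-1 : ℚ) ^ (m * n) • br x y)
  jacobi : ∀ (l m n : ℤ) (x y z : V), x ∈ 𝒜 l → y ∈ 𝒜 m → z ∈ 𝒜 n →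
    (-1 : ℚ) ^ (l * m) • br (br y z) x + (-1 : ℚ) ^ (m * n) • br (br z x) y +
      (-1 : ℚ) ^ (n * l) • br (br x y) z = 0
  leibniz : ∀ (m n : ℤ) (x y : V), x ∈ 𝒜 m → y ∈ 𝒜 n →
    d (br x y) = br (d x) y + (-1 : ℚ) ^ m • br x (d y)

section Differential

variable {G : Type} {deg : G → ℤ}

/-- A linear map respects the filtration by the number of brackets, i.e. it induces maps of the
tower of quotients by the expressions with more than `N` brackets. -/
def IsFiltered (D : FreeGLA deg →ₗ[ℚ] FreeGLA deg) : Prop :=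
  ∀ (m : ℕ) (x : FreeGLA deg), OrderGE m x.1 → OrderGE m (D x).1

/-- A derivation of degree `-1` of the completed free graded Lie algebra. -/
structure IsGradedDerivation (D : FreeGLA deg →ₗ[ℚ] FreeGLA deg) : Prop where
  filtered : IsFiltered D
  mem : ∀ (m : ℤ) (x : FreeGLA deg), x ∈ FreeGLA.grade deg m → D x ∈ FreeGLA.grade deg (m - 1)
  leibniz : ∀ (m n : ℤ) (x y : FreeGLA deg), x ∈ FreeGLA.grade deg m → y ∈ FreeGLA.grade deg n →
    D (FreeGLA.lie deg x y) =
      FreeGLA.lie deg (D x) y + (-1 : ℚ) ^ m • FreeGLA.lie deg x (D y)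

open Classical in
/-- The value of `D` on a series which is an element of the completed free graded Lie algebra (and
`0` on all other series). -/
noncomputable def diffAt (D : FreeGLA deg →ₗ[ℚ] FreeGLA deg) (p : NCSeries G) : NCSeries G :=
  if h : p ∈ total deg then (D ⟨p, h⟩).1 else 0

/-- The twisted differential `∂ p + [a, p]`. -/
noncomputable def twistedDiff (D : FreeGLA deg →ₗ[ℚ] FreeGLA deg) (a p : NCSeries G) :
    NCSeries G :=
  diffAt D p + bracket deg a p

/-- A point: an element of degree `-1` satisfying the Maurer-Cartan equation. -/
def IsPoint (D : FreeGLA deg →ₗ[ℚ] FreeGLA deg) (a : NCSeries G) : Prop :=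
  a ∈ piece deg (-1) ∧ diffAt D a + (1 / 2 : ℚ) • bracket deg a a = 0

/-- The unit time flow `exp (-ad e) a + ((1 - exp (-ad e)) / ad e) (∂ e)` of `a` by `e`, where `e`
has degree `0` and `a` has degree `-1`. -/
noncomputable def flow (D : FreeGLA deg →ₗ[ℚ] FreeGLA deg) (e a : NCSeries G) : NCSeries G :=
  expOp (-bracket deg e) a +
    opSeries (fun k => (-1) ^ k / ((k + 1).factorial : ℚ)) (bracket deg e) (diffAt D e)

end Differential

/-- A series `Q` in two non-commuting variables `X = ad x` and `Y = ad y` with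
`BCH(x, y) = x + y + Q(X, Y) y`, an identity in the completed free Lie algebra on `x` and `y`
(of degree zero). -/
def IsBCHRemainder (Q : NCSeries (Fin 2)) : Prop :=
  bch (of 0) (of 1) = of (0 : Fin 2) + of 1 +
    evalOp ![bracket (fun _ => 0) (of 0), bracket (fun _ => 0) (of 1)] Q (of 1)

/-- A universal average of a finite family of arguments indexed by `ι`: a Lie series `μ` in
variables of degree `0` which is totally symmetric, and such that in any model in which all the
elements `x i` of degree `0` flow from the point `a` to the point `b` also the average of the `x i`
flows from `a` to `b`. -/
structure IsUniversalAverage {ι : Type} [Fintype ι] (μ : NCSeries ι) : Prop where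
  lie : μ ∈ lieSeries (fun _ : ι => (0 : ℤ)) Set.univ
  symmetric : ∀ (π : Equiv.Perm ι) (w : List ι), μ (w.map π) = μ w
  flow_eq : ∀ (G : Type) [Finite G] (deg : G → ℤ) (D : FreeGLA deg →ₗ[ℚ] FreeGLA deg),
    IsDGLA (FreeGLA.grade deg) (FreeGLA.lie deg) D → IsFiltered D →
    ∀ (a b : NCSeries G) (x : ι → NCSeries G), IsPoint D a → IsPoint D b →
      (∀ i, x i ∈ piece deg 0 ∧ flow D (x i) a = b) → flow D (subst x μ) a = b

/-- The universal average of two elements, `BCH(x, BCH(-x, y) / 2)`. -/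
noncomputable def average₂ {G : Type} (x y : NCSeries G) : NCSeries G :=
  bch x ((1 / 2 : ℚ) • bch (-x) y)

section Model

variable {C : Type} (dim : C → ℕ) (inc : C → C → ℤ)

/-- The degree of the generator of a cell: its dimension minus one. -/
def cellDeg (c : C) : ℤ := (dim c : ℤ) - 1

/-- The cells in the closure of a cell of a regular cell complex with incidence numbers `inc`
(`inc c c'` is the coefficient of `c'` in the geometric boundary of `c`). -/
def cellClosure (c : C) : Set C := {c' | Relation.ReflTransGen (fun x y => inc x y ≠ 0) c c'}

/-- The cells in the closure of the geometric boundary of a cell. -/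
def boundaryClosure (c : C) : Set C := {c' | Relation.TransGen (fun x y => inc x y ≠ 0) c c'}

/-- The completed free graded Lie algebra on the cells, with differential `D`, is a DGLA model of
the regular cell complex with cells `C`, dimensions `dim` and incidence numbers `inc`. -/
structure IsModel (D : FreeGLA (cellDeg dim) →ₗ[ℚ] FreeGLA (cellDeg dim)) : Prop where
  isDGLA : IsDGLA (FreeGLA.grade (cellDeg dim)) (FreeGLA.lie (cellDeg dim)) D
  filtered : IsFiltered D
  vertex : ∀ c, dim c = 0 → IsPoint D (of c)
  geometric : ∀ c c', (D (FreeGLA.gen _ c)).1 [c'] = (inc c c' : ℚ)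
  locality : ∀ c, (D (FreeGLA.gen _ c)).1 ∈ lieSeries (cellDeg dim) (cellClosure inc c)

/-- The cell `c` is localised at the point `x` in the model. -/
def IsLocalisedAt (D : FreeGLA (cellDeg dim) →ₗ[ℚ] FreeGLA (cellDeg dim)) (c : C)
    (x : NCSeries C) : Prop :=
  1 < dim c ∧ IsPoint D x ∧
    twistedDiff D x (of c) ∈ lieSeries (cellDeg dim) (boundaryClosure inc c)

variable {dim} in
/-- The signed permutation `c ↦ s c • π c` of the cells is a symmetry of the model: it extends to
an automorphism of the DGLA. -/
def IsModelSymmetry (D : FreeGLA (cellDeg dim) →ₗ[ℚ] FreeGLA (cellDeg dim)) (π : C → C)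
    (s : C → ℚ) : Prop :=
  ∃ Φ : FreeGLA (cellDeg dim) ≃ₗ[ℚ] FreeGLA (cellDeg dim),
    IsFiltered Φ.toLinearMap ∧ IsFiltered Φ.symm.toLinearMap ∧
    (∀ (d : ℤ) (x : FreeGLA (cellDeg dim)),
      x ∈ FreeGLA.grade _ d → Φ x ∈ FreeGLA.grade _ d) ∧
    (∀ x y, Φ (FreeGLA.lie _ x y) = FreeGLA.lie _ (Φ x) (Φ y)) ∧
    (∀ c, Φ (FreeGLA.gen _ c) = s c • FreeGLA.gen _ (π c)) ∧
    ∀ x, Φ (D x) = D (Φ x)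

end Model

/-- The cells of the banana with `n` facets; indices are taken modulo `n`. -/
inductive BananaCell (n : ℕ) : Type
  | a : BananaCell n
  | b : BananaCell n
  | e (i : ZMod n) : BananaCell n
  | f (i : ZMod n) : BananaCell n
  | h : BananaCell n

namespace Banana

variable {n : ℕ}

/-- The dimensions of the cells. -/
def dim : BananaCell n → ℕ
  | .a => 0
  | .b => 0
  | .e _ => 1
  | .f _ => 2
  | .h => 3

/-- The geometric boundary: `e i ↦ b - a`, `f i ↦ e i - e (i + 1)` and `h ↦ ∑ i, f i`. -/
def inc : BananaCell n → BananaCell n → ℤ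
  | .e _, .a => -1
  | .e _, .b => 1
  | .f i, .e j => (if j = i then 1 else 0) - (if j = i + 1 then 1 else 0)
  | .h, .f _ => 1
  | _, _ => 0

/-- The action of the dihedral group on the cells, up to sign: `r k` is the `k`-th power of the
rotation `τ` with `e i ↦ e (i + 1)` and `f i ↦ f (i + 1)`, and `sr k` is the composite of the `k`-th
power of `τ` followed by the reflection `σ` with `e i ↦ e (-i)` and `f i ↦ - f (-i - 1)`. -/
def dihedralPerm : DihedralGroup n → BananaCell n → BananaCell n
  | _, .a => .a
  | _, .b => .b
  | .r k, .e i => .e (i + k)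
  | .sr k, .e i => .e (-(i + k))
  | .r k, .f i => .f (i + k)
  | .sr k, .f i => .f (-(i + k) - 1)
  | _, .h => .h

/-- The signs of the action of the dihedral group on the oriented cells. -/
def dihedralSign : DihedralGroup n → BananaCell n → ℚ
  | .sr _, .f _ => -1
  | .sr _, .h => -1
  | _, _ => 1

/-- The bracket in the completed free graded Lie algebra on the cells of the banana, as an
operator in the second argument. -/
noncomputable abbrev ad (x : NCSeries (BananaCell n)) :
    NCSeries (BananaCell n) → NCSeries (BananaCell n) :=
  bracket (cellDeg dim) x

/-- The operators `E_i = ad e_i`. -/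
noncomputable abbrev E (i : ZMod n) : NCSeries (BananaCell n) → NCSeries (BananaCell n) :=
  ad (of (.e i))

/-- The centreline `v_i` of the bigon `f_i`. -/
noncomputable def faceAxis (i : ZMod n) : NCSeries (BananaCell n) :=
  average₂ (of (.e i)) (of (.e (i + 1)))

/-- The element `f'_i = exp (ad v_i / 2) f_i`. -/
noncomputable def twistedFace (i : ZMod n) : NCSeries (BananaCell n) :=
  expOp (ad ((1 / 2 : ℚ) • faceAxis i)) (of (.f i))

/-- The centreline `v = μ (e_1, …, e_n)` of the banana. -/
noncomputable def axis [NeZero n] (μ : NCSeries (ZMod n)) : NCSeries (BananaCell n) :=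
  subst (fun i => of (.e i)) μ

/-- The Lie algebra of the model. -/
abbrev Alg (n : ℕ) : Type := FreeGLA (cellDeg (dim (n := n)))

/-- The centre of the bigon `f_i`, halfway along its centreline from `a`. -/
noncomputable def faceCentre (D : Alg n →ₗ[ℚ] Alg n) (i : ZMod n) : NCSeries (BananaCell n) :=
  flow D ((1 / 2 : ℚ) • faceAxis i) (of .a)

/-- The centre of the banana, halfway along its centreline from `a`. -/
noncomputable def centre [NeZero n] (μ : NCSeries (ZMod n)) (D : Alg n →ₗ[ℚ] Alg n) :
    NCSeries (BananaCell n) :=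
  flow D ((1 / 2 : ℚ) • axis μ) (of .a)

/-- `D` is the differential with the explicit values on the generators. -/
structure IsExplicitDifferential [NeZero n] (Q : NCSeries (Fin 2)) (μ : NCSeries (ZMod n))
    (D : Alg n →ₗ[ℚ] Alg n) : Prop where
  derivation : IsGradedDerivation D
  d_a : (D (FreeGLA.gen _ .a)).1 = -((1 / 2 : ℚ) • bracket (cellDeg dim) (of .a) (of .a))
  d_b : (D (FreeGLA.gen _ .b)).1 = -((1 / 2 : ℚ) • bracket (cellDeg dim) (of .b) (of .b))
  /-- `∂ e_i = (E / (1 - exp E)) a + (E / (1 - exp (-E))) b` with `E = E_i`. -/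
  d_e : ∀ i, (D (FreeGLA.gen _ (.e i))).1 =
    opSeries (fun k => -(bernoulli k / (k.factorial : ℚ))) (E i) (of .a) +
      opSeries (fun k => bernoulli' k / (k.factorial : ℚ)) (E i) (of .b)
  d_f : ∀ i, (D (FreeGLA.gen _ (.f i))).1 =
    bch (bch (bch (-((1 / 2 : ℚ) • faceAxis i)) (of (.e i))) (-of (.e (i + 1))))
        ((1 / 2 : ℚ) • faceAxis i) -
      bracket (cellDeg dim) (faceCentre D i) (of (.f i))
  d_h : expOp (ad ((1 / 2 : ℚ) • axis μ)) (twistedDiff D (centre μ D) (of .h)) =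
    ∑ i : ZMod n, twistedFace i +
      (1 / (2 * (n : ℚ))) • ∑ i : ZMod n, ∑ j : ZMod n with j ≠ i ∧ j ≠ i + 1,
        (evalOp ![bchOp (E j) (-E i), bchOp (E i) (-E (i + 1))] Q (twistedFace i) +
          evalOp ![bchOp (E j) (-E (i + 1)), bchOp (E (i + 1)) (-E i)] Q (twistedFace i))

end Banana

/-! The completed free graded Lie algebra sits in the algebra of non-commutative power series, with
the graded commutator as bracket. There `e^x` is an honest series, and `u_x(p) = q` becomes the
gauge equation `p e^x + ∂e^x = e^x q` (`FlowsTo`, `flow_eq`). Consequently flows compose by BCH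
(`FlowsTo.trans`), conjugation by `e^x` exchanges `∂_p` and `∂_q` (`FlowsTo.twist_conj`), and `x`
flows `p` to itself exactly when `∂_p x = 0` (`flowsTo_self_iff`).

The Bernoulli series in `∂e_i` say precisely that `e_i` flows from `a` to `b`. So the loops `ℓ_{jk}
= BCH(e_j, -e_k)` are `∂_a`-closed, and they compose: `BCH(ℓ_{ij}, ℓ_{jk}) = ℓ_{ik}`. The formula
for `∂f_i` says that `∂_{x_i} f_i` is the loop `ℓ_{i,i+1}` transported from `a` to `x_i`;
transported back, `∂_a f'_i = ℓ_{i,i+1}` (`twist_twistedFace`).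

The solid cell needs a `∂_a`-closed element with bracket-free part `∑ f_i`. The sum of the `f'_i`
has boundary `∑ ℓ_{i,i+1}`, which need not vanish. Since `∂_a` commutes with `ad ℓ`, the boundary of
`Q(ad ℓ_{ji}, ad ℓ_{i,i+1}) f'_i` is `Q(ad ℓ_{ji}, ad ℓ_{i,i+1}) ℓ_{i,i+1} = ℓ_{j,i+1} - ℓ_{ji} -
ℓ_{i,i+1}`, by the defining identity of `Q` applied to two composable loops. The second `Q`-term,
with the two edges of the bigon exchanged, has the same boundary. For fixed `j`, the sum over `i` of
the first two loops cancels cyclically and leaves `-∑ ℓ_{i,i+1}`. Averaging over the `n` choices of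
`j` and the two orders gives the factor `1/(2n)` and a closed total (`twist_solidBoundary`).
Transporting it to `x` makes `∂_x² h = 0`, and `∂_x² = ∂²` because `x` is a point.

For the symmetry, each ingredient is natural: `μ_2` and `μ` are symmetric, and a reflection swaps
the two `Q`-terms while reversing `f_i` and `h`. Uniqueness holds because `x_i` and `x` depend only
on the differential of vertices and edges, so the formulas fix all values on generators.

Existence of `μ`: solve `∑ BCH(x_i, -c) = 0` by successive approximation; every approximation flows
from `a` to `b` because the loops at `a` form a linear space. Existence of `Q`: every Lie polynomial
in `x, y` is `c x + P(ad x, ad y) y`. Both rest on the Baker-Campbell-Hausdorff theorem, proved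
through the Euler derivation. -/

/-! ### Identities for exp, log and the Bernoulli series -/

namespace PowerSeries

theorem one_add_X_mul_deriv_log : (1 + X) * d⁄dX ℚ (log ℚ) = 1 := by
  rw [deriv_log]
  ext n
  rw [add_mul, one_mul, map_add]
  cases n with
  | zero => simp
  | succ n => rw [coeff_succ_X_mul]; simp [pow_succ, coeff_one]

/-- Both sides have constant term 0 and derivative 1: the chain rule gives `log'(e^X - 1) e^X`, and
substituting `e^X - 1` in `(1 + X) log' = 1` evaluates this. -/
theorem log_subst_exp_sub_one : (log ℚ).subst (exp ℚ - 1) = (X : ℚ⟦X⟧) := by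
  have hs : HasSubst (exp ℚ - 1) := HasSubst.exp_sub_one
  refine derivative.ext ?_ ?_
  · rw [derivative_subst hs, derivative_X, map_sub, derivative_one, sub_zero, derivative_exp]
    have h := congrArg (PowerSeries.subst (exp ℚ - 1)) one_add_X_mul_deriv_log
    have h1 : (1 : ℚ⟦X⟧).subst (exp ℚ - 1) = (1 : ℚ⟦X⟧) := by
      rw [← coe_substAlgHom hs, map_one]
    rw [subst_mul hs, subst_add hs, subst_X hs, h1] at h
    rw [mul_comm]
    rwa [add_sub_cancel] at h
  · rw [constantCoeff_X]
    exact constantCoeff_subst_eq_zero (by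
      rw [map_sub, map_one, ← constantCoeff_eq, constantCoeff_exp, sub_self]) _ constantCoeff_log

/-- With `q = 1/(1+X)` and `F = e^{log(1+X)}` one has `F' = Fq` and `q' = -q²`, so `Fq` has
derivative 0 and constant term 1. -/
theorem exp_subst_log : (exp ℚ).subst (log ℚ) = (1 + X : ℚ⟦X⟧) := by
  have hs : HasSubst (log ℚ) := HasSubst.log
  set q := d⁄dX ℚ (log ℚ) with hq
  have h1 : (1 + X) * q = 1 := one_add_X_mul_deriv_log
  have hF : d⁄dX ℚ ((exp ℚ).subst (log ℚ) : ℚ⟦X⟧) = (exp ℚ).subst (log ℚ) * q := by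
    rw [derivative_subst hs, derivative_exp]
  have hq' : d⁄dX ℚ q = -(q * q) := by
    have h2 := congrArg (d⁄dX ℚ) h1
    rw [Derivation.leibniz, derivative_one, map_add, derivative_one, derivative_X, zero_add,
      smul_eq_mul, smul_eq_mul, mul_one] at h2
    linear_combination q * h2 - (d⁄dX ℚ q) * h1
  have h3 : (exp ℚ).subst (log ℚ) * q = 1 := by
    refine derivative.ext ?_ ?_
    · rw [Derivation.leibniz, hF, hq', derivative_one, smul_eq_mul, smul_eq_mul]
      ring
    · rw [map_mul, map_one]
      have h4 := congrArg (constantCoeff (R := ℚ)) h1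
      rw [map_mul, map_add, map_one, constantCoeff_X, add_zero, one_mul] at h4
      rw [h4, mul_one]
      -- The substitution lemma needs an outer series without constant term, hence `exp - 1`.
      have h5 := constantCoeff_subst_eq_zero (a := (log ℚ : ℚ⟦X⟧)) constantCoeff_log
        (exp ℚ - 1) (by simp)
      rw [subst_sub hs, map_sub] at h5
      have h6 : (1 : ℚ⟦X⟧).subst (log ℚ) = (1 : ℚ⟦X⟧) := by
        rw [← coe_substAlgHom hs, map_one]
      rw [h6] at h5
      have h7 := sub_eq_zero.1 h5
      exact h7.trans (by rw [← constantCoeff_eq]; simp)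
  linear_combination (1 + X) * h3 - (exp ℚ).subst (log ℚ) * h1

/-- The series `(1 - exp (-X)) / X`. -/
noncomputable def expQuot : ℚ⟦X⟧ := mk fun k => (-1) ^ k / ((k + 1).factorial : ℚ)

theorem X_mul_expQuot_mul_exp : X * expQuot * exp ℚ = exp ℚ - 1 := by
  have h : X * expQuot = 1 - evalNegHom (exp ℚ) := by
    ext n
    cases n with
    | zero =>
      rw [coeff_zero_X_mul, map_sub, evalNegHom, coeff_rescale]
      simp
    | succ n =>
      rw [coeff_succ_X_mul, expQuot, coeff_mk, map_sub, evalNegHom, coeff_rescale, coeff_exp,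
        coeff_one, if_neg (Nat.succ_ne_zero n)]
      simp only [pow_succ, one_div, map_inv₀, eq_ratCast, Rat.cast_natCast]
      ring
  rw [h, sub_mul, one_mul, mul_comm, exp_mul_exp_neg_eq_one]

/-- The `bernoulli'` series is `X / (1 - e^{-X})`, the reciprocal of `expQuot`; the `bernoulli`
series of the next lemma is `X / (e^X - 1)`. Together they make the prescribed `∂e_i` the solution
of `u_{e_i}(a) = b`. Both follow by cancelling `X e^X` in a domain. -/
theorem expQuot_mul_bernoulli' : expQuot * bernoulli'PowerSeries ℚ = 1 := by
  have h := bernoulli'PowerSeries_mul_exp_sub_one ℚ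
  rw [← X_mul_expQuot_mul_exp] at h
  have he : IsUnit (exp ℚ) := isUnit_exp ℚ
  have h2 : (X * exp ℚ) * (expQuot * bernoulli'PowerSeries ℚ) = (X * exp ℚ) * 1 := by
    linear_combination h
  exact mul_left_cancel₀ (mul_ne_zero X_ne_zero he.ne_zero) h2

theorem expQuot_mul_bernoulli :
    expQuot * bernoulliPowerSeries ℚ = evalNegHom (exp ℚ) := by
  have h := bernoulliPowerSeries_mul_exp_sub_one ℚ
  rw [← X_mul_expQuot_mul_exp] at h
  have he : IsUnit (exp ℚ) := isUnit_exp ℚ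
  have h2 : (X * exp ℚ) * (expQuot * bernoulliPowerSeries ℚ) =
      (X * exp ℚ) * evalNegHom (exp ℚ) := by
    linear_combination h - X * exp_mul_exp_neg_eq_one (A := ℚ)
  exact mul_left_cancel₀ (mul_ne_zero X_ne_zero he.ne_zero) h2

end PowerSeries

/-! ### The ring of non-commutative power series -/

namespace NCSeries

variable {G H : Type}

/-- The series of those words `w` for which `g :: w` is a word of `p`. -/
def shift (g : G) (p : NCSeries G) : NCSeries G := fun w => p (g :: w)

theorem zero_apply (w : List G) : (0 : NCSeries G) w = 0 := rfl
theorem add_apply (p q : NCSeries G) (w : List G) : (p + q) w = p w + q w := rfl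
theorem sub_apply (p q : NCSeries G) (w : List G) : (p - q) w = p w - q w := rfl
theorem neg_apply (p : NCSeries G) (w : List G) : (-p) w = -p w := rfl
theorem smul_apply (c : ℚ) (p : NCSeries G) (w : List G) : (c • p) w = c * p w := rfl

@[simp]
theorem shift_apply (g : G) (p : NCSeries G) (w : List G) : shift g p w = p (g :: w) := rfl

@[ext]
theorem ext {p q : NCSeries G} (h : ∀ w, p w = q w) : p = q := funext h

theorem mul_nil (p q : NCSeries G) : (p * q) [] = p [] * q [] := by
  change mul p q [] = _
  simp [mul]

/-- Recursion on the first letter: it replaces the reindexing of convolution sums by inductions on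
words. -/
theorem mul_cons (p q : NCSeries G) (g : G) (w : List G) :
    (p * q) (g :: w) = p [] * q (g :: w) + (shift g p * q) w := by
  change mul p q (g :: w) = _ + mul (shift g p) q w
  simp only [mul, List.length_cons]
  rw [Finset.sum_range_succ', add_comm]
  simp

theorem one_nil : (1 : NCSeries G) [] = 1 := rfl
theorem one_cons (g : G) (w : List G) : (1 : NCSeries G) (g :: w) = 0 := rfl

theorem shift_one (g : G) : shift g (1 : NCSeries G) = 0 := rfl
theorem shift_add (g : G) (p q : NCSeries G) : shift g (p + q) = shift g p + shift g q := rfl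
theorem shift_smul (g : G) (c : ℚ) (p : NCSeries G) : shift g (c • p) = c • shift g p := rfl

theorem add_mul_aux (p q r : NCSeries G) : (p + q) * r = p * r + q * r := by
  ext w
  induction w generalizing p q with
  | nil => simp only [mul_nil, add_apply]; ring
  | cons g w ih => rw [mul_cons, shift_add, ih, add_apply, add_apply, add_apply, mul_cons, mul_cons]; ring

theorem mul_add_aux (p q r : NCSeries G) : p * (q + r) = p * q + p * r := by
  ext w
  induction w generalizing p with
  | nil => simp only [mul_nil, add_apply]; ring
  | cons g w ih => rw [mul_cons, ih, add_apply, add_apply, add_apply, mul_cons, mul_cons]; ring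

theorem smul_mul_aux (c : ℚ) (p q : NCSeries G) : (c • p) * q = c • (p * q) := by
  ext w
  induction w generalizing p with
  | nil => simp only [mul_nil, smul_apply]; ring
  | cons g w ih => rw [mul_cons, shift_smul, ih, smul_apply, smul_apply, smul_apply, mul_cons]; ring

theorem mul_smul_aux (c : ℚ) (p q : NCSeries G) : p * (c • q) = c • (p * q) := by
  ext w
  induction w generalizing p with
  | nil => simp only [mul_nil, smul_apply]; ring
  | cons g w ih => rw [mul_cons, ih, smul_apply, smul_apply, smul_apply, mul_cons]; ring

theorem shift_mul (g : G) (p q : NCSeries G) : shift g (p * q) = p [] • shift g q + shift g p * q :=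
  ext fun w => mul_cons p q g w

theorem mul_assoc_aux (p q r : NCSeries G) : p * q * r = p * (q * r) := by
  ext w
  induction w generalizing p with
  | nil => simp only [mul_nil]; ring
  | cons g w ih =>
    rw [mul_cons, shift_mul, add_mul_aux, smul_mul_aux, add_apply, ih, smul_apply, mul_cons,
      mul_cons, mul_nil]
    ring

theorem zero_mul_aux (p : NCSeries G) : 0 * p = 0 := by
  simpa using smul_mul_aux 0 0 p

theorem mul_zero_aux (p : NCSeries G) : p * 0 = 0 := by
  simpa using mul_smul_aux 0 p 0

theorem one_mul_aux (p : NCSeries G) : 1 * p = p := by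
  ext w
  cases w with
  | nil => rw [mul_nil, one_nil, one_mul]
  | cons g w => rw [mul_cons, shift_one, zero_mul_aux, one_nil, one_mul, zero_apply, add_zero]

theorem mul_one_aux (p : NCSeries G) : p * 1 = p := by
  ext w
  induction w generalizing p with
  | nil => rw [mul_nil, one_nil, mul_one]
  | cons g w ih => rw [mul_cons, ih, one_cons, mul_zero, zero_add, shift_apply]

noncomputable instance : Ring (NCSeries G) :=
  { (inferInstance : AddCommGroup (NCSeries G)), (inferInstance : Mul (NCSeries G)),
    (inferInstance : One (NCSeries G)) with
    left_distrib := mul_add_aux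
    right_distrib := add_mul_aux
    zero_mul := zero_mul_aux
    mul_zero := mul_zero_aux
    mul_assoc := mul_assoc_aux
    one_mul := one_mul_aux
    mul_one := mul_one_aux }

noncomputable instance : Algebra ℚ (NCSeries G) :=
  Algebra.ofModule smul_mul_aux (fun c p q => mul_smul_aux c p q)

/-! ### The filtration by length -/

/-- The series all of whose words have length at least `m`. -/
def ord (G : Type) (m : ℕ) : Submodule ℚ (NCSeries G) where
  carrier := {p | OrderGE m p}
  zero_mem' := fun _ _ => rfl
  add_mem' := fun {p q} hp hq w hw => by rw [add_apply, hp w hw, hq w hw, add_zero]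
  smul_mem' := fun c p hp w hw => by rw [smul_apply, hp w hw, mul_zero]

theorem mem_ord {m : ℕ} {p : NCSeries G} : p ∈ ord G m ↔ ∀ w : List G, w.length < m → p w = 0 :=
  Iff.rfl

theorem mem_ord_zero (p : NCSeries G) : p ∈ ord G 0 := fun _ h => absurd h (Nat.not_lt_zero _)

theorem ord_mono {m n : ℕ} (h : m ≤ n) {p : NCSeries G} (hp : p ∈ ord G n) : p ∈ ord G m :=
  fun w hw => hp w (hw.trans_le h)

theorem mem_ord_one {p : NCSeries G} : p ∈ ord G 1 ↔ p [] = 0 := by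
  rw [mem_ord]
  refine ⟨fun h => h [] (by simp), fun h w hw => ?_⟩
  rw [List.length_eq_zero_iff.1 (Nat.lt_one_iff.1 hw), h]

theorem of_mem_ord (g : G) : of g ∈ ord G 1 := by
  rw [mem_ord_one]
  simp [of]

theorem mul_mem_ord {m n : ℕ} {p q : NCSeries G} (hp : p ∈ ord G m) (hq : q ∈ ord G n) :
    p * q ∈ ord G (m + n) := by
  intro w hw
  change ∑ i ∈ Finset.range (w.length + 1), p (w.take i) * q (w.drop i) = 0
  refine Finset.sum_eq_zero fun i hi => ?_
  rw [Finset.mem_range] at hi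
  by_cases h : (w.take i).length < m
  · rw [hp _ h, zero_mul]
  · rw [hq, mul_zero]
    rw [List.length_take] at h
    rw [List.length_drop]
    omega

/-- The filtration is separated, so equalities of infinite sums can be tested modulo every `ord G
m`. -/
theorem eq_of_forall_sub_mem_ord {p q : NCSeries G} (h : ∀ m, p - q ∈ ord G m) : p = q := by
  ext w
  have := h (w.length + 1) w (Nat.lt_succ_self _)
  rwa [sub_apply, sub_eq_zero] at this

/-- A linear map which respects the filtration by length. -/
def Filtered (Ψ : NCSeries G →ₗ[ℚ] NCSeries H) : Prop := ∀ m p, p ∈ ord G m → Ψ p ∈ ord H m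

/-- A linear operator which raises the length of words. -/
def Contracting (T : NCSeries G →ₗ[ℚ] NCSeries G) : Prop :=
  ∀ m p, p ∈ ord G m → T p ∈ ord G (m + 1)

theorem Filtered.comp {K : Type} {Ψ : NCSeries G →ₗ[ℚ] NCSeries H} {Ψ' : NCSeries H →ₗ[ℚ] NCSeries K}
    (h' : Filtered Ψ') (h : Filtered Ψ) : Filtered (Ψ' ∘ₗ Ψ) := fun _ _ hp => h' _ _ (h _ _ hp)

theorem Contracting.filtered {T : NCSeries G →ₗ[ℚ] NCSeries G} (h : Contracting T) : Filtered T :=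
  fun _ _ hp => ord_mono (Nat.le_succ _) (h _ _ hp)

theorem Contracting.pow {T : NCSeries G →ₗ[ℚ] NCSeries G} (h : Contracting T) (k m : ℕ)
    {p : NCSeries G} (hp : p ∈ ord G m) : (T ^ k) p ∈ ord G (m + k) := by
  induction k with
  | zero => simpa using hp
  | succ k ih => rw [pow_succ', Module.End.mul_apply]; exact h _ _ ih

theorem Contracting.pow_mem {T : NCSeries G →ₗ[ℚ] NCSeries G} (h : Contracting T) (k : ℕ)
    (p : NCSeries G) : (T ^ k) p ∈ ord G k := by
  simpa using h.pow k 0 (mem_ord_zero p)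

theorem contracting_mulLeft {x : NCSeries G} (hx : x ∈ ord G 1) :
    Contracting (LinearMap.mulLeft ℚ x) := fun _ _ hp => by
  rw [add_comm]; exact mul_mem_ord hx hp

theorem contracting_mulRight {x : NCSeries G} (hx : x ∈ ord G 1) :
    Contracting (LinearMap.mulRight ℚ x) := fun _ _ hp => mul_mem_ord hp hx

theorem filtered_mulLeft (x : NCSeries G) : Filtered (LinearMap.mulLeft ℚ x) := fun _ _ hp => by
  simpa using mul_mem_ord (mem_ord_zero x) hp

theorem filtered_mulRight (x : NCSeries G) : Filtered (LinearMap.mulRight ℚ x) :=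
  fun _ _ hp => by simpa using mul_mem_ord hp (mem_ord_zero x)

/-! ### Infinite sums -/

theorem seriesSum_sub_mem {t : ℕ → NCSeries G} (ht : ∀ k, t k ∈ ord G k) (N : ℕ) :
    seriesSum t - ∑ k ∈ Finset.range N, t k ∈ ord G N := by
  intro w hw
  rw [sub_apply, sum_apply, sub_eq_zero, seriesSum]
  refine Finset.sum_subset ?_ fun k _ hk => ?_
  · intro k hk
    rw [Finset.mem_range] at hk ⊢
    omega
  · rw [Finset.mem_range] at hk
    exact ht k w (by omega)

theorem eq_seriesSum {t : ℕ → NCSeries G} {q : NCSeries G} (ht : ∀ k, t k ∈ ord G k)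
    (hq : ∀ N, q - ∑ k ∈ Finset.range N, t k ∈ ord G N) : q = seriesSum t :=
  eq_of_forall_sub_mem_ord fun N => by
    have := Submodule.sub_mem _ (hq N) (seriesSum_sub_mem ht N)
    rwa [sub_sub_sub_cancel_right] at this

/-- Filtered maps are continuous: the tail of the sum stays in `ord` under `Ψ`. -/
theorem map_seriesSum {Ψ : NCSeries G →ₗ[ℚ] NCSeries H} (hΨ : Filtered Ψ) {t : ℕ → NCSeries G}
    (ht : ∀ k, t k ∈ ord G k) : Ψ (seriesSum t) = seriesSum fun k => Ψ (t k) :=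
  eq_seriesSum (fun k => hΨ _ _ (ht k)) fun N => by
    rw [← map_sum, ← map_sub]
    exact hΨ _ _ (seriesSum_sub_mem ht N)

theorem seriesSum_mem_ord {t : ℕ → NCSeries G} {m : ℕ} (ht : ∀ k, t k ∈ ord G m) :
    seriesSum t ∈ ord G m := fun w hw => Finset.sum_eq_zero fun k _ => ht k w hw

theorem seriesSum_add (s t : ℕ → NCSeries G) :
    seriesSum (fun k => s k + t k) = seriesSum s + seriesSum t := by
  ext w
  rw [add_apply]
  exact Finset.sum_add_distrib

theorem seriesSum_smul (c : ℚ) (t : ℕ → NCSeries G) :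
    seriesSum (fun k => c • t k) = c • seriesSum t := by
  ext w
  exact (Finset.mul_sum _ _ _).symm

/-- At a word of length `L` the left side sums over the square `i, j ≤ L` and the right side over
the triangle `i + j ≤ L`; the terms in between vanish by the length bound. -/
theorem seriesSum_seriesSum {t : ℕ → ℕ → NCSeries G} (ht : ∀ i j, t i j ∈ ord G (i + j)) :
    seriesSum (fun i => seriesSum (t i)) =
      seriesSum fun n => ∑ ij ∈ Finset.HasAntidiagonal.antidiagonal n, t ij.1 ij.2 := by
  ext w
  simp only [seriesSum, sum_apply]
  rw [← Finset.sum_product' (f := fun i j => t i j w), Finset.sum_sigma']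
  symm
  refine Finset.sum_of_injOn (fun x => x.2) ?_ ?_ ?_ ?_
  · rintro ⟨n, i, j⟩ h ⟨n', i', j'⟩ h' e
    simp only [Finset.coe_sigma, Set.mem_sigma_iff, Finset.mem_coe,
      Finset.HasAntidiagonal.mem_antidiagonal, Prod.mk.injEq] at h h' e
    obtain ⟨rfl, rfl⟩ := e
    have : n = n' := h.2.symm.trans h'.2
    subst this
    rfl
  · rintro ⟨n, i, j⟩ h
    simp only [Finset.coe_sigma, Set.mem_sigma_iff, Finset.mem_coe, Finset.mem_range,
      Finset.HasAntidiagonal.mem_antidiagonal, Finset.coe_product, Set.mem_prod] at h ⊢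
    omega
  · rintro ⟨i, j⟩ - h
    refine ht i j w ?_
    by_contra hlt
    refine h ⟨⟨i + j, i, j⟩, ?_, rfl⟩
    simp only [Finset.coe_sigma, Set.mem_sigma_iff, Finset.mem_coe, Finset.mem_range,
      Finset.HasAntidiagonal.mem_antidiagonal]
    exact ⟨Nat.lt_succ_of_le (not_lt.1 hlt), trivial⟩
  · rintro ⟨n, i, j⟩ -
    rfl

/-! ### Power series of contracting operators -/

/-- The operator `f(T)`. -/
noncomputable def opEval (T : Module.End ℚ (NCSeries G)) (f : PowerSeries ℚ) :
    Module.End ℚ (NCSeries G) where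
  toFun := opSeries (fun k => PowerSeries.coeff k f) T
  map_add' p q := by
    simp only [opSeries, ← seriesSum_add, ← Module.End.pow_apply, map_add, smul_add]
  map_smul' c p := by
    simp only [opSeries, RingHom.id_apply, ← seriesSum_smul, ← Module.End.pow_apply, map_smul]
    simp only [smul_comm c]

theorem opEval_apply (T : Module.End ℚ (NCSeries G)) (f : PowerSeries ℚ) (p : NCSeries G) :
    opEval T f p = seriesSum fun k => PowerSeries.coeff k f • (T ^ k) p := by
  simp only [Module.End.pow_apply]
  rfl

theorem opEval_filtered {T : Module.End ℚ (NCSeries G)} (hT : Contracting T) (f : PowerSeries ℚ) :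
    Filtered (opEval T f) := fun m p hp => by
  rw [opEval_apply]
  exact seriesSum_mem_ord fun k => Submodule.smul_mem _ _
    (ord_mono (Nat.le_add_right m k) (hT.pow k m hp))

/-- A map intertwining `T` and `T'` intertwines `f(T)` and `f(T')`. This one principle covers
algebra homomorphisms, derivations killing `x`, and left against right multiplication. -/
theorem map_opEval {Ψ : NCSeries G →ₗ[ℚ] NCSeries H} (hΨ : Filtered Ψ)
    {T : Module.End ℚ (NCSeries G)} (hT : Contracting T) {T' : Module.End ℚ (NCSeries H)}
    (h : ∀ p, Ψ (T p) = T' (Ψ p)) (f : PowerSeries ℚ) (p : NCSeries G) :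
    Ψ (opEval T f p) = opEval T' f (Ψ p) := by
  rw [opEval_apply, map_seriesSum hΨ fun k => Submodule.smul_mem _ _ (hT.pow_mem k p), opEval_apply]
  congr 1
  funext k
  rw [map_smul]
  congr 1
  induction k generalizing p with
  | zero => rfl
  | succ k ih => rw [pow_succ, pow_succ, Module.End.mul_apply, Module.End.mul_apply, ih, h]

theorem opEval_mul {T : Module.End ℚ (NCSeries G)} (hT : Contracting T) (f g : PowerSeries ℚ) :
    opEval T (f * g) = opEval T f * opEval T g := by
  refine LinearMap.ext fun p => ?_
  rw [Module.End.mul_apply, opEval_apply T g,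
    map_seriesSum (opEval_filtered hT f) fun k => Submodule.smul_mem _ _ (hT.pow_mem k p)]
  have h : ∀ i j, PowerSeries.coeff i g • PowerSeries.coeff j f • (T ^ (j + i)) p ∈ ord G (i + j) :=
    fun i j => Submodule.smul_mem _ _ (Submodule.smul_mem _ _ (by
      rw [add_comm]; exact hT.pow_mem _ p))
  have := seriesSum_seriesSum h
  have hf : ∀ q, opEval T f q = seriesSum fun j => PowerSeries.coeff j f • (T ^ j) q :=
    opEval_apply T f
  simp only [pow_add, Module.End.mul_apply, seriesSum_smul, ← hf] at this
  simp only [map_smul]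
  rw [this, opEval_apply]
  congr 1
  funext n
  rw [mul_comm, PowerSeries.coeff_mul, Finset.sum_smul]
  refine Finset.sum_congr rfl fun ij hij => ?_
  rw [Finset.HasAntidiagonal.mem_antidiagonal] at hij
  rw [smul_smul, ← Module.End.mul_apply, ← pow_add, add_comm, hij]

theorem opEval_one (T : Module.End ℚ (NCSeries G)) : opEval T 1 = 1 := by
  refine LinearMap.ext fun p => ext fun w => ?_
  rw [opEval_apply, seriesSum, Finset.sum_eq_single 0]
  · simp
  · intro k _ hk
    simp [PowerSeries.coeff_one, hk, zero_apply]
  · simp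

theorem opEval_add (T : Module.End ℚ (NCSeries G)) (f g : PowerSeries ℚ) :
    opEval T (f + g) = opEval T f + opEval T g := by
  refine LinearMap.ext fun p => ?_
  simp only [LinearMap.add_apply, opEval_apply, ← seriesSum_add, map_add, add_smul]

theorem opEval_neg (T : Module.End ℚ (NCSeries G)) (f : PowerSeries ℚ) :
    opEval T (-f) = -opEval T f := by
  rw [eq_neg_iff_add_eq_zero, ← opEval_add, neg_add_cancel]
  refine LinearMap.ext fun p => ext fun w => ?_
  simp [opEval_apply, seriesSum, zero_apply]

theorem opEval_X {T : Module.End ℚ (NCSeries G)} (hT : Contracting T) :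
    opEval T PowerSeries.X = T := by
  refine LinearMap.ext fun p => ?_
  rw [opEval_apply]
  symm
  have key : ∀ k, (PowerSeries.coeff k (PowerSeries.X : PowerSeries ℚ)) • (T ^ k) p =
      if k = 1 then T p else 0 := by
    intro k
    rw [PowerSeries.coeff_X]
    split_ifs with h <;> simp [h]
  refine eq_seriesSum (fun k => Submodule.smul_mem _ _ (hT.pow_mem k p)) fun N => ?_
  simp only [key]
  rw [Finset.sum_ite_eq']
  split_ifs with h
  · rw [sub_self]; exact Submodule.zero_mem _
  · rw [sub_zero]
    rw [Finset.mem_range, not_lt] at h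
    exact ord_mono h (by simpa using hT.pow_mem 1 p)

theorem opEval_pow {T : Module.End ℚ (NCSeries G)} (hT : Contracting T) (f : PowerSeries ℚ)
    (k : ℕ) : opEval T (f ^ k) = opEval T f ^ k := by
  induction k with
  | zero => rw [pow_zero, pow_zero, opEval_one]
  | succ k ih => rw [pow_succ, pow_succ, opEval_mul hT, ih]

theorem opEval_mem_ord {T : Module.End ℚ (NCSeries G)} (hT : Contracting T) {f : PowerSeries ℚ}
    {N : ℕ} (hf : ∀ k < N, PowerSeries.coeff k f = 0) {m : ℕ} {p : NCSeries G} (hp : p ∈ ord G m) :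
    opEval T f p ∈ ord G (m + N) := by
  rw [opEval_apply]
  refine seriesSum_mem_ord fun k => ?_
  by_cases h : k < N
  · rw [hf k h, zero_smul]; exact Submodule.zero_mem _
  · exact Submodule.smul_mem _ _ (ord_mono (by omega) (hT.pow k m hp))

theorem contracting_opEval {T : Module.End ℚ (NCSeries G)} (hT : Contracting T) {f : PowerSeries ℚ}
    (hf : PowerSeries.constantCoeff f = 0) : Contracting (opEval T f) := fun m p hp =>
  opEval_mem_ord hT (fun k hk => by
    rw [Nat.lt_one_iff.1 hk, PowerSeries.coeff_zero_eq_constantCoeff_apply, hf]) hp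

/-- Since `g^k` starts in degree `k`, at a given word both sides become the same finite double sum.
-/
theorem opEval_subst {T : Module.End ℚ (NCSeries G)} (hT : Contracting T) (f : PowerSeries ℚ)
    {g : PowerSeries ℚ} (hg : PowerSeries.constantCoeff g = 0) :
    opEval T (f.subst g) = opEval (opEval T g) f := by
  refine LinearMap.ext fun p => ?_
  have hs : PowerSeries.HasSubst g := PowerSeries.HasSubst.of_constantCoeff_zero' hg
  have hpow : ∀ k n, n < k → PowerSeries.coeff n (g ^ k) = 0 := fun k n hn =>
    PowerSeries.coeff_of_lt_order n (lt_of_lt_of_le (by exact_mod_cast hn)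
      (PowerSeries.le_order_pow_of_constantCoeff_eq_zero k hg))
  have hcoeff : ∀ n (L : ℕ), n ≤ L → PowerSeries.coeff n (f.subst g) =
      ∑ k ∈ Finset.range (L + 1), PowerSeries.coeff k f * PowerSeries.coeff n (g ^ k) := by
    intro n L hL
    rw [PowerSeries.coeff_subst' hs]
    refine finsum_eq_sum_of_support_subset _ fun k hk => ?_
    rw [Function.mem_support] at hk
    rw [Finset.coe_range, Set.mem_Iio]
    by_contra hlt
    exact hk (by rw [hpow k n (by omega), smul_zero])
  ext w
  rw [opEval_apply, opEval_apply]
  simp only [seriesSum, ← opEval_pow hT, smul_apply, opEval_apply T, Finset.mul_sum]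
  rw [Finset.sum_comm]
  refine Finset.sum_congr rfl fun n hn => ?_
  rw [hcoeff n w.length (Nat.lt_succ_iff.1 (Finset.mem_range.1 hn)), Finset.sum_mul]
  exact Finset.sum_congr rfl fun k _ => by ring

end NCSeries

/-! ### Exponentials and logarithms of operators -/

namespace NCSeries

variable {G H : Type}

theorem expOp_eq (T : Module.End ℚ (NCSeries G)) (p : NCSeries G) :
    expOp T p = opEval T (PowerSeries.exp ℚ) p := by
  change opSeries _ _ _ = opSeries _ _ _
  simp

theorem logOnePlusOp_eq (T : Module.End ℚ (NCSeries G)) (p : NCSeries G) :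
    logOnePlusOp T p = opEval T (PowerSeries.log ℚ) p := by
  change opSeries _ _ _ = opSeries _ _ _
  congr 1
  funext k
  rw [PowerSeries.coeff_log]
  -- The coefficient at `k = 0` is a quotient by zero, hence 0, which agrees with the constant term
  -- of `log`.
  split_ifs with h
  · simp [h]
  · rfl

/-- The binomial theorem for the commuting operators `S` and `T`, with the product of the two
exponential series regrouped by total degree. -/
theorem opEval_exp_add {S T : Module.End ℚ (NCSeries G)} (hS : Contracting S) (hT : Contracting T)
    (h : Commute S T) (p : NCSeries G) :
    opEval (S + T) (PowerSeries.exp ℚ) p =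
      opEval S (PowerSeries.exp ℚ) (opEval T (PowerSeries.exp ℚ) p) := by
  have hord : ∀ i j, (PowerSeries.coeff i (PowerSeries.exp ℚ)) • (S ^ i)
      ((PowerSeries.coeff j (PowerSeries.exp ℚ)) • (T ^ j) p) ∈ ord G (i + j) := fun i j =>
    Submodule.smul_mem _ _ (ord_mono (Nat.add_comm i j).le
      (hS.pow i j (Submodule.smul_mem _ _ (hT.pow_mem j p))))
  have hSf : ∀ i, Filtered (S ^ i) := fun i m q hq => ord_mono (Nat.le_add_right _ _) (hS.pow i m hq)
  rw [opEval_apply S, opEval_apply T]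
  have : ∀ i, (PowerSeries.coeff i (PowerSeries.exp ℚ)) • (S ^ i) (seriesSum fun j =>
      (PowerSeries.coeff j (PowerSeries.exp ℚ)) • (T ^ j) p) = seriesSum fun j =>
      (PowerSeries.coeff i (PowerSeries.exp ℚ)) • (S ^ i)
      ((PowerSeries.coeff j (PowerSeries.exp ℚ)) • (T ^ j) p) := fun i => by
    rw [map_seriesSum (hSf i) fun k => Submodule.smul_mem _ _ (hT.pow_mem k p), seriesSum_smul]
  simp only [this]
  rw [seriesSum_seriesSum hord, opEval_apply]
  congr 1
  funext n
  rw [h.add_pow', LinearMap.sum_apply, Finset.smul_sum]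
  refine Finset.sum_congr rfl fun ij hij => ?_
  rw [Finset.HasAntidiagonal.mem_antidiagonal] at hij
  rw [map_smul, smul_smul, LinearMap.smul_apply, Module.End.mul_apply, ← Nat.cast_smul_eq_nsmul ℚ,
    smul_smul]
  congr 1
  rw [← hij, Nat.choose_symm_add, Nat.add_choose]
  simp only [PowerSeries.coeff_exp, Algebra.algebraMap_self, RingHom.id_apply]
  rw [Nat.cast_div (Nat.factorial_mul_factorial_dvd_factorial_add _ _)
    (by exact_mod_cast Nat.mul_ne_zero (Nat.factorial_ne_zero _) (Nat.factorial_ne_zero _))]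
  have h1 : ((ij.1 + ij.2).factorial : ℚ) ≠ 0 := by exact_mod_cast Nat.factorial_ne_zero _
  push_cast
  field_simp

/-! ### Power series of a series without constant term -/

/-- The value `f(x)` of a power series in one variable. -/
noncomputable def serEval (x : NCSeries G) (f : PowerSeries ℚ) : NCSeries G :=
  opEval (LinearMap.mulLeft ℚ x) f 1

/-- Right multiplication by `p` commutes with left multiplication by `x`, so `f(L_x)` is determined
by its value at 1. -/
theorem opEval_mulLeft {x : NCSeries G} (hx : x ∈ ord G 1) (f : PowerSeries ℚ) (p : NCSeries G) :
    opEval (LinearMap.mulLeft ℚ x) f p = serEval x f * p := by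
  have := map_opEval (filtered_mulRight p) (contracting_mulLeft hx)
    (T' := LinearMap.mulLeft ℚ x) (fun q => mul_assoc x q p) f 1
  rw [LinearMap.mulRight_apply, LinearMap.mulRight_apply, one_mul] at this
  exact this.symm

theorem serEval_apply (x : NCSeries G) (f : PowerSeries ℚ) :
    serEval x f = seriesSum fun k => PowerSeries.coeff k f • x ^ k := by
  rw [serEval, opEval_apply]
  simp [LinearMap.pow_mulLeft]

theorem opEval_mulRight {x : NCSeries G} (hx : x ∈ ord G 1) (f : PowerSeries ℚ) (p : NCSeries G) :
    opEval (LinearMap.mulRight ℚ x) f p = p * serEval x f := by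
  have := map_opEval (filtered_mulLeft p) (contracting_mulRight hx)
    (T' := LinearMap.mulRight ℚ x) (fun q => (mul_assoc p q x).symm) f 1
  rw [LinearMap.mulLeft_apply, LinearMap.mulLeft_apply, mul_one] at this
  rw [← this, serEval_apply, opEval_apply]
  simp [LinearMap.pow_mulRight]

theorem serEval_add (x : NCSeries G) (f g : PowerSeries ℚ) :
    serEval x (f + g) = serEval x f + serEval x g := by
  rw [serEval, opEval_add]; rfl

theorem serEval_one (x : NCSeries G) : serEval x 1 = 1 := by rw [serEval, opEval_one]; rfl

theorem serEval_X {x : NCSeries G} (hx : x ∈ ord G 1) : serEval x PowerSeries.X = x := by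
  rw [serEval, opEval_X (contracting_mulLeft hx), LinearMap.mulLeft_apply, mul_one]

theorem serEval_mem_ord {x : NCSeries G} (hx : x ∈ ord G 1) {f : PowerSeries ℚ}
    (hf : PowerSeries.constantCoeff f = 0) : serEval x f ∈ ord G 1 :=
  contracting_opEval (contracting_mulLeft hx) hf 0 1 (mem_ord_zero _)

theorem serEval_subst {x : NCSeries G} (hx : x ∈ ord G 1) (f : PowerSeries ℚ) {g : PowerSeries ℚ}
    (hg : PowerSeries.constantCoeff g = 0) : serEval x (f.subst g) = serEval (serEval x g) f := by
  rw [serEval, opEval_subst (contracting_mulLeft hx) f hg]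
  congr 2
  exact LinearMap.ext fun p => opEval_mulLeft hx g p

theorem serEval_zero (f : PowerSeries ℚ) :
    serEval (0 : NCSeries G) f = PowerSeries.constantCoeff f • 1 := by
  rw [serEval_apply]
  ext w
  rw [seriesSum, Finset.sum_eq_single 0]
  · simp
  · intro k _ hk
    simp [hk, zero_apply]
  · simp

theorem map_serEval {Ψ : NCSeries G →ₗ[ℚ] NCSeries H} (hΨ : Filtered Ψ) (h1 : Ψ 1 = 1)
    {x : NCSeries G} (hx : x ∈ ord G 1) {x' : NCSeries H} (h : ∀ p, Ψ (x * p) = x' * Ψ p)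
    (f : PowerSeries ℚ) : Ψ (serEval x f) = serEval x' f := by
  rw [serEval, map_opEval hΨ (contracting_mulLeft hx) (T' := LinearMap.mulLeft ℚ x') h, h1]
  rfl

theorem map_serEval_eq_zero {Ψ : NCSeries G →ₗ[ℚ] NCSeries G} (hΨ : Filtered Ψ) (h1 : Ψ 1 = 0)
    {x : NCSeries G} (hx : x ∈ ord G 1) (h : ∀ p, Ψ (x * p) = x * Ψ p)
    (f : PowerSeries ℚ) : Ψ (serEval x f) = 0 := by
  rw [serEval, map_opEval hΨ (contracting_mulLeft hx) (T' := LinearMap.mulLeft ℚ x) h, h1, map_zero]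

theorem seriesSum_ite_one {q : NCSeries G} (hq : q ∈ ord G 1) :
    seriesSum (fun k => if k = 1 then q else 0) = q := by
  symm
  refine eq_seriesSum (fun k => ?_) fun N => ?_
  · split_ifs with h
    · rw [h]; exact hq
    · exact Submodule.zero_mem _
  · rw [Finset.sum_ite_eq']
    split_ifs with h
    · rw [sub_self]; exact Submodule.zero_mem _
    · rw [Finset.mem_range, not_lt] at h
      rw [sub_zero]; exact ord_mono h hq

theorem pow_mem_ord {x : NCSeries G} (hx : x ∈ ord G 1) (k : ℕ) : x ^ k ∈ ord G k := by
  induction k with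
  | zero => exact mem_ord_zero _
  | succ k ih => rw [pow_succ]; exact mul_mem_ord ih hx

theorem pow_sub_pow_mem_ord {x y : NCSeries G} {l : ℕ} (hx : x ∈ ord G 1) (hy : y ∈ ord G 1)
    (h : x - y ∈ ord G l) (k : ℕ) : x ^ (k + 1) - y ^ (k + 1) ∈ ord G (l + k) := by
  induction k with
  | zero => simpa using h
  | succ k ih =>
    have : x ^ (k + 1 + 1) - y ^ (k + 1 + 1) =
        x * (x ^ (k + 1) - y ^ (k + 1)) + (x - y) * y ^ (k + 1) := by
      rw [pow_succ' x (k + 1), pow_succ' y (k + 1)]; noncomm_ring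
    rw [this]
    exact Submodule.add_mem _ (ord_mono (by omega) (mul_mem_ord hx ih))
      (mul_mem_ord h (pow_mem_ord hy _))

/-- Linearisation: in degree `k + 2` each term of `x^{k+2} - y^{k+2}` carries, besides one factor `x
- y`, at least one further factor from `ord G 1`. -/
theorem serEval_sub_sub_mem_ord {x y : NCSeries G} {l : ℕ} (hx : x ∈ ord G 1) (hy : y ∈ ord G 1)
    (h : x - y ∈ ord G l) (f : PowerSeries ℚ) :
    serEval x f - serEval y f - PowerSeries.coeff 1 f • (x - y) ∈ ord G (l + 1) := by
  have h1 : PowerSeries.coeff 1 f • (x - y) ∈ ord G 1 :=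
    Submodule.smul_mem _ _ (Submodule.sub_mem _ hx hy)
  rw [serEval_apply, serEval_apply]
  have : (seriesSum fun k => PowerSeries.coeff k f • x ^ k) -
      (seriesSum fun k => PowerSeries.coeff k f • y ^ k) - PowerSeries.coeff 1 f • (x - y) =
      seriesSum fun k => PowerSeries.coeff k f • (x ^ k - y ^ k) -
        if k = 1 then PowerSeries.coeff 1 f • (x - y) else 0 := by
    nth_rewrite 1 [← seriesSum_ite_one h1]
    ext w
    simp only [seriesSum, sub_apply, smul_sub, Finset.sum_sub_distrib]
  rw [this]
  refine seriesSum_mem_ord fun k => ?_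
  match k with
  | 0 => simp
  | 1 => simp
  | k + 2 =>
    rw [if_neg (by omega), sub_zero]
    exact Submodule.smul_mem _ _ (ord_mono (by omega) (pow_sub_pow_mem_ord hx hy h (k + 1)))

theorem serEval_sub_mem_ord {x y : NCSeries G} {l : ℕ} (hx : x ∈ ord G 1) (hy : y ∈ ord G 1)
    (h : x - y ∈ ord G l) (f : PowerSeries ℚ) : serEval x f - serEval y f ∈ ord G l := by
  have h1 := ord_mono (Nat.le_succ l) (serEval_sub_sub_mem_ord hx hy h f)
  have h2 := Submodule.add_mem _ h1 (Submodule.smul_mem _ (PowerSeries.coeff 1 f) h)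
  rwa [sub_add_cancel] at h2

/-! ### Exponentials and the Baker-Campbell-Hausdorff series -/

theorem exp_eq (x : NCSeries G) : exp x = serEval x (PowerSeries.exp ℚ) :=
  expOp_eq (LinearMap.mulLeft ℚ x) 1

theorem bch_eq (x y : NCSeries G) :
    bch x y = serEval (exp x * exp y - 1) (PowerSeries.log ℚ) :=
  logOnePlusOp_eq (LinearMap.mulLeft ℚ (exp x * exp y - 1)) 1

theorem exp_sub_one (x : NCSeries G) : exp x - 1 = serEval x (PowerSeries.exp ℚ - 1) := by
  have h := serEval_add x (PowerSeries.exp ℚ - 1) 1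
  rw [sub_add_cancel, serEval_one, ← exp_eq] at h
  rw [h, add_sub_cancel_right]

theorem exp_sub_one_mem_ord {x : NCSeries G} (hx : x ∈ ord G 1) : exp x - 1 ∈ ord G 1 := by
  rw [exp_sub_one]
  exact serEval_mem_ord hx (by simp)

theorem exp_mul_exp_sub_one_mem_ord {x y : NCSeries G} (hx : x ∈ ord G 1) (hy : y ∈ ord G 1) :
    exp x * exp y - 1 ∈ ord G 1 := by
  have : exp x * exp y - 1 = (exp x - 1) * exp y + (exp y - 1) := by noncomm_ring
  rw [this]
  exact Submodule.add_mem _ (mul_mem_ord (exp_sub_one_mem_ord hx) (mem_ord_zero _))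
    (exp_sub_one_mem_ord hy)

theorem bch_mem_ord {x y : NCSeries G} (hx : x ∈ ord G 1) (hy : y ∈ ord G 1) :
    bch x y ∈ ord G 1 := by
  rw [bch_eq]
  exact serEval_mem_ord (exp_mul_exp_sub_one_mem_ord hx hy) PowerSeries.constantCoeff_log

theorem exp_bch {x y : NCSeries G} (hx : x ∈ ord G 1) (hy : y ∈ ord G 1) :
    exp (bch x y) = exp x * exp y := by
  have hu := exp_mul_exp_sub_one_mem_ord hx hy
  rw [exp_eq, bch_eq, ← serEval_subst hu _ PowerSeries.constantCoeff_log, PowerSeries.exp_subst_log,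
    serEval_add, serEval_one, serEval_X hu, add_sub_cancel]

theorem log_exp {x : NCSeries G} (hx : x ∈ ord G 1) :
    serEval (exp x - 1) (PowerSeries.log ℚ) = x := by
  rw [exp_sub_one, ← serEval_subst hx _ (by simp), PowerSeries.log_subst_exp_sub_one, serEval_X hx]

/-- The logarithm recovers `x`. Identities between BCH expressions thereby reduce to identities
between products of exponentials. -/
theorem exp_injOn {x y : NCSeries G} (hx : x ∈ ord G 1) (hy : y ∈ ord G 1) (h : exp x = exp y) :
    x = y := by
  rw [← log_exp hx, h, log_exp hy]

theorem exp_zero : exp (0 : NCSeries G) = 1 := by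
  rw [exp_eq, serEval_zero]
  simp

theorem exp_add {x y : NCSeries G} (hx : x ∈ ord G 1) (hy : y ∈ ord G 1) (h : Commute x y) :
    exp (x + y) = exp x * exp y := by
  have hc : Commute (LinearMap.mulLeft ℚ x) (LinearMap.mulLeft ℚ y) := by
    refine LinearMap.ext fun p => ?_
    simp [Module.End.mul_apply, ← mul_assoc, h.eq]
  have hadd : LinearMap.mulLeft ℚ (x + y) = LinearMap.mulLeft ℚ x + LinearMap.mulLeft ℚ y :=
    LinearMap.ext fun p => add_mul x y p
  rw [exp_eq, serEval, hadd, opEval_exp_add (contracting_mulLeft hx) (contracting_mulLeft hy) hc,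
    opEval_mulLeft hx, exp_eq, exp_eq]
  rfl

theorem exp_mul_exp_neg {x : NCSeries G} (hx : x ∈ ord G 1) : exp x * exp (-x) = 1 := by
  rw [← exp_add hx (Submodule.neg_mem _ hx) (Commute.neg_right (Commute.refl x)), add_neg_cancel,
    exp_zero]

theorem exp_neg_mul_exp {x : NCSeries G} (hx : x ∈ ord G 1) : exp (-x) * exp x = 1 := by
  simpa using exp_mul_exp_neg (Submodule.neg_mem _ hx)

theorem bch_assoc {x y z : NCSeries G} (hx : x ∈ ord G 1) (hy : y ∈ ord G 1) (hz : z ∈ ord G 1) :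
    bch (bch x y) z = bch x (bch y z) := by
  refine exp_injOn (bch_mem_ord (bch_mem_ord hx hy) hz) (bch_mem_ord hx (bch_mem_ord hy hz)) ?_
  rw [exp_bch (bch_mem_ord hx hy) hz, exp_bch hx hy, exp_bch hx (bch_mem_ord hy hz), exp_bch hy hz,
    mul_assoc]

theorem bch_neg_self {x : NCSeries G} (hx : x ∈ ord G 1) : bch x (-x) = 0 := by
  refine exp_injOn (bch_mem_ord hx (Submodule.neg_mem _ hx)) (Submodule.zero_mem _) ?_
  rw [exp_bch hx (Submodule.neg_mem _ hx), exp_mul_exp_neg hx, exp_zero]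

theorem bch_zero {x : NCSeries G} (hx : x ∈ ord G 1) : bch x 0 = x := by
  refine exp_injOn (bch_mem_ord hx (Submodule.zero_mem _)) hx ?_
  rw [exp_bch hx (Submodule.zero_mem _), exp_zero, mul_one]

theorem neg_bch {x y : NCSeries G} (hx : x ∈ ord G 1) (hy : y ∈ ord G 1) :
    -bch x y = bch (-y) (-x) := by
  have hx' := Submodule.neg_mem _ hx
  have hy' := Submodule.neg_mem _ hy
  refine exp_injOn (Submodule.neg_mem _ (bch_mem_ord hx hy)) (bch_mem_ord hy' hx') ?_
  rw [exp_bch hy' hx']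
  calc exp (-bch x y) = exp (-bch x y) * (exp x * (exp y * exp (-y)) * exp (-x)) := by
        rw [exp_mul_exp_neg hy, mul_one, exp_mul_exp_neg hx, mul_one]
    _ = exp (-bch x y) * (exp x * exp y) * (exp (-y) * exp (-x)) := by noncomm_ring
    _ = _ := by rw [← exp_bch hx hy, exp_neg_mul_exp (bch_mem_ord hx hy), one_mul]

/-- To first order in `y - y'`, replacing `y'` by `y` changes `bch x y'` by `y - y'`. -/
theorem bch_sub_bch_sub_mem_ord {x y y' : NCSeries G} {l : ℕ} (hx : x ∈ ord G 1) (hy : y ∈ ord G 1)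
    (hy' : y' ∈ ord G 1) (h : y - y' ∈ ord G l) :
    bch x y - bch x y' - (y - y') ∈ ord G (l + 1) := by
  have h1 := serEval_sub_sub_mem_ord hy hy' h (PowerSeries.exp ℚ)
  rw [← exp_eq, ← exp_eq] at h1
  have h0 := serEval_sub_mem_ord hy hy' h (PowerSeries.exp ℚ)
  rw [← exp_eq, ← exp_eq] at h0
  have h2 : exp x * exp y - 1 - (exp x * exp y' - 1) ∈ ord G l := by
    rw [sub_sub_sub_cancel_right, ← mul_sub]
    simpa using mul_mem_ord (mem_ord_zero (exp x)) h0
  have h3 := serEval_sub_sub_mem_ord (exp_mul_exp_sub_one_mem_ord hx hy)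
    (exp_mul_exp_sub_one_mem_ord hx hy') h2 (PowerSeries.log ℚ)
  rw [← bch_eq, ← bch_eq, PowerSeries.coeff_one_log, one_smul] at h3
  have h4 := ord_mono (Nat.add_comm l 1).le (mul_mem_ord (exp_sub_one_mem_ord hx) h0)
  have h5 : PowerSeries.coeff 1 (PowerSeries.exp ℚ) = 1 := by simp
  rw [h5, one_smul] at h1
  -- Three errors, each one letter longer than `y - y'`: the linearisation of `log`, the factor `e^x
  -- - 1`, and the linearisation of `exp`.
  have : bch x y - bch x y' - (y - y') =
      (bch x y - bch x y' - (exp x * exp y - 1 - (exp x * exp y' - 1))) +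
        ((exp x - 1) * (exp y - exp y')) + (exp y - exp y' - (y - y')) := by noncomm_ring
  rw [this]
  exact Submodule.add_mem _ (Submodule.add_mem _ h3 h4) h1

theorem bch_sub_add_mem_ord {x y : NCSeries G} (hx : x ∈ ord G 1) (hy : y ∈ ord G 1) :
    bch x y - (x + y) ∈ ord G 2 := by
  have := bch_sub_bch_sub_mem_ord (l := 1) hx hy (Submodule.zero_mem _) (by simpa using hy)
  rw [bch_zero hx, sub_zero, sub_sub] at this
  exact this

theorem map_exp {Ψ : NCSeries G →ₗ[ℚ] NCSeries H} (hΨ : Filtered Ψ) (h1 : Ψ 1 = 1)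
    (hmul : ∀ p q, Ψ (p * q) = Ψ p * Ψ q) {x : NCSeries G} (hx : x ∈ ord G 1) :
    Ψ (exp x) = exp (Ψ x) := by
  rw [exp_eq, exp_eq]
  exact map_serEval hΨ h1 hx (hmul x) _

theorem map_bch {Ψ : NCSeries G →ₗ[ℚ] NCSeries H} (hΨ : Filtered Ψ) (h1 : Ψ 1 = 1)
    (hmul : ∀ p q, Ψ (p * q) = Ψ p * Ψ q) {x y : NCSeries G} (hx : x ∈ ord G 1) (hy : y ∈ ord G 1) :
    Ψ (bch x y) = bch (Ψ x) (Ψ y) := by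
  refine exp_injOn (hΨ _ _ (bch_mem_ord hx hy)) (bch_mem_ord (hΨ _ _ hx) (hΨ _ _ hy)) ?_
  rw [← map_exp hΨ h1 hmul (bch_mem_ord hx hy), exp_bch hx hy, hmul, map_exp hΨ h1 hmul hx,
    map_exp hΨ h1 hmul hy, exp_bch (hΨ _ _ hx) (hΨ _ _ hy)]

/-- `e ^ (x / 2) * e ^ (x / 2) = e ^ x`. -/
theorem exp_half_mul_exp_half {x : NCSeries G} (hx : x ∈ ord G 1) :
    exp ((1 / 2 : ℚ) • x) * exp ((1 / 2 : ℚ) • x) = exp x := by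
  rw [← exp_add (Submodule.smul_mem _ _ hx) (Submodule.smul_mem _ _ hx) (Commute.refl _),
    ← add_smul]
  norm_num

theorem average₂_mem_ord {x y : NCSeries G} (hx : x ∈ ord G 1) (hy : y ∈ ord G 1) :
    average₂ x y ∈ ord G 1 :=
  bch_mem_ord hx (Submodule.smul_mem _ _ (bch_mem_ord (Submodule.neg_mem _ hx) hy))

/-- With `z = BCH(-x, y)` one has `e^y = e^x e^z`, so the midpoint is `e^x e^{z/2} = e^y e^{-z/2}`.
This symmetry is what makes the centre of a bigon invariant under reflections. -/
theorem average₂_comm {x y : NCSeries G} (hx : x ∈ ord G 1) (hy : y ∈ ord G 1) :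
    average₂ x y = average₂ y x := by
  have hx' := Submodule.neg_mem _ hx
  have hy' := Submodule.neg_mem _ hy
  have hz := bch_mem_ord hx' hy
  refine exp_injOn (average₂_mem_ord hx hy) (average₂_mem_ord hy hx) ?_
  rw [average₂, average₂, exp_bch hx (Submodule.smul_mem _ _ hz),
    exp_bch hy (Submodule.smul_mem _ _ (bch_mem_ord hy' hx))]
  have hneg : bch (-y) x = -bch (-x) y := by rw [neg_bch hx' hy, neg_neg]
  rw [hneg, smul_neg]
  set z := bch (-x) y with hzdef
  have h1 : exp y = exp x * exp z := by
    rw [hzdef, exp_bch hx' hy, ← mul_assoc, exp_mul_exp_neg hx, one_mul]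
  rw [h1, ← exp_half_mul_exp_half hz, mul_assoc, mul_assoc,
    exp_mul_exp_neg (Submodule.smul_mem _ _ hz), mul_one]

end NCSeries

namespace NCSeries

variable {G H : Type}

/-! ### The derivative of the exponential -/

theorem seriesSum_succ {s : ℕ → NCSeries G} (h0 : s 0 = 0) (hs : ∀ n, s (n + 1) ∈ ord G (n + 1)) :
    seriesSum s = seriesSum fun n => s (n + 1) := by
  ext w
  rw [seriesSum, seriesSum, Finset.sum_range_succ', h0, Finset.sum_range_succ, zero_apply,
    hs w.length w (Nat.lt_succ_self _)]

/-- The commutator with `z`. -/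
noncomputable def comm (z : NCSeries G) : Module.End ℚ (NCSeries G) :=
  LinearMap.mulLeft ℚ z - LinearMap.mulRight ℚ z

theorem comm_apply (z p : NCSeries G) : comm z p = z * p - p * z := rfl

theorem contracting_comm {z : NCSeries G} (hz : z ∈ ord G 1) : Contracting (comm z) :=
  fun m p hp => Submodule.sub_mem _ (contracting_mulLeft hz m p hp) (contracting_mulRight hz m p hp)

theorem commute_mulLeft_mulRight (x y : NCSeries G) :
    Commute (LinearMap.mulLeft ℚ x) (LinearMap.mulRight ℚ y) :=
  LinearMap.ext fun p => (mul_assoc x p y).symm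

/-- `ad z` is the sum of the commuting operators of left multiplication by `z` and right
multiplication by `-z`, so its exponential factors. -/
theorem opEval_comm_exp {z : NCSeries G} (hz : z ∈ ord G 1) (p : NCSeries G) :
    opEval (comm z) (PowerSeries.exp ℚ) p = exp z * p * exp (-z) := by
  have hz' := Submodule.neg_mem _ hz
  have h : comm z = LinearMap.mulLeft ℚ z + LinearMap.mulRight ℚ (-z) :=
    LinearMap.ext fun p => by
      rw [comm_apply, LinearMap.add_apply, LinearMap.mulLeft_apply, LinearMap.mulRight_apply,
        mul_neg, sub_eq_add_neg]
  rw [h, opEval_exp_add (contracting_mulLeft hz) (contracting_mulRight hz')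
    (commute_mulLeft_mulRight _ _), opEval_mulLeft hz, opEval_mulRight hz', exp_eq, exp_eq, mul_assoc]

/-- Write right multiplication by `z` as left multiplication minus `ad z`; these commute, so `Δ(z)
z^n` expands by the binomial theorem. The induction then adds the coefficients by Pascal's rule. -/
theorem derivation_pow_succ {Δ : Module.End ℚ (NCSeries G)} {z : NCSeries G}
    (h : ∀ q, Δ (z * q) = Δ z * q + z * Δ q) (n : ℕ) :
    Δ (z ^ (n + 1)) = ∑ m ∈ Finset.range (n + 1),
      ((n + 1).choose (m + 1) : ℚ) • (z ^ (n - m) * ((-comm z) ^ m) (Δ z)) := by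
  have hc : Commute (LinearMap.mulLeft ℚ z) (-comm z) :=
    ((Commute.refl _).sub_right (commute_mulLeft_mulRight z z)).neg_right
  have hR : LinearMap.mulRight ℚ z = LinearMap.mulLeft ℚ z + -comm z := by
    rw [comm]; abel
  have hmul : ∀ n, Δ z * z ^ n = ∑ m ∈ Finset.range (n + 1),
      (n.choose m : ℚ) • (z ^ (n - m) * ((-comm z) ^ m) (Δ z)) := by
    intro n
    have h1 : Δ z * z ^ n = (LinearMap.mulRight ℚ z ^ n) (Δ z) := by
      rw [LinearMap.pow_mulRight, LinearMap.mulRight_apply]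
    rw [h1, hR, hc.add_pow, ← Finset.sum_range_reflect, LinearMap.sum_apply]
    refine Finset.sum_congr rfl fun m hm => ?_
    rw [Finset.mem_range] at hm
    have h2 : n + 1 - 1 - m = n - m := by omega
    have h3 : n - (n - m) = m := by omega
    rw [h2, h3, Nat.choose_symm (by omega), LinearMap.pow_mulLeft]
    rw [← Nat.cast_comm, ← nsmul_eq_mul, LinearMap.smul_apply, Module.End.mul_apply,
      LinearMap.mulLeft_apply, Nat.cast_smul_eq_nsmul]
  induction n with
  | zero => simp
  | succ n ih =>
    rw [pow_succ', h, ih, hmul, Finset.mul_sum]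
    have h0 : ∑ m ∈ Finset.range (n + 1), z * (((n + 1).choose (m + 1) : ℚ) •
        (z ^ (n - m) * ((-comm z) ^ m) (Δ z))) = ∑ m ∈ Finset.range (n + 1 + 1),
        ((n + 1).choose (m + 1) : ℚ) • (z ^ (n + 1 - m) * ((-comm z) ^ m) (Δ z)) := by
      rw [Finset.sum_range_succ _ (n + 1), Nat.choose_succ_self, Nat.cast_zero, zero_smul, add_zero]
      refine Finset.sum_congr rfl fun m hm => ?_
      rw [Finset.mem_range] at hm
      have h2 : n + 1 - m = n - m + 1 := by omega
      rw [h2, pow_succ', mul_smul_comm, mul_assoc]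
    rw [h0, ← Finset.sum_add_distrib]
    refine Finset.sum_congr rfl fun m _ => ?_
    rw [← add_smul, Nat.choose_succ_succ (n + 1) m]
    push_cast
    rfl

/-- The derivative of the exponential. -/
theorem exp_neg_mul_derivation_exp {Δ : Module.End ℚ (NCSeries G)} (hΔ : Filtered Δ) (h1 : Δ 1 = 0)
    {z : NCSeries G} (hz : z ∈ ord G 1) (h : ∀ q, Δ (z * q) = Δ z * q + z * Δ q) :
    exp (-z) * Δ (exp z) = opEval (comm z) PowerSeries.expQuot (Δ z) := by
  have hA := contracting_comm hz
  suffices key : Δ (exp z) = exp z * opEval (comm z) PowerSeries.expQuot (Δ z) by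
    rw [key, ← mul_assoc, exp_neg_mul_exp hz, one_mul]
  have hy : Δ z ∈ ord G 1 := hΔ _ _ hz
  rw [exp_eq, ← opEval_mulLeft hz, opEval_apply (comm z), serEval_apply,
    map_seriesSum (opEval_filtered (contracting_mulLeft hz) _)
      fun k => Submodule.smul_mem _ _ (hA.pow_mem k _),
    map_seriesSum hΔ fun k => Submodule.smul_mem _ _ (pow_mem_ord hz k)]
  have hs : ∀ i j, (PowerSeries.coeff i PowerSeries.expQuot) •
      ((PowerSeries.coeff j (PowerSeries.exp ℚ)) • (z ^ j * (comm z ^ i) (Δ z))) ∈ ord G (i + j) :=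
    fun i j => Submodule.smul_mem _ _ (Submodule.smul_mem _ _ (by
      rw [add_comm]
      exact mul_mem_ord (pow_mem_ord hz j) (hA.pow_mem i _)))
  have h2 := seriesSum_seriesSum hs
  simp only [seriesSum_smul] at h2
  have h3 : ∀ q, opEval (LinearMap.mulLeft ℚ z) (PowerSeries.exp ℚ) q =
      seriesSum fun j => PowerSeries.coeff j (PowerSeries.exp ℚ) • (z ^ j * q) := fun q => by
    rw [opEval_apply]
    simp only [LinearMap.pow_mulLeft, LinearMap.mulLeft_apply]
  simp only [map_smul]
  simp only [← h3] at h2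
  rw [h2, seriesSum_succ (by simp [h1]) fun n => Submodule.smul_mem _ _
    (hΔ _ _ (pow_mem_ord hz _))]
  congr 1
  funext n
  rw [derivation_pow_succ h, Finset.smul_sum, Finset.Nat.sum_antidiagonal_eq_sum_range_succ
    (fun i j => (PowerSeries.coeff i PowerSeries.expQuot) •
      ((PowerSeries.coeff j (PowerSeries.exp ℚ)) • (z ^ j * (comm z ^ i) (Δ z))))]
  refine Finset.sum_congr rfl fun m hm => ?_
  rw [Finset.mem_range] at hm
  have h4 : ((-comm z) ^ m) (Δ z) = ((-1 : ℚ) ^ m) • (comm z ^ m) (Δ z) := by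
    rw [neg_pow, Module.End.mul_apply]
    rcases Nat.even_or_odd m with he | ho
    · rw [he.neg_one_pow, he.neg_one_pow, one_smul]; rfl
    · rw [ho.neg_one_pow, ho.neg_one_pow, neg_smul, one_smul]; rfl
  rw [h4, mul_smul_comm, smul_smul, smul_smul, smul_smul]
  congr 1
  -- It remains to compare coefficients: `C(n+1, m+1) / (n+1)! = 1 / ((m+1)! (n-m)!)`.
  rw [PowerSeries.expQuot, PowerSeries.coeff_mk, PowerSeries.coeff_exp, PowerSeries.coeff_exp,
    Nat.cast_choose ℚ (show m + 1 ≤ n + 1 by omega)]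
  have h5 : n + 1 - (m + 1) = n - m := by omega
  have h6 : ∀ k : ℕ, (k.factorial : ℚ) ≠ 0 := fun k => by exact_mod_cast Nat.factorial_ne_zero k
  rw [h5]
  have := h6 (n + 1)
  have := h6 (m + 1)
  have := h6 (n - m)
  simp only [Algebra.algebraMap_self, RingHom.id_apply]
  field_simp

/-! ### Degrees -/

section Degree

variable (deg : G → ℤ)

/-- The series all of whose words have degree `d`. -/
def homDeg (d : ℤ) : Submodule ℚ (NCSeries G) where
  carrier := {p | ∀ w, p w ≠ 0 → wordDeg deg w = d}
  zero_mem' := fun _ h => absurd rfl h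
  add_mem' := fun {p q} hp hq w h => by
    by_cases hpw : p w = 0
    · refine hq w fun hqw => h ?_
      rw [add_apply, hpw, hqw, add_zero]
    · exact hp w hpw
  smul_mem' := fun c p hp w h => hp w fun hpw => h (by rw [smul_apply, hpw, mul_zero])

variable {deg}

theorem mem_piece {d : ℤ} {p : NCSeries G} :
    p ∈ piece deg d ↔ p ∈ lieSeries deg Set.univ ∧ p ∈ homDeg deg d := Iff.rfl

theorem wordDeg_append (u v : List G) : wordDeg deg (u ++ v) = wordDeg deg u + wordDeg deg v := by
  rw [wordDeg, wordDeg, wordDeg, List.map_append, List.sum_append]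

theorem wordDeg_cons (g : G) (v : List G) : wordDeg deg (g :: v) = deg g + wordDeg deg v := by
  rw [wordDeg, wordDeg, List.map_cons, List.sum_cons]

theorem wordDeg_take_add_drop (w : List G) (i : ℕ) :
    wordDeg deg (w.take i) + wordDeg deg (w.drop i) = wordDeg deg w := by
  rw [← wordDeg_append, List.take_append_drop]

theorem of_mem_homDeg (g : G) : of g ∈ homDeg deg (deg g) := (of_mem_piece deg g).2

theorem one_mem_homDeg : (1 : NCSeries G) ∈ homDeg deg 0 := fun w h => by
  cases w with
  | nil => rfl
  | cons g w => exact absurd (one_cons g w) h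

theorem mul_apply (p q : NCSeries G) (w : List G) :
    (p * q) w = ∑ i ∈ Finset.range (w.length + 1), p (w.take i) * q (w.drop i) := rfl

theorem mul_mem_homDeg {d e : ℤ} {p q : NCSeries G} (hp : p ∈ homDeg deg d)
    (hq : q ∈ homDeg deg e) : p * q ∈ homDeg deg (d + e) := fun w h => by
  rw [mul_apply] at h
  obtain ⟨i, -, hi⟩ := Finset.exists_ne_zero_of_sum_ne_zero h
  rw [← wordDeg_take_add_drop w i, hp _ (left_ne_zero_of_mul hi), hq _ (right_ne_zero_of_mul hi)]

theorem seriesSum_mem_homDeg {d : ℤ} {t : ℕ → NCSeries G} (ht : ∀ k, t k ∈ homDeg deg d) :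
    seriesSum t ∈ homDeg deg d := fun w h => by
  obtain ⟨k, -, hk⟩ := Finset.exists_ne_zero_of_sum_ne_zero h
  exact ht k w hk

theorem opEval_mem {V : Submodule ℚ (NCSeries G)} (hV : ∀ t : ℕ → NCSeries G, (∀ k, t k ∈ V) →
    seriesSum t ∈ V) {T : Module.End ℚ (NCSeries G)} (hT : ∀ p ∈ V, T p ∈ V) (f : PowerSeries ℚ)
    {p : NCSeries G} (hp : p ∈ V) : opEval T f p ∈ V := by
  rw [opEval_apply]
  refine hV _ fun k => Submodule.smul_mem _ _ ?_
  induction k with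
  | zero => exact hp
  | succ k ih => rw [pow_succ', Module.End.mul_apply]; exact hT _ ih

theorem serEval_mem_homDeg {x : NCSeries G} (hx : x ∈ homDeg deg 0) (f : PowerSeries ℚ) :
    serEval x f ∈ homDeg deg 0 :=
  opEval_mem (fun _ => seriesSum_mem_homDeg) (fun p hp => by
    simpa using mul_mem_homDeg hx hp) f one_mem_homDeg

theorem exp_mem_homDeg {x : NCSeries G} (hx : x ∈ homDeg deg 0) : exp x ∈ homDeg deg 0 := by
  rw [exp_eq]; exact serEval_mem_homDeg hx _

theorem bch_mem_homDeg {x y : NCSeries G} (hx : x ∈ homDeg deg 0) (hy : y ∈ homDeg deg 0) :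
    bch x y ∈ homDeg deg 0 := by
  rw [bch_eq]
  exact serEval_mem_homDeg (Submodule.sub_mem _
    (by simpa using mul_mem_homDeg (exp_mem_homDeg hx) (exp_mem_homDeg hy)) one_mem_homDeg) _

variable (deg) in
/-- The parity involution. -/
noncomputable def sgn : Module.End ℚ (NCSeries G) where
  toFun p := fun w => (-1 : ℚ) ^ wordDeg deg w * p w
  map_add' p q := by ext w; exact mul_add _ _ _
  map_smul' c p := by ext w; exact mul_left_comm _ _ _

theorem sgn_apply (p : NCSeries G) (w : List G) :
    sgn deg p w = (-1 : ℚ) ^ wordDeg deg w * p w := rfl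

theorem neg_one_zpow_mul_self (d : ℤ) : (-1 : ℚ) ^ d * (-1 : ℚ) ^ d = 1 := by
  rw [← mul_zpow]; norm_num

theorem sgn_mul (p q : NCSeries G) : sgn deg (p * q) = sgn deg p * sgn deg q := by
  ext w
  rw [sgn_apply, mul_apply, mul_apply, Finset.mul_sum]
  refine Finset.sum_congr rfl fun i _ => ?_
  rw [sgn_apply, sgn_apply, ← wordDeg_take_add_drop w i, zpow_add₀ (by norm_num)]
  ring

theorem sgn_of_mem_homDeg {d : ℤ} {p : NCSeries G} (hp : p ∈ homDeg deg d) :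
    sgn deg p = (-1 : ℚ) ^ d • p := by
  ext w
  rw [sgn_apply, smul_apply]
  by_cases h : p w = 0
  · rw [h, mul_zero, mul_zero]
  · rw [hp w h]

theorem sgn_even {p : NCSeries G} (hp : p ∈ homDeg deg 0) : sgn deg p = p := by
  rw [sgn_of_mem_homDeg hp, zpow_zero, one_smul]

theorem sgn_neg_one {p : NCSeries G} (hp : p ∈ homDeg deg (-1)) : sgn deg p = -p := by
  rw [sgn_of_mem_homDeg hp]; norm_num

theorem sgn_one : sgn deg (1 : NCSeries G) = 1 := sgn_even one_mem_homDeg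

theorem sgn_sgn (p : NCSeries G) : sgn deg (sgn deg p) = p := by
  ext w
  rw [sgn_apply, sgn_apply, ← mul_assoc, neg_one_zpow_mul_self, one_mul]

theorem filtered_sgn : Filtered (sgn deg) := fun m p hp w hw => by
  rw [sgn_apply, hp w hw, mul_zero]

theorem bracket_apply (p q : NCSeries G) (w : List G) : bracket deg p q w =
    ∑ i ∈ Finset.range (w.length + 1), (p (w.take i) * q (w.drop i) -
      (-1 : ℚ) ^ (wordDeg deg (w.take i) * wordDeg deg (w.drop i)) *
        (q (w.take i) * p (w.drop i))) := rfl

theorem bracket_of_mem_homDeg {d e : ℤ} {p q : NCSeries G} (hp : p ∈ homDeg deg d)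
    (hq : q ∈ homDeg deg e) : bracket deg p q = p * q - (-1 : ℚ) ^ (d * e) • (q * p) := by
  ext w
  rw [bracket_apply, sub_apply, smul_apply, mul_apply, mul_apply, Finset.mul_sum,
    ← Finset.sum_sub_distrib]
  refine Finset.sum_congr rfl fun i _ => ?_
  by_cases h1 : q (w.take i) = 0
  · simp [h1]
  by_cases h2 : p (w.drop i) = 0
  · simp [h2]
  rw [hq _ h1, hp _ h2, mul_comm e d]

/-- An argument of degree 0 makes every sign trivial, so the other argument need not be homogeneous.
-/
theorem bracket_even {p : NCSeries G} (hp : p ∈ homDeg deg 0) (q : NCSeries G) :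
    bracket deg p q = p * q - q * p := by
  ext w
  rw [bracket_apply, sub_apply, mul_apply, mul_apply, ← Finset.sum_sub_distrib]
  refine Finset.sum_congr rfl fun i _ => ?_
  by_cases h2 : p (w.drop i) = 0
  · simp [h2]
  rw [hp _ h2, mul_zero, zpow_zero, one_mul]

/-- For `p` of degree -1 the sign depends only on the parity of the words of `q` and is absorbed in
`sgn`; no homogeneity of `q` is required. -/
theorem bracket_neg_one {p : NCSeries G} (hp : p ∈ homDeg deg (-1)) (q : NCSeries G) :
    bracket deg p q = p * q - sgn deg q * p := by
  ext w
  rw [bracket_apply, sub_apply, mul_apply, mul_apply, ← Finset.sum_sub_distrib]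
  refine Finset.sum_congr rfl fun i _ => ?_
  by_cases h2 : p (w.drop i) = 0
  · simp [h2]
  rw [hp _ h2, sgn_apply, mul_neg_one, zpow_neg, ← inv_zpow]
  norm_num [mul_assoc]

theorem bracket_mem_homDeg {d e : ℤ} {p q : NCSeries G} (hp : p ∈ homDeg deg d)
    (hq : q ∈ homDeg deg e) : bracket deg p q ∈ homDeg deg (d + e) := by
  rw [bracket_of_mem_homDeg hp hq]
  exact Submodule.sub_mem _ (mul_mem_homDeg hp hq)
    (Submodule.smul_mem _ _ (by rw [add_comm]; exact mul_mem_homDeg hq hp))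

theorem bracket_mem_ord {m n : ℕ} {p q : NCSeries G} (hp : p ∈ ord G m) (hq : q ∈ ord G n) :
    bracket deg p q ∈ ord G (m + n) := by
  intro w hw
  rw [bracket_apply]
  refine Finset.sum_eq_zero fun i hi => ?_
  rw [Finset.mem_range] at hi
  have h1 : p (w.take i) * q (w.drop i) = 0 := by
    by_cases h : (w.take i).length < m
    · rw [hp _ h, zero_mul]
    · rw [hq, mul_zero]
      rw [List.length_take] at h
      rw [List.length_drop]
      omega
  have h2 : q (w.take i) * p (w.drop i) = 0 := by
    by_cases h : (w.take i).length < n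
    · rw [hq _ h, zero_mul]
    · rw [hp, mul_zero]
      rw [List.length_take] at h
      rw [List.length_drop]
      omega
  rw [h1, h2, mul_zero, sub_zero]

variable (deg) in
/-- The operator `ad x`. -/
noncomputable def adOp (x : NCSeries G) : Module.End ℚ (NCSeries G) where
  toFun := bracket deg x
  map_add' := bracket_add_right deg x
  map_smul' c p := bracket_smul_right deg c x p

theorem adOp_apply (x p : NCSeries G) : adOp deg x p = bracket deg x p := rfl

theorem coe_adOp (x : NCSeries G) : ⇑(adOp deg x) = bracket deg x := rfl

theorem adOp_neg (x : NCSeries G) : adOp deg (-x) = -adOp deg x := by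
  refine LinearMap.ext fun p => ?_
  rw [adOp_apply, ← neg_one_smul ℚ x, bracket_smul_left, neg_one_smul]
  rfl

theorem contracting_adOp {x : NCSeries G} (hx : x ∈ ord G 1) : Contracting (adOp deg x) :=
  fun m p hp => by rw [add_comm]; exact bracket_mem_ord hx hp

theorem adOp_even {x : NCSeries G} (hx : x ∈ homDeg deg 0) : adOp deg x = comm x :=
  LinearMap.ext fun p => bracket_even hx p

theorem expOp_bracket {x : NCSeries G} (hx : x ∈ ord G 1) (hd : x ∈ homDeg deg 0)
    (p : NCSeries G) : expOp (bracket deg x) p = exp x * p * exp (-x) := by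
  rw [← coe_adOp, expOp_eq, adOp_even hd, opEval_comm_exp hx]

/-- `exp (ad x) exp (ad y) = exp (ad (bch x y))`. -/
theorem bchOp_bracket {x y : NCSeries G} (hx : x ∈ ord G 1) (hy : y ∈ ord G 1)
    (hdx : x ∈ homDeg deg 0) (hdy : y ∈ homDeg deg 0) :
    bchOp (bracket deg x) (bracket deg y) = bracket deg (bch x y) := by
  have hz := bch_mem_ord hx hy
  have hdz := bch_mem_homDeg hdx hdy
  have hC := contracting_adOp (deg := deg) hz
  -- Both `e^{ad x} e^{ad y}` and `e^{ad BCH(x,y)}` are conjugation by `e^x e^y`, so the argument of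
  -- the logarithm is `e^{ad z} - 1` with `z = BCH(x,y)`.
  have hU : (fun p => expOp (bracket deg x) (expOp (bracket deg y) p) - p) =
      ⇑(opEval (adOp deg (bch x y)) (PowerSeries.exp ℚ - 1)) := by
    funext p
    rw [sub_eq_add_neg (PowerSeries.exp ℚ), opEval_add, opEval_neg, opEval_one, adOp_even hdz, LinearMap.add_apply,
      opEval_comm_exp hz, expOp_bracket hx hdx, expOp_bracket hy hdy, exp_bch hx hy, neg_bch hx hy,
      exp_bch (Submodule.neg_mem _ hy) (Submodule.neg_mem _ hx), LinearMap.neg_apply,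
      Module.End.one_apply, ← sub_eq_add_neg]
    simp only [mul_assoc]
  funext p
  rw [bchOp, hU, logOnePlusOp_eq, ← opEval_subst hC _ (by simp),
    PowerSeries.log_subst_exp_sub_one, opEval_X hC]
  rfl

end Degree

end NCSeries

namespace NCSeries

variable {G H : Type} {deg : G → ℤ} {S : Set G}

/-! ### Lie series -/

theorem homPart_apply (m : ℕ) (p : NCSeries G) (w : List G) :
    homPart m p w = if w.length = m then p w else 0 := rfl

theorem homPart_mem_ord (m : ℕ) (p : NCSeries G) : homPart m p ∈ ord G m := fun w hw => by
  rw [homPart_apply, if_neg (by omega)]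

theorem seriesSum_homPart (p : NCSeries G) : seriesSum (fun m => homPart m p) = p := by
  ext w
  simp [seriesSum, homPart_apply]

theorem homPart_sub (m : ℕ) (p q : NCSeries G) : homPart m (p - q) = homPart m p - homPart m q := by
  ext w
  rw [sub_apply, homPart_apply, homPart_apply, homPart_apply]
  split_ifs <;> simp [sub_apply]

theorem homPart_eq_zero {m n : ℕ} (h : m < n) {p : NCSeries G} (hp : p ∈ ord G n) :
    homPart m p = 0 := by
  ext w
  rw [homPart_apply]
  split_ifs with hw
  · rw [hp w (by omega)]; rfl
  · rfl

theorem homPart_congr {m n : ℕ} (h : m < n) {p q : NCSeries G} (hpq : p - q ∈ ord G n) :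
    homPart m p = homPart m q := by
  rw [← sub_eq_zero, ← homPart_sub, homPart_eq_zero h hpq]

theorem homPart_homPart (m n : ℕ) (p : NCSeries G) :
    homPart m (homPart n p) = if m = n then homPart n p else 0 := by
  ext w
  simp only [homPart_apply]
  split_ifs with h1 h2 h3 h4
  · rw [homPart_apply, if_pos (h1.trans h3)]
  · exact absurd (h1.symm.trans h2) h3
  · rw [homPart_apply, if_neg (fun h => h2 h)]
  · rfl
  · rw [homPart_apply, if_neg (by omega)]
  · rfl

theorem seriesSum_mem_lieSeries {t : ℕ → NCSeries G} (ht : ∀ k, t k ∈ lieSeries deg S) :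
    seriesSum t ∈ lieSeries deg S := fun m => by
  have : homPart m (seriesSum t) = ∑ k ∈ Finset.range (m + 1), homPart m (t k) := by
    ext w
    rw [sum_apply]
    simp only [homPart_apply, seriesSum]
    split_ifs with h
    · rw [h]
    · simp
  rw [this]
  exact isLiePoly_sum deg S _ _ fun k _ => ht k m

theorem isLiePoly_mem_ord {p : NCSeries G} (hp : IsLiePoly deg S p) : p ∈ ord G 1 := by
  induction hp with
  | zero => exact Submodule.zero_mem _
  | of g _ => exact of_mem_ord g
  | add p q _ _ hp hq => exact Submodule.add_mem _ hp hq
  | smul c p _ hp => exact Submodule.smul_mem _ c hp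
  | bracket p q _ _ hp hq => exact ord_mono (by omega) (bracket_mem_ord hp hq)

theorem of_mem_lieSeries {g : G} (hg : g ∈ S) : of g ∈ lieSeries deg S := fun m => by
  by_cases hm : m = 1
  · have : homPart m (of g) = of g := by
      ext w
      rw [homPart_apply, hm]
      split_ifs with h
      · rfl
      · symm
        rw [of, if_neg]
        rintro rfl
        exact h rfl
    rw [this]
    exact IsLiePoly.of g hg
  · have : homPart m (of g) = 0 := by
      ext w
      rw [homPart_apply]
      split_ifs with h
      · rw [of, if_neg]
        · rfl
        · rintro rfl
          exact hm h.symm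
      · rfl
    rw [this]
    exact IsLiePoly.zero

theorem isLiePoly_mem_lieSeries {p : NCSeries G} (hp : IsLiePoly deg S p) :
    p ∈ lieSeries deg S := by
  induction hp with
  | zero => exact Submodule.zero_mem _
  | of g hg => exact of_mem_lieSeries hg
  | add p q _ _ hp hq => exact Submodule.add_mem _ hp hq
  | smul c p _ hp => exact Submodule.smul_mem _ c hp
  | bracket p q _ _ hp hq => exact bracket_mem_lieSeries deg hp hq

theorem isLiePoly_mono {S' : Set G} (h : S ⊆ S') {p : NCSeries G} (hp : IsLiePoly deg S p) :
    IsLiePoly deg S' p := by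
  induction hp with
  | zero => exact .zero
  | of g hg => exact .of g (h hg)
  | add p q _ _ hp hq => exact .add _ _ hp hq
  | smul c p _ hp => exact .smul _ _ hp
  | bracket p q _ _ hp hq => exact .bracket _ _ hp hq

theorem lieSeries_mono {S' : Set G} (h : S ⊆ S') : lieSeries deg S ≤ lieSeries deg S' :=
  fun _ hp m => isLiePoly_mono h (hp m)

theorem lieSeries_mem_ord {p : NCSeries G} (hp : p ∈ lieSeries deg S) : p ∈ ord G 1 := by
  rw [← seriesSum_homPart p]
  exact seriesSum_mem_ord fun k => isLiePoly_mem_ord (hp k)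

theorem piece_mem_ord {d : ℤ} {p : NCSeries G} (hp : p ∈ piece deg d) : p ∈ ord G 1 :=
  lieSeries_mem_ord hp.1

/-- By continuity it is enough to check the homogeneous parts, which are Lie polynomials and
therefore open to structural induction. -/
theorem map_mem_lieSeries {degH : H → ℤ} {S' : Set H} {Ψ : NCSeries G →ₗ[ℚ] NCSeries H}
    (hΨ : Filtered Ψ) (h : ∀ p, IsLiePoly deg S p → Ψ p ∈ lieSeries degH S') {p : NCSeries G}
    (hp : p ∈ lieSeries deg S) : Ψ p ∈ lieSeries degH S' := by
  rw [← seriesSum_homPart p, map_seriesSum hΨ fun k => homPart_mem_ord k p]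
  exact seriesSum_mem_lieSeries fun k => h _ (hp k)

theorem map_eq_zero_of_mem_lieSeries {Ψ : NCSeries G →ₗ[ℚ] NCSeries H}
    (hΨ : Filtered Ψ) (h : ∀ p, IsLiePoly deg S p → Ψ p = 0) {p : NCSeries G}
    (hp : p ∈ lieSeries deg S) : Ψ p = 0 := by
  rw [← seriesSum_homPart p, map_seriesSum hΨ fun k => homPart_mem_ord k p]
  ext w
  exact Finset.sum_eq_zero fun k _ => by simp only [h _ (hp k)]; rfl

theorem opEval_adOp_mem_lieSeries {x p : NCSeries G} (hx : x ∈ lieSeries deg S)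
    (hp : p ∈ lieSeries deg S) (f : PowerSeries ℚ) :
    opEval (adOp deg x) f p ∈ lieSeries deg S :=
  opEval_mem (fun _ => seriesSum_mem_lieSeries) (fun _ hq => bracket_mem_lieSeries deg hx hq) f hp

/-- Multiplication of every word by its length. -/
noncomputable def euler (G : Type) : Module.End ℚ (NCSeries G) where
  toFun p := fun w => (w.length : ℚ) * p w
  map_add' p q := by ext w; exact mul_add _ _ _
  map_smul' c p := by ext w; exact mul_left_comm _ _ _

theorem euler_apply (p : NCSeries G) (w : List G) : euler G p w = (w.length : ℚ) * p w := rfl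

theorem euler_mul (p q : NCSeries G) : euler G (p * q) = euler G p * q + p * euler G q := by
  ext w
  rw [euler_apply, add_apply, mul_apply, mul_apply, mul_apply, Finset.mul_sum,
    ← Finset.sum_add_distrib]
  refine Finset.sum_congr rfl fun i hi => ?_
  rw [Finset.mem_range] at hi
  rw [euler_apply, euler_apply]
  have : (w.length : ℚ) = (w.take i).length + (w.drop i).length := by
    rw [← Nat.cast_add, ← List.length_append, List.take_append_drop]
  rw [this]
  ring

theorem euler_one : euler G 1 = 0 := by
  ext w
  cases w with
  | nil => rw [euler_apply]; simp [zero_apply]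
  | cons g w => rw [euler_apply, one_cons, mul_zero]; rfl

theorem filtered_euler : Filtered (euler G) := fun m p hp w hw => by
  rw [euler_apply, hp w hw, mul_zero]

theorem homPart_euler (m : ℕ) (p : NCSeries G) : homPart m (euler G p) = (m : ℚ) • homPart m p := by
  ext w
  rw [homPart_apply, smul_apply, homPart_apply]
  split_ifs with h
  · rw [euler_apply, h]
  · rw [mul_zero]

theorem euler_mem_lieSeries {p : NCSeries G} (hp : p ∈ lieSeries deg S) :
    euler G p ∈ lieSeries deg S := fun m => by
  rw [homPart_euler]
  exact .smul _ _ (hp m)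

theorem adOp_pow_sub_mem_ord {z z' y y' : NCSeries G} {m : ℕ} (hz : z ∈ ord G 1)
    (hz' : z' ∈ ord G 1) (hy' : y' ∈ ord G 1) (h : z - z' ∈ ord G m) (hy : y - y' ∈ ord G m)
    (k : ℕ) : (adOp deg z ^ k) y - (adOp deg z' ^ k) y' ∈ ord G (m + k) := by
  induction k with
  | zero => simpa using hy
  | succ k ih =>
    rw [pow_succ', pow_succ', Module.End.mul_apply, Module.End.mul_apply]
    set u := (adOp deg z ^ k) y
    set u' := (adOp deg z' ^ k) y' with hu'
    have hu'' : u' ∈ ord G (1 + k) := (contracting_adOp hz').pow k 1 hy'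
    have e : adOp deg z u - adOp deg z' u' = adOp deg z (u - u') + adOp deg (z - z') u' := by
      have : bracket deg z u' = bracket deg (z - z') u' + bracket deg z' u' := by
        rw [← bracket_add_left, sub_add_cancel]
      rw [map_sub]
      simp only [adOp_apply]
      rw [this]
      abel
    rw [e]
    exact Submodule.add_mem _ (contracting_adOp hz _ _ ih)
      (ord_mono (by omega) (bracket_mem_ord h hu''))

/-- If `((1 - exp (-ad z)) / ad z) (euler z)` is a Lie series, then so is `z`. -/
theorem mem_lieSeries_of_expQuot_euler {z : NCSeries G} (hz : z ∈ ord G 1)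
    (h : opEval (adOp deg z) PowerSeries.expQuot (euler G z) ∈ lieSeries deg S) :
    z ∈ lieSeries deg S := by
  intro m
  induction m using Nat.strong_induction_on with
  | _ m ih =>
  obtain rfl | hm := Nat.eq_zero_or_pos m
  · rw [homPart_eq_zero one_pos hz]
    exact .zero
  -- The truncation below length `m` is a Lie series by induction, hence so is the corresponding
  -- `L'`.
  set z' := ∑ j ∈ Finset.range m, homPart j z with hz'def
  have hz' : z' ∈ lieSeries deg S := Submodule.sum_mem _ fun j hj =>
    isLiePoly_mem_lieSeries (ih j (Finset.mem_range.1 hj))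
  have hz'1 := lieSeries_mem_ord hz'
  have hzz' : z - z' ∈ ord G m := by
    have := seriesSum_sub_mem (fun k => homPart_mem_ord k z) m
    rwa [seriesSum_homPart] at this
  have hyy' : euler G z - euler G z' ∈ ord G m := by
    rw [← map_sub]; exact filtered_euler _ _ hzz'
  set L := opEval (adOp deg z) PowerSeries.expQuot (euler G z) with hL
  set L' := opEval (adOp deg z') PowerSeries.expQuot (euler G z') with hL'
  have hL'mem : L' ∈ lieSeries deg S :=
    opEval_adOp_mem_lieSeries hz' (euler_mem_lieSeries hz') _
  have hc0 : PowerSeries.coeff 0 PowerSeries.expQuot = 1 := by simp [PowerSeries.expQuot]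
  have hy1 : euler G z - euler G z' ∈ ord G 1 :=
    Submodule.sub_mem _ (filtered_euler _ _ hz) (filtered_euler _ _ hz'1)
  -- Modulo length `m + 1`, `L - L'` equals `euler z - euler z'`: the constant coefficient of
  -- `expQuot` is 1, and each application of `ad` lengthens the discrepancy by a letter. So the part
  -- of `euler z` of length `m` is that of `L - L' + euler z'`.
  have key : L - (L - L' + euler G z') - (L - euler G z) ∈ ord G (m + 1) := by
    have e : L - (L - L' + euler G z') - (L - euler G z) =
        (euler G z - euler G z') - (L - L') := by abel
    rw [e, hL, hL', opEval_apply, opEval_apply]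
    have e2 : (euler G z - euler G z') - ((seriesSum fun k => PowerSeries.coeff k
        PowerSeries.expQuot • (adOp deg z ^ k) (euler G z)) - seriesSum fun k => PowerSeries.coeff k
        PowerSeries.expQuot • (adOp deg z' ^ k) (euler G z')) = seriesSum fun k =>
        (if k = 0 then euler G z - euler G z' else 0) - PowerSeries.coeff k PowerSeries.expQuot •
          ((adOp deg z ^ k) (euler G z) - (adOp deg z' ^ k) (euler G z')) := by
      ext w
      have h0 : ∑ k ∈ Finset.range (w.length + 1), (if k = 0 then euler G z - euler G z' else 0) w =
          (euler G z - euler G z') w := by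
        rw [Finset.sum_eq_single 0]
        · simp
        · intro k _ hk; rw [if_neg hk]; rfl
        · simp
      rw [sub_apply, ← h0]
      simp only [seriesSum, sub_apply, smul_sub, Finset.sum_sub_distrib]
    rw [e2]
    refine seriesSum_mem_ord fun k => ?_
    match k with
    | 0 => simp [hc0]
    | k + 1 =>
      rw [if_neg (Nat.succ_ne_zero k), zero_sub]
      exact Submodule.neg_mem _ (Submodule.smul_mem _ _ (ord_mono (by omega)
        (adOp_pow_sub_mem_ord hz hz'1 (filtered_euler _ _ hz'1) hzz' hyy' (k + 1))))
  have hpart := homPart_congr (m := m) (Nat.lt_succ_self m) (p := euler G z)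
    (q := L - L' + euler G z') (by
      have e : euler G z - (L - L' + euler G z') =
        L - (L - L' + euler G z') - (L - euler G z) := by abel
      rw [e]; exact key)
  have hlie : IsLiePoly deg S (homPart m (euler G z)) := by
    rw [hpart]
    exact Submodule.add_mem _ (Submodule.sub_mem _ h hL'mem) (euler_mem_lieSeries hz') m
  -- On length `m > 0` the Euler derivation is the invertible scalar `m`.
  rw [homPart_euler] at hlie
  have := IsLiePoly.smul ((m : ℚ)⁻¹) _ hlie
  rwa [smul_smul, inv_mul_cancel₀ (by exact_mod_cast hm.ne'), one_smul] at this

/-- The **Baker-Campbell-Hausdorff theorem**. -/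
theorem bch_mem_lieSeries {x y : NCSeries G} (hx : x ∈ lieSeries deg S) (hy : y ∈ lieSeries deg S)
    (hdx : x ∈ homDeg deg 0) (hdy : y ∈ homDeg deg 0) : bch x y ∈ lieSeries deg S := by
  have hx1 := lieSeries_mem_ord hx
  have hy1 := lieSeries_mem_ord hy
  have hz1 := bch_mem_ord hx1 hy1
  have hdz := bch_mem_homDeg hdx hdy
  have form : ∀ {z : NCSeries G}, z ∈ ord G 1 → z ∈ homDeg deg 0 →
      opEval (adOp deg z) PowerSeries.expQuot (euler G z) = exp (-z) * euler G (exp z) :=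
    fun hz hd => by
      rw [adOp_even hd]
      exact (exp_neg_mul_derivation_exp filtered_euler euler_one hz fun q => euler_mul _ q).symm
  refine mem_lieSeries_of_expQuot_euler hz1 ?_
  -- The logarithmic derivative of a product: that of `e^x e^y` is `e^{-ad y}` of that of `e^x`,
  -- plus that of `e^y`. Both are Lie series, as power series in `ad` applied to Lie series.
  have e : exp (-bch x y) * euler G (exp (bch x y)) =
      expOp (bracket deg (-y)) (opEval (adOp deg x) PowerSeries.expQuot (euler G x)) +
        opEval (adOp deg y) PowerSeries.expQuot (euler G y) := by
    rw [expOp_bracket (Submodule.neg_mem _ hy1) (Submodule.neg_mem _ hdy), form hx1 hdx,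
      form hy1 hdy, neg_bch hx1 hy1, exp_bch (Submodule.neg_mem _ hy1) (Submodule.neg_mem _ hx1),
      exp_bch hx1 hy1, euler_mul, neg_neg, mul_add]
    have e2 : exp (-y) * exp (-x) * (exp x * euler G (exp y)) =
        exp (-y) * (exp (-x) * exp x) * euler G (exp y) := by noncomm_ring
    rw [e2, exp_neg_mul_exp hx1, mul_one]
    noncomm_ring
  rw [form hz1 hdz, e, ← coe_adOp, expOp_eq]
  exact Submodule.add_mem _ (opEval_adOp_mem_lieSeries (Submodule.neg_mem _ hy)
    (opEval_adOp_mem_lieSeries hx (euler_mem_lieSeries hx) _) _)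
    (opEval_adOp_mem_lieSeries hy (euler_mem_lieSeries hy) _)

end NCSeries

namespace NCSeries

theorem shift_of_self {G : Type} (g : G) : shift g (of g) = 1 := by
  ext w
  rw [shift_apply, of]
  cases w with
  | nil => rw [if_pos rfl]; rfl
  | cons a w => rw [if_neg (by simp), one_cons]

theorem shift_of_ne {G : Type} {g h : G} (hne : h ≠ g) : shift h (of g) = 0 := by
  ext w
  rw [shift_apply, of, if_neg (fun e => hne (List.cons.inj e).1)]
  rfl

theorem mem_homDeg_zero {ι : Type} (p : NCSeries ι) : p ∈ homDeg (fun _ : ι => (0 : ℤ)) 0 :=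
  fun w _ => by
    rw [wordDeg]
    simp

theorem foldr_eq_prod {G ι : Type} (T : ι → Module.End ℚ (NCSeries G)) (l : List ι)
    (p : NCSeries G) : l.foldr (fun i q => T i q) p = (l.map T).prod p := by
  induction l with
  | nil => rfl
  | cons i l ih => rw [List.foldr_cons, ih, List.map_cons, List.prod_cons, Module.End.mul_apply]

variable {G H ι : Type} [Fintype ι]

/-! ### Substitution of operators into series in non-commuting variables -/

/-- The part of `evalOp` coming from words of length `k`. -/
noncomputable def evalPart (T : ι → Module.End ℚ (NCSeries G)) (Q : NCSeries ι) (k : ℕ) :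
    Module.End ℚ (NCSeries G) :=
  ∑ u : Fin k → ι, Q (List.ofFn u) • ((List.ofFn u).map T).prod

theorem evalOp_eq (T : ι → Module.End ℚ (NCSeries G)) (Q : NCSeries ι) (p : NCSeries G) :
    evalOp (fun i => ⇑(T i)) Q p = seriesSum fun k => evalPart T Q k p := by
  rw [evalOp]
  congr 1
  funext k
  rw [evalPart, LinearMap.sum_apply]
  exact Finset.sum_congr rfl fun u _ => by rw [foldr_eq_prod, LinearMap.smul_apply]

theorem evalPart_zero (T : ι → Module.End ℚ (NCSeries G)) (Q : NCSeries ι) (p : NCSeries G) :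
    evalPart T Q 0 p = Q [] • p := by
  rw [evalPart, Fintype.sum_unique]
  simp

theorem evalPart_succ (T : ι → Module.End ℚ (NCSeries G)) (Q : NCSeries ι) (k : ℕ) (p : NCSeries G) :
    evalPart T Q (k + 1) p = ∑ i, T i (evalPart T (shift i Q) k p) := by
  rw [evalPart, ← Fintype.sum_equiv (Fin.consEquiv fun _ => ι) (fun x => Q (x.1 :: List.ofFn x.2) •
    (T x.1 * ((List.ofFn x.2).map T).prod)) _ fun x => by
      simp [Fin.consEquiv, List.ofFn_succ],
    Fintype.sum_prod_type, LinearMap.sum_apply]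
  refine Finset.sum_congr rfl fun i _ => ?_
  rw [evalPart, LinearMap.sum_apply, LinearMap.sum_apply, map_sum]
  exact Finset.sum_congr rfl fun u _ => by
    rw [LinearMap.smul_apply, LinearMap.smul_apply, map_smul]; rfl

variable {T : ι → Module.End ℚ (NCSeries G)}


theorem evalPart_mem_ord (hT : ∀ i, Contracting (T i)) (Q : NCSeries ι) (k : ℕ) {m : ℕ} {p : NCSeries G} (hp : p ∈ ord G m) :
    evalPart T Q k p ∈ ord G (m + k) := by
  induction k generalizing Q with
  | zero => rw [evalPart_zero]; exact Submodule.smul_mem _ _ hp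
  | succ k ih =>
    rw [evalPart_succ]
    exact Submodule.sum_mem _ fun i _ => hT i _ _ (ih _)

theorem evalPart_mem_ord' (hT : ∀ i, Contracting (T i)) (Q : NCSeries ι) (k : ℕ)
    (p : NCSeries G) : evalPart T Q k p ∈ ord G k := by
  simpa using evalPart_mem_ord hT Q k (mem_ord_zero p)

/-- The first letter of a word acts last. Splitting it off expresses the value through the series
`shift i Q`. -/
theorem evalOp_rec (hT : ∀ i, Contracting (T i)) (Q : NCSeries ι) (p : NCSeries G) :
    evalOp (fun i => ⇑(T i)) Q p =
      Q [] • p + ∑ i, T i (evalOp (fun i => ⇑(T i)) (shift i Q) p) := by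
  have h : ∑ i, T i (evalOp (fun i => ⇑(T i)) (shift i Q) p) =
      seriesSum fun k => evalPart T Q (k + 1) p := by
    ext w
    rw [sum_apply, seriesSum]
    simp only [evalPart_succ, sum_apply]
    rw [Finset.sum_comm]
    refine Finset.sum_congr rfl fun i _ => ?_
    rw [evalOp_eq, map_seriesSum (hT i).filtered fun k => evalPart_mem_ord' hT _ k p]
    rfl
  rw [h, evalOp_eq]
  ext w
  rw [add_apply, seriesSum, seriesSum, Finset.sum_range_succ', Finset.sum_range_succ,
    evalPart_zero, evalPart_mem_ord' hT Q (w.length + 1) p w (Nat.lt_succ_self _), add_zero, add_comm]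

theorem evalPart_add (T : ι → Module.End ℚ (NCSeries G)) (Q Q' : NCSeries ι) (k : ℕ) :
    evalPart T (Q + Q') k = evalPart T Q k + evalPart T Q' k := by
  rw [evalPart, evalPart, evalPart, ← Finset.sum_add_distrib]
  exact Finset.sum_congr rfl fun u _ => by rw [add_apply, add_smul]

theorem evalPart_smul (T : ι → Module.End ℚ (NCSeries G)) (c : ℚ) (Q : NCSeries ι) (k : ℕ) :
    evalPart T (c • Q) k = c • evalPart T Q k := by
  rw [evalPart, evalPart, Finset.smul_sum]
  exact Finset.sum_congr rfl fun u _ => by rw [smul_apply, mul_smul]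

/-- `evalOp` as a bilinear map. -/
noncomputable def evalLin (T : ι → Module.End ℚ (NCSeries G)) :
    NCSeries ι →ₗ[ℚ] Module.End ℚ (NCSeries G) :=
  LinearMap.mk₂ ℚ (fun Q p => evalOp (fun i => ⇑(T i)) Q p)
    (fun Q Q' p => by
      simp only [evalOp_eq, evalPart_add, LinearMap.add_apply, seriesSum_add])
    (fun c Q p => by
      simp only [evalOp_eq, evalPart_smul, LinearMap.smul_apply, seriesSum_smul])
    (fun Q p p' => by simp only [evalOp_eq, map_add, seriesSum_add])
    (fun c Q p => by simp only [evalOp_eq, map_smul, seriesSum_smul])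

theorem evalLin_apply (T : ι → Module.End ℚ (NCSeries G)) (Q : NCSeries ι) (p : NCSeries G) :
    evalLin T Q p = evalOp (fun i => ⇑(T i)) Q p := rfl

theorem evalLin_eq (T : ι → Module.End ℚ (NCSeries G)) (Q : NCSeries ι) (p : NCSeries G) :
    evalLin T Q p = seriesSum fun k => evalPart T Q k p := evalOp_eq T Q p

theorem evalLin_rec (hT : ∀ i, Contracting (T i)) (Q : NCSeries ι) (p : NCSeries G) :
    evalLin T Q p = Q [] • p + ∑ i, T i (evalLin T (shift i Q) p) := evalOp_rec hT Q p

theorem filtered_evalLin (hT : ∀ i, Contracting (T i)) (Q : NCSeries ι) : Filtered (evalLin T Q) :=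
  fun m p hp => by
    rw [evalLin_eq]
    exact seriesSum_mem_ord fun k => ord_mono (Nat.le_add_right _ _) (evalPart_mem_ord hT Q k hp)

theorem evalLin_mem_ord (hT : ∀ i, Contracting (T i)) {m : ℕ} {Q : NCSeries ι} (hQ : Q ∈ ord ι m)
    (p : NCSeries G) : evalLin T Q p ∈ ord G m := by
  rw [evalLin_eq]
  refine seriesSum_mem_ord fun k => ?_
  by_cases h : k < m
  · have : evalPart T Q k = 0 := Finset.sum_eq_zero fun u _ => by
      rw [hQ _ (by rwa [List.length_ofFn]), zero_smul]
    rw [this]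
    exact Submodule.zero_mem _
  · exact ord_mono (by omega) (evalPart_mem_ord' hT Q k p)

theorem evalLin_sub_smul_mem_ord (hT : ∀ i, Contracting (T i)) (Q : NCSeries ι) {m : ℕ}
    {p : NCSeries G} (hp : p ∈ ord G m) : evalLin T Q p - Q [] • p ∈ ord G (m + 1) := by
  rw [evalLin_rec hT, add_sub_cancel_left]
  exact Submodule.sum_mem _ fun i _ => hT i _ _ (filtered_evalLin hT _ _ _ hp)

theorem evalLin_one (hT : ∀ i, Contracting (T i)) (p : NCSeries G) :
    evalLin T 1 p = p := by
  rw [evalLin_rec hT, one_nil, one_smul]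
  simp [shift_one]

/-- By the recursion, the difference of the two sides is the sum over `i` of `T i` applied to the
same difference for `shift i Q`. Each `T i` gains a letter, so the difference lies in every `ord`.
-/
theorem evalLin_mul (hT : ∀ i, Contracting (T i)) (Q Q' : NCSeries ι) (p : NCSeries G) :
    evalLin T (Q * Q') p = evalLin T Q (evalLin T Q' p) := by
  refine eq_of_forall_sub_mem_ord fun N => ?_
  induction N generalizing Q with
  | zero => exact mem_ord_zero _
  | succ N ih =>
    have e : evalLin T (Q * Q') p - evalLin T Q (evalLin T Q' p) =
        ∑ i, T i (evalLin T (shift i Q * Q') p - evalLin T (shift i Q) (evalLin T Q' p)) := by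
      rw [evalLin_rec hT (Q * Q'), evalLin_rec hT Q (evalLin T Q' p), evalLin_rec hT Q', mul_nil]
      simp only [shift_mul, map_add, map_smul, LinearMap.add_apply, LinearMap.smul_apply, smul_add,
        map_sub, Finset.sum_add_distrib, Finset.sum_sub_distrib, ← Finset.smul_sum, smul_smul,
        map_sum]
      abel_nf
    rw [e]
    exact Submodule.sum_mem _ fun i _ => hT i _ _ (ih _)

/-- The several-operator form of `map_opEval`; it serves substitutions, the twisted differential
`∂_a` and the relabellings of cells. -/
theorem map_evalLin {Ψ : NCSeries G →ₗ[ℚ] NCSeries H} (hΨ : Filtered Ψ)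
    (hT : ∀ i, Contracting (T i)) {T' : ι → Module.End ℚ (NCSeries H)}
    (h : ∀ i p, Ψ (T i p) = T' i (Ψ p)) (Q : NCSeries ι) (p : NCSeries G) :
    Ψ (evalLin T Q p) = evalLin T' Q (Ψ p) := by
  rw [evalLin_eq, map_seriesSum hΨ fun k => evalPart_mem_ord' hT Q k p, evalLin_eq]
  congr 1
  funext k
  induction k generalizing Q with
  | zero => rw [evalPart_zero, evalPart_zero, map_smul]
  | succ k ih =>
    rw [evalPart_succ, evalPart_succ, map_sum]
    exact Finset.sum_congr rfl fun i _ => by rw [h, ih]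

theorem evalLin_mem {V : Submodule ℚ (NCSeries G)} (hV : ∀ t : ℕ → NCSeries G, (∀ k, t k ∈ V) →
    seriesSum t ∈ V) (hTV : ∀ i, ∀ p ∈ V, T i p ∈ V) (Q : NCSeries ι)
    {p : NCSeries G} (hp : p ∈ V) : evalLin T Q p ∈ V := by
  rw [evalLin_eq]
  refine hV _ fun k => ?_
  induction k generalizing Q with
  | zero => rw [evalPart_zero]; exact Submodule.smul_mem _ _ hp
  | succ k ih => rw [evalPart_succ]; exact Submodule.sum_mem _ fun i _ => hTV i _ (ih _)

theorem evalLin_of (hT : ∀ i, Contracting (T i)) (i : ι) (p : NCSeries G) :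
    evalLin T (of i) p = T i p := by
  rw [evalLin_rec hT, mem_ord_one.1 (of_mem_ord i), zero_smul, zero_add,
    Finset.sum_eq_single i]
  · rw [shift_of_self, evalLin_one hT]
  · intro j _ hj
    rw [shift_of_ne hj]
    simp
  · simp

/-! ### Substitution of series -/

/-- Substitution as a linear map. -/
noncomputable def substLin (x : ι → NCSeries G) : NCSeries ι →ₗ[ℚ] NCSeries G :=
  (evalLin fun i => LinearMap.mulLeft ℚ (x i)).flip 1

theorem substLin_apply (x : ι → NCSeries G) (μ : NCSeries ι) : substLin x μ = subst x μ := rfl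

section Subst

variable {x : ι → NCSeries G}

theorem filtered_substLin (hx : ∀ i, x i ∈ ord G 1) : Filtered (substLin x) :=
  fun _ _ hμ => evalLin_mem_ord (fun i => contracting_mulLeft (hx i)) hμ 1

theorem substLin_one (hx : ∀ i, x i ∈ ord G 1) : substLin x 1 = 1 :=
  evalLin_one (fun i => contracting_mulLeft (hx i)) 1

theorem substLin_of (hx : ∀ i, x i ∈ ord G 1) (i : ι) : substLin x (of i) = x i :=
  (evalLin_of (fun i => contracting_mulLeft (hx i)) i 1).trans (mul_one _)

theorem substLin_mul (hx : ∀ i, x i ∈ ord G 1) (μ ν : NCSeries ι) :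
    substLin x (μ * ν) = substLin x μ * substLin x ν := by
  have hc : ∀ i, Contracting (LinearMap.mulLeft ℚ (x i)) := fun i => contracting_mulLeft (hx i)
  change evalLin _ (μ * ν) 1 = evalLin _ μ 1 * evalLin _ ν 1
  rw [evalLin_mul hc]
  have := map_evalLin (filtered_mulRight (evalLin (fun i => LinearMap.mulLeft ℚ (x i)) ν 1)) hc
    (T' := fun i => LinearMap.mulLeft ℚ (x i)) (fun i p => mul_assoc _ _ _) μ 1
  rw [LinearMap.mulRight_apply, LinearMap.mulRight_apply, one_mul] at this
  exact this.symm

theorem substLin_mem_homDeg {deg : G → ℤ} (hx : ∀ i, x i ∈ homDeg deg 0) (μ : NCSeries ι) :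
    substLin x μ ∈ homDeg deg 0 :=
  evalLin_mem (fun _ => seriesSum_mem_homDeg) (fun i p hp => by
    simpa using mul_mem_homDeg (hx i) hp) μ one_mem_homDeg

theorem substLin_bracket {deg : G → ℤ} (hx : ∀ i, x i ∈ ord G 1) (hd : ∀ i, x i ∈ homDeg deg 0)
    (p q : NCSeries ι) : substLin x (bracket (fun _ => 0) p q) =
      bracket deg (substLin x p) (substLin x q) := by
  rw [bracket_even (mem_homDeg_zero p), bracket_even (substLin_mem_homDeg hd p), map_sub,
    substLin_mul hx, substLin_mul hx]

theorem substLin_mem_lieSeries {deg : G → ℤ} {S : Set G} (hx : ∀ i, x i ∈ lieSeries deg S)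
    (hd : ∀ i, x i ∈ homDeg deg 0) {μ : NCSeries ι}
    (hμ : μ ∈ lieSeries (fun _ : ι => (0 : ℤ)) Set.univ) : substLin x μ ∈ lieSeries deg S := by
  have hx1 : ∀ i, x i ∈ ord G 1 := fun i => lieSeries_mem_ord (hx i)
  refine map_mem_lieSeries (filtered_substLin hx1) (fun p hp => ?_) hμ
  induction hp with
  | zero => rw [map_zero]; exact Submodule.zero_mem _
  | of i _ => rw [substLin_of hx1]; exact hx i
  | add p q _ _ hp hq => rw [map_add]; exact Submodule.add_mem _ hp hq
  | smul c p _ hp => rw [map_smul]; exact Submodule.smul_mem _ c hp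
  | bracket p q _ _ hp hq =>
    rw [substLin_bracket hx1 hd]
    exact bracket_mem_lieSeries deg hp hq

theorem map_substLin {Ψ : NCSeries G →ₗ[ℚ] NCSeries H} (hΨ : Filtered Ψ) (h1 : Ψ 1 = 1)
    (hmul : ∀ p q, Ψ (p * q) = Ψ p * Ψ q) (hx : ∀ i, x i ∈ ord G 1) (μ : NCSeries ι) :
    Ψ (substLin x μ) = substLin (fun i => Ψ (x i)) μ := by
  have := map_evalLin hΨ (fun i => contracting_mulLeft (hx i))
    (T' := fun i => LinearMap.mulLeft ℚ (Ψ (x i))) (fun i p => hmul _ _) μ 1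
  rw [h1] at this
  exact this

end Subst

/-- The defining identity of `Q` with arbitrary even series in place of the variables. -/
theorem _root_.IsBCHRemainder.bch_eq {Q : NCSeries (Fin 2)} (hQ : IsBCHRemainder Q) {deg : G → ℤ}
    {x y : NCSeries G} (hx : x ∈ ord G 1) (hy : y ∈ ord G 1) (hdx : x ∈ homDeg deg 0)
    (hdy : y ∈ homDeg deg 0) :
    bch x y = x + y + evalOp ![bracket deg x, bracket deg y] Q y := by
  have h1 : ∀ i, (![x, y] : Fin 2 → NCSeries G) i ∈ ord G 1 := by
    intro i; fin_cases i <;> assumption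
  have hd : ∀ i, (![x, y] : Fin 2 → NCSeries G) i ∈ homDeg deg 0 := by
    intro i; fin_cases i <;> assumption
  have e1 : (![bracket deg x, bracket deg y] : Fin 2 → NCSeries G → NCSeries G) =
      fun i => ⇑(adOp deg (![x, y] i)) := by
    funext i; fin_cases i <;> rfl
  have e2 : (![bracket (fun _ => 0) (of 0), bracket (fun _ => 0) (of 1)] :
      Fin 2 → NCSeries (Fin 2) → NCSeries (Fin 2)) =
      fun i => ⇑(adOp (fun _ => 0) (of i)) := by
    funext i; fin_cases i <;> rfl
  -- The universal identity is transported along the substitution. It is an algebra homomorphism,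
  -- and it respects brackets without signs because `x` and `y` have degree 0.
  have h := congrArg (substLin ![x, y]) hQ
  rw [e2, ← evalLin_apply, map_bch (filtered_substLin h1) (substLin_one h1) (substLin_mul h1)
    (of_mem_ord _) (of_mem_ord _), map_add, map_add, map_evalLin (filtered_substLin h1)
    (fun i => contracting_adOp (of_mem_ord i)) (T' := fun i => adOp deg (![x, y] i))
    (fun i p => by
      rw [adOp_apply, adOp_apply, substLin_bracket h1 hd, substLin_of h1]),
    substLin_of h1, substLin_of h1] at h
  rw [e1]
  exact h

end NCSeries

namespace NCSeries

variable {G : Type} {deg : G → ℤ}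

/-! ### Graded derivations of degree `-1` -/

theorem shift_sgn (p : NCSeries G) (a : G) :
    shift a (sgn deg p) = (-1 : ℚ) ^ deg a • sgn deg (shift a p) := by
  ext w
  rw [shift_apply, sgn_apply, smul_apply, sgn_apply, wordDeg_cons, zpow_add₀ (by norm_num),
    mul_assoc]
  rfl

theorem shift_mem_ord {m : ℕ} {p : NCSeries G} (hp : p ∈ ord G (m + 1)) (g : G) :
    shift g p ∈ ord G m := fun w hw => hp _ (by simpa using hw)

theorem shift_mem_homDeg {d : ℤ} {p : NCSeries G} (hp : p ∈ homDeg deg d) (g : G) :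
    shift g p ∈ homDeg deg (d - deg g) := fun w hw => by
  have := hp _ hw
  rw [wordDeg_cons] at this
  omega

section Derivation

variable [Fintype G]

/-- The coefficients of the derivation with given values on the generators. -/
noncomputable def derivCoeff (deg : G → ℤ) (δ : G → NCSeries G) : List G → NCSeries G → ℚ
  | [], p => (∑ g, δ g * shift g p) []
  | a :: w, p => (∑ g, δ g * shift g p) (a :: w) + (-1) ^ deg a * derivCoeff deg δ w (shift a p)

theorem derivCoeff_add (δ : G → NCSeries G) (w : List G) (p q : NCSeries G) :
    derivCoeff deg δ w (p + q) = derivCoeff deg δ w p + derivCoeff deg δ w q := by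
  induction w generalizing p q with
  | nil => simp only [derivCoeff, shift_add, mul_add, Finset.sum_add_distrib, add_apply]
  | cons a w ih =>
    simp only [derivCoeff, shift_add, mul_add, Finset.sum_add_distrib, add_apply, ih]
    ring

theorem derivCoeff_smul (δ : G → NCSeries G) (w : List G) (c : ℚ) (p : NCSeries G) :
    derivCoeff deg δ w (c • p) = c * derivCoeff deg δ w p := by
  induction w generalizing p with
  | nil => simp only [derivCoeff, shift_smul, mul_smul_comm, ← Finset.smul_sum, smul_apply]
  | cons a w ih =>
    simp only [derivCoeff, shift_smul, mul_smul_comm, ← Finset.smul_sum, smul_apply, ih]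
    ring

/-- The derivation of degree `-1` with given values on the generators. -/
noncomputable def derivExt (deg : G → ℤ) (δ : G → NCSeries G) : Module.End ℚ (NCSeries G) where
  toFun p := fun w => derivCoeff deg δ w p
  map_add' p q := by ext w; exact derivCoeff_add δ w p q
  map_smul' c p := by ext w; exact derivCoeff_smul δ w c p

variable {δ : G → NCSeries G}

theorem derivExt_nil (p : NCSeries G) :
    derivExt deg δ p [] = (∑ g, δ g * shift g p) [] := rfl

theorem derivExt_cons (p : NCSeries G) (a : G) (w : List G) :
    derivExt deg δ p (a :: w) =
      (∑ g, δ g * shift g p) (a :: w) + (-1) ^ deg a * derivExt deg δ (shift a p) w := rfl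

theorem shift_derivExt (p : NCSeries G) (a : G) : shift a (derivExt deg δ p) =
    shift a (∑ g, δ g * shift g p) + (-1 : ℚ) ^ deg a • derivExt deg δ (shift a p) := by
  ext w
  exact derivExt_cons p a w

/-- The coefficients encode `∂(g p) = δ_g p + (-1)^{|g|} g ∂p`; induction on the word gives the
graded Leibniz rule. Writing the sign as `sgn` makes it valid for inhomogeneous `p`. -/
theorem derivExt_mul (p q : NCSeries G) : derivExt deg δ (p * q) =
    derivExt deg δ p * q + sgn deg p * derivExt deg δ q := by
  have hsum : ∀ p, ∑ g, δ g * shift g (p * q) =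
      p [] • (∑ g, δ g * shift g q) + (∑ g, δ g * shift g p) * q := fun p => by
    simp only [shift_mul, mul_add, mul_smul_comm, Finset.sum_add_distrib, Finset.smul_sum,
      Finset.sum_mul, mul_assoc]
  have hnil : ∀ p : NCSeries G, sgn deg p [] = p [] := fun p => by
    rw [sgn_apply]; simp [wordDeg]
  ext w
  induction w generalizing p with
  | nil =>
    rw [derivExt_nil, hsum, add_apply, smul_apply, add_apply, mul_nil, mul_nil, mul_nil,
      derivExt_nil, derivExt_nil, hnil]
    ring
  | cons a w ih =>
    rw [derivExt_cons, hsum, shift_mul, map_add, map_smul, add_apply, add_apply, smul_apply,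
      smul_apply, ih, add_apply, add_apply, mul_cons, mul_cons, mul_cons (sgn deg p), shift_derivExt,
      shift_sgn, hnil, derivExt_nil, derivExt_cons, add_mul, add_apply, smul_mul_assoc,
      smul_mul_assoc, smul_apply, smul_apply]
    ring

theorem derivExt_one : derivExt deg δ 1 = 0 := by
  ext w
  cases w with
  | nil => rw [derivExt_nil]; simp [shift_one, zero_apply]
  | cons a w => rw [derivExt_cons, shift_one, map_zero]; simp [shift_one, zero_apply]

theorem derivExt_of (g : G) : derivExt deg δ (of g) = δ g := by
  have h : ∑ h, δ h * shift h (of g) = δ g := by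
    rw [Finset.sum_eq_single g]
    · rw [shift_of_self, mul_one]
    · intro h _ hne
      rw [shift_of_ne hne, mul_zero]
    · simp
  ext w
  cases w with
  | nil => rw [derivExt_nil, h]
  | cons a w =>
    rw [derivExt_cons, h]
    by_cases ha : a = g
    · rw [ha, shift_of_self, derivExt_one, zero_apply, mul_zero, add_zero]
    · rw [shift_of_ne ha, map_zero, zero_apply, mul_zero, add_zero]

theorem filtered_derivExt (hδ : ∀ g, δ g ∈ ord G 1) : Filtered (derivExt deg δ) := by
  intro m p hp
  induction m generalizing p with
  | zero => exact mem_ord_zero _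
  | succ m ih =>
    have h : ∑ g, δ g * shift g p ∈ ord G (m + 1) := Submodule.sum_mem _ fun g _ => by
      rw [add_comm]; exact mul_mem_ord (hδ g) (shift_mem_ord hp g)
    intro w hw
    cases w with
    | nil => exact h _ hw
    | cons a w =>
      rw [derivExt_cons, h _ hw, ih _ (shift_mem_ord hp a) w (by simpa using hw), mul_zero, add_zero]

theorem derivExt_mem_homDeg (hδ : ∀ g, δ g ∈ homDeg deg (deg g - 1)) {d : ℤ} {p : NCSeries G}
    (hp : p ∈ homDeg deg d) : derivExt deg δ p ∈ homDeg deg (d - 1) := by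
  intro w hw
  have h : ∀ {d p}, p ∈ homDeg deg d → ∑ g, δ g * shift g p ∈ homDeg deg (d - 1) := fun {d p} hp =>
    Submodule.sum_mem _ fun g _ => by
      have := mul_mem_homDeg (hδ g) (shift_mem_homDeg hp g)
      rwa [show deg g - 1 + (d - deg g) = d - 1 by ring] at this
  induction w generalizing d p with
  | nil => exact h hp _ hw
  | cons a w ih =>
    rw [derivExt_cons] at hw
    by_cases h1 : (∑ g, δ g * shift g p) (a :: w) = 0
    · rw [h1, zero_add] at hw
      rw [wordDeg_cons, ih (shift_mem_homDeg hp a) (right_ne_zero_of_mul hw)]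
      ring
    · exact h hp _ h1

theorem derivExt_sgn (hδ : ∀ g, δ g ∈ homDeg deg (deg g - 1)) (p : NCSeries G) :
    derivExt deg δ (sgn deg p) = -sgn deg (derivExt deg δ p) := by
  have h : ∀ p, ∑ g, δ g * shift g (sgn deg p) = -sgn deg (∑ g, δ g * shift g p) := fun p => by
    rw [map_sum, ← Finset.sum_neg_distrib]
    refine Finset.sum_congr rfl fun g _ => ?_
    rw [shift_sgn, sgn_mul, sgn_of_mem_homDeg (hδ g), zpow_sub₀ (by norm_num), smul_mul_assoc,
      mul_smul_comm, zpow_one, div_neg, div_one, neg_smul, neg_neg]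
  ext w
  induction w generalizing p with
  | nil => rw [derivExt_nil, h, neg_apply, neg_apply, sgn_apply, sgn_apply, derivExt_nil]
  | cons a w ih =>
    rw [derivExt_cons, h, shift_sgn, map_smul, smul_apply, ih, neg_apply, neg_apply, neg_apply,
      sgn_apply, sgn_apply, sgn_apply, derivExt_cons, wordDeg_cons, zpow_add₀ (by norm_num)]
    ring

theorem derivExt_even_mul {z : NCSeries G} (hz : z ∈ homDeg deg 0) (q : NCSeries G) :
    derivExt deg δ (z * q) = derivExt deg δ z * q + z * derivExt deg δ q := by
  rw [derivExt_mul, sgn_even hz]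

/-- The square of an odd derivation is an ordinary derivation: `∂` anticommutes with the parity
involution, so the mixed terms cancel. -/
theorem derivExt_derivExt_mul (hδ : ∀ g, δ g ∈ homDeg deg (deg g - 1)) (p q : NCSeries G) :
    derivExt deg δ (derivExt deg δ (p * q)) =
      derivExt deg δ (derivExt deg δ p) * q + p * derivExt deg δ (derivExt deg δ q) := by
  rw [derivExt_mul, map_add, derivExt_mul, derivExt_mul, derivExt_sgn hδ, sgn_sgn]
  noncomm_ring

theorem derivExt_bracket {d e : ℤ} (hδ : ∀ g, δ g ∈ homDeg deg (deg g - 1)) {p q : NCSeries G}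
    (hp : p ∈ homDeg deg d) (hq : q ∈ homDeg deg e) : derivExt deg δ (bracket deg p q) =
      bracket deg (derivExt deg δ p) q + (-1 : ℚ) ^ d • bracket deg p (derivExt deg δ q) := by
  rw [bracket_of_mem_homDeg hp hq, bracket_of_mem_homDeg (derivExt_mem_homDeg hδ hp) hq,
    bracket_of_mem_homDeg hp (derivExt_mem_homDeg hδ hq), map_sub, map_smul, derivExt_mul,
    derivExt_mul, sgn_of_mem_homDeg hp, sgn_of_mem_homDeg hq]
  have h1 : (-1 : ℚ) ^ ((d - 1) * e) = (-1 : ℚ) ^ (d * e) * (-1 : ℚ) ^ e := by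
    rw [sub_mul, one_mul, zpow_sub₀ (by norm_num), div_eq_mul_inv, ← inv_zpow]
    norm_num
  have h2 : (-1 : ℚ) ^ (d * (e - 1)) = (-1 : ℚ) ^ (d * e) * (-1 : ℚ) ^ d := by
    rw [mul_sub, mul_one, zpow_sub₀ (by norm_num), div_eq_mul_inv, ← inv_zpow]
    norm_num
  rw [h1, h2]
  simp only [smul_add, smul_sub, smul_mul_assoc, smul_smul]
  have h3 : (-1 : ℚ) ^ d * ((-1 : ℚ) ^ (d * e) * (-1 : ℚ) ^ d) = (-1 : ℚ) ^ (d * e) := by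
    rw [mul_comm, mul_assoc, neg_one_zpow_mul_self, mul_one]
  rw [h3]
  abel

end Derivation

/-! ### Homogeneous induction -/

/-- `IsLiePoly` permits brackets of inhomogeneous elements, while the signed Leibniz rule needs
homogeneous ones. The span of the homogeneous Lie polynomials satisfying `P` is closed under
brackets by bilinearity, so it contains every Lie polynomial. -/
theorem isLiePoly_homogeneous_induction {S : Set G} {P : NCSeries G → Prop}
    (zero : P 0) (gen : ∀ g ∈ S, P (of g)) (add : ∀ p q, P p → P q → P (p + q))
    (smul : ∀ (c : ℚ) p, P p → P (c • p))
    (brac : ∀ d e p q, p ∈ homDeg deg d → q ∈ homDeg deg e → IsLiePoly deg S p →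
      IsLiePoly deg S q → P p → P q → P (bracket deg p q))
    {p : NCSeries G} (hp : IsLiePoly deg S p) : P p := by
  let V : Submodule ℚ (NCSeries G) :=
    Submodule.span ℚ {q | (∃ d, q ∈ homDeg deg d) ∧ IsLiePoly deg S q ∧ P q}
  have hV : ∀ q ∈ V, P q := fun q hq => by
    induction hq using Submodule.span_induction with
    | mem q h => exact h.2.2
    | zero => exact zero
    | add p q _ _ hp hq => exact add p q hp hq
    | smul c p _ hp => exact smul c p hp
  refine hV p ?_
  induction hp with
  | zero => exact Submodule.zero_mem _
  | of g hg => exact Submodule.subset_span ⟨⟨_, of_mem_homDeg g⟩, .of g hg, gen g hg⟩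
  | add p q _ _ hp hq => exact Submodule.add_mem _ hp hq
  | smul c p _ hp => exact Submodule.smul_mem _ c hp
  | bracket p q hpl hql hp hq =>
    clear hpl hql
    change adOp deg p q ∈ V
    induction hp using Submodule.span_induction with
    | mem p h =>
      induction hq using Submodule.span_induction with
      | mem q h' =>
        obtain ⟨⟨d, hd⟩, hp, hPp⟩ := h
        obtain ⟨⟨e, he⟩, hq, hPq⟩ := h'
        exact Submodule.subset_span ⟨⟨_, bracket_mem_homDeg hd he⟩, .bracket _ _ hp hq,
          brac d e p q hd he hp hq hPp hPq⟩
      | zero => rw [map_zero]; exact Submodule.zero_mem _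
      | add q q' _ _ hq hq' => rw [map_add]; exact Submodule.add_mem _ hq hq'
      | smul c q _ hq => rw [map_smul]; exact Submodule.smul_mem _ c hq
    | zero =>
      have : bracket deg 0 q = 0 := by simpa using bracket_smul_left deg 0 0 q
      rw [adOp_apply, this]; exact Submodule.zero_mem _
    | add p p' _ _ hp hp' =>
      rw [adOp_apply, bracket_add_left]; exact Submodule.add_mem _ hp hp'
    | smul c p _ hp => rw [adOp_apply, bracket_smul_left]; exact Submodule.smul_mem _ c hp

theorem IsLiePoly.mem_total {S : Set G} {p : NCSeries G} (hp : IsLiePoly deg S p) :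
    p ∈ total deg := by
  refine isLiePoly_homogeneous_induction (deg := deg) (S := S) (Submodule.zero_mem _) (fun g _ => ?_)
    (fun p q => Submodule.add_mem _) (fun c p => Submodule.smul_mem _ c)
    (fun d e p q _ _ _ _ => bracket_mem_total deg) hp
  exact piece_le_total deg _ (of_mem_piece deg g)

theorem total_le_lieSeries : total deg ≤ lieSeries deg Set.univ :=
  iSup_le fun _ _ hp => hp.1

section Derivation

variable [Fintype G] {δ : G → NCSeries G}

theorem derivExt_mem_lieSeries {S S' : Set G} (hS : S ⊆ S')
    (hδ1 : ∀ g, δ g ∈ ord G 1) (hδ : ∀ g, δ g ∈ homDeg deg (deg g - 1))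
    (hδS : ∀ g ∈ S, δ g ∈ lieSeries deg S') {p : NCSeries G} (hp : p ∈ lieSeries deg S) :
    derivExt deg δ p ∈ lieSeries deg S' := by
  refine map_mem_lieSeries (filtered_derivExt hδ1) (fun p hp => ?_) hp
  refine isLiePoly_homogeneous_induction (P := fun p => derivExt deg δ p ∈ lieSeries deg S')
    ?_ (fun g hg => ?_) (fun p q hp hq => ?_) (fun c p hp => ?_) (fun d e p q hd he hp hq hp' hq' => ?_) hp
  · rw [map_zero]; exact Submodule.zero_mem _
  · rw [derivExt_of]; exact hδS g hg
  · rw [map_add]; exact Submodule.add_mem _ hp hq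
  · rw [map_smul]; exact Submodule.smul_mem _ c hp
  · rw [derivExt_bracket hδ hd he]
    have h1 := isLiePoly_mem_lieSeries (isLiePoly_mono hS hp)
    have h2 := isLiePoly_mem_lieSeries (isLiePoly_mono hS hq)
    exact Submodule.add_mem _ (bracket_mem_lieSeries deg hp' h2)
      (Submodule.smul_mem _ _ (bracket_mem_lieSeries deg h1 hq'))

theorem derivExt_mem_piece (hδ : ∀ g, δ g ∈ piece deg (deg g - 1)) {d : ℤ} {p : NCSeries G}
    (hp : p ∈ piece deg d) : derivExt deg δ p ∈ piece deg (d - 1) :=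
  ⟨derivExt_mem_lieSeries subset_rfl (fun g => piece_mem_ord (hδ g)) (fun g => (hδ g).2)
    (fun g _ => (hδ g).1) hp.1, derivExt_mem_homDeg (fun g => (hδ g).2) hp.2⟩

theorem derivExt_mem_total (hδ : ∀ g, δ g ∈ piece deg (deg g - 1)) {p : NCSeries G}
    (hp : p ∈ total deg) : derivExt deg δ p ∈ total deg := by
  refine Submodule.iSup_induction (piece deg) (motive := fun p => derivExt deg δ p ∈ total deg)
    hp (fun m x hx => piece_le_total deg _ (derivExt_mem_piece hδ hx)) ?_ fun x y hx hy => ?_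
  · rw [map_zero]; exact Submodule.zero_mem _
  · rw [map_add]; exact Submodule.add_mem _ hx hy

/-- Two derivations which agree on `S` agree on the Lie series in `S`. -/
theorem derivExt_congr {δ' : G → NCSeries G} {S : Set G} (hδ1 : ∀ g, δ g ∈ ord G 1)
    (hδ : ∀ g, δ g ∈ homDeg deg (deg g - 1)) (hδ1' : ∀ g, δ' g ∈ ord G 1)
    (hδ' : ∀ g, δ' g ∈ homDeg deg (deg g - 1)) (h : ∀ g ∈ S, δ g = δ' g) {p : NCSeries G}
    (hp : p ∈ lieSeries deg S) : derivExt deg δ p = derivExt deg δ' p := by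
  rw [← sub_eq_zero, ← LinearMap.sub_apply]
  refine map_eq_zero_of_mem_lieSeries (deg := deg) (S := S) (fun m p hp => Submodule.sub_mem _
    (filtered_derivExt hδ1 m p hp) (filtered_derivExt hδ1' m p hp)) (fun p hp => ?_) hp
  rw [LinearMap.sub_apply, sub_eq_zero]
  refine isLiePoly_homogeneous_induction (P := fun p => derivExt deg δ p = derivExt deg δ' p)
    ?_ (fun g hg => ?_) (fun p q hp hq => ?_) (fun c p hp => ?_)
    (fun d e p q hd he hp hq hp' hq' => ?_) hp
  · rw [map_zero, map_zero]
  · rw [derivExt_of, derivExt_of, h g hg]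
  · rw [map_add, map_add, hp, hq]
  · rw [map_smul, map_smul, hp]
  · rw [derivExt_bracket hδ hd he, derivExt_bracket hδ' hd he, hp', hq']

/-- If `∂² = 0` on the generators in `S`, then `∂² = 0` on the Lie series in `S`. -/
theorem derivExt_derivExt_eq_zero {S : Set G} (hδ1 : ∀ g, δ g ∈ ord G 1)
    (hδ : ∀ g, δ g ∈ homDeg deg (deg g - 1))
    (h : ∀ g ∈ S, derivExt deg δ (δ g) = 0) {p : NCSeries G} (hp : p ∈ lieSeries deg S) :
    derivExt deg δ (derivExt deg δ p) = 0 := by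
  refine map_eq_zero_of_mem_lieSeries (deg := deg) (S := S) (Ψ := derivExt deg δ ∘ₗ derivExt deg δ)
    ((filtered_derivExt hδ1).comp (filtered_derivExt hδ1)) (fun p hp => ?_) hp
  rw [LinearMap.comp_apply]
  refine isLiePoly_homogeneous_induction
    (P := fun p => derivExt deg δ (derivExt deg δ p) = 0)
    ?_ (fun g hg => ?_) (fun p q hp hq => ?_) (fun c p hp => ?_)
    (fun d e p q hd he hp hq hp' hq' => ?_) hp
  · rw [map_zero, map_zero]
  · rw [derivExt_of, h g hg]
  · rw [map_add, map_add, hp, hq, add_zero]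
  · rw [map_smul, map_smul, hp, smul_zero]
  · rw [bracket_of_mem_homDeg hd he, map_sub, map_smul, map_sub, map_smul,
      derivExt_derivExt_mul hδ, derivExt_derivExt_mul hδ, hp', hq']
    simp

end Derivation

end NCSeries


/-! ### Derivations of the completed free Lie algebra -/

namespace FreeGLA

variable {G : Type} {deg : G → ℤ}

theorem gen_mem_grade (g : G) : gen deg g ∈ grade deg (deg g) := of_mem_piece deg g

/-- A linear map on the completed free Lie algebra agrees with a filtered linear map on series
if it does so on Lie polynomials. -/
theorem eq_of_isLiePoly {D : FreeGLA deg →ₗ[ℚ] FreeGLA deg} (hD : IsFiltered D)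
    {Ψ : NCSeries G →ₗ[ℚ] NCSeries G} (hΨ : Filtered Ψ)
    (h : ∀ (p : NCSeries G) (hp : IsLiePoly deg Set.univ p), (D ⟨p, hp.mem_total⟩).1 = Ψ p)
    (x : FreeGLA deg) : (D x).1 = Ψ x.1 := by
  refine eq_of_forall_sub_mem_ord fun N => ?_
  have hx := total_le_lieSeries x.2
  -- The truncation `y` is a sum of Lie polynomials, where the two maps agree; on `x - y` both
  -- values lie in `ord G N`.
  let y : FreeGLA deg := ∑ k ∈ Finset.range N, ⟨homPart k x.1, (hx k).mem_total⟩
  have hy : y.1 = ∑ k ∈ Finset.range N, homPart k x.1 := by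
    simp [y, AddSubmonoidClass.coe_finsetSum]
  have hxy : (x - y).1 ∈ ord G N := by
    have := seriesSum_sub_mem (fun k => homPart_mem_ord k x.1) N
    rw [seriesSum_homPart, ← hy] at this
    exact this
  have hDy : (D y).1 = Ψ y.1 := by
    rw [map_sum, hy, map_sum, AddSubmonoidClass.coe_finsetSum]
    exact Finset.sum_congr rfl fun k _ => h _ (hx k)
  have e : (D x).1 - Ψ x.1 = (D (x - y)).1 - Ψ (x - y).1 := by
    rw [map_sub, Submodule.coe_sub, Submodule.coe_sub, map_sub, hDy]
    abel
  rw [e]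
  exact Submodule.sub_mem _ (hD N _ hxy) (hΨ N _ hxy)

theorem _root_.IsGradedDerivation.mem_piece {D : FreeGLA deg →ₗ[ℚ] FreeGLA deg}
    (hD : IsGradedDerivation D) (g : G) : (D (gen deg g)).1 ∈ piece deg (deg g - 1) :=
  hD.mem _ _ (gen_mem_grade g)

variable [Fintype G]

/-- Every graded derivation is determined by its values on the generators. -/
theorem _root_.IsGradedDerivation.eq_derivExt {D : FreeGLA deg →ₗ[ℚ] FreeGLA deg}
    (hD : IsGradedDerivation D) (x : FreeGLA deg) :
    (D x).1 = derivExt deg (fun g => (D (gen deg g)).1) x.1 := by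
  have hδ := fun g => hD.mem_piece g
  refine eq_of_isLiePoly hD.filtered (filtered_derivExt fun g => piece_mem_ord (hδ g))
    (fun p hp => ?_) x
  -- Since `D` is defined only on `total deg`, membership is carried along in the induction.
  have key : ∃ h : p ∈ total deg,
      (D ⟨p, h⟩).1 = derivExt deg (fun g => (D (gen deg g)).1) p := by
    refine isLiePoly_homogeneous_induction (P := fun p => ∃ h : p ∈ total deg,
      (D ⟨p, h⟩).1 = derivExt deg (fun g => (D (gen deg g)).1) p)
      ⟨Submodule.zero_mem _, ?_⟩ (fun g _ => ⟨piece_le_total deg _ (of_mem_piece deg g), ?_⟩)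
      ?_ ?_ ?_ hp
    · rw [map_zero]
      exact congrArg Subtype.val (map_zero D)
    · rw [derivExt_of]; rfl
    · rintro p q ⟨hp, hp'⟩ ⟨hq, hq'⟩
      refine ⟨Submodule.add_mem _ hp hq, ?_⟩
      rw [map_add, ← hp', ← hq']
      exact congrArg Subtype.val (map_add D ⟨p, hp⟩ ⟨q, hq⟩)
    · rintro c p ⟨hp, hp'⟩
      refine ⟨Submodule.smul_mem _ c hp, ?_⟩
      rw [map_smul, ← hp']
      exact congrArg Subtype.val (map_smul D c ⟨p, hp⟩)
    · rintro d e p q hd he hpl hql ⟨hp, hp'⟩ ⟨hq, hq'⟩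
      refine ⟨bracket_mem_total deg hp hq, ?_⟩
      rw [derivExt_bracket (fun g => (hδ g).2) hd he, ← hp', ← hq']
      exact congrArg Subtype.val (hD.leibniz d e ⟨p, hp⟩ ⟨q, hq⟩
        ⟨isLiePoly_mem_lieSeries hpl, hd⟩ ⟨isLiePoly_mem_lieSeries hql, he⟩)
  exact key.2

theorem _root_.IsGradedDerivation.diffAt_eq {D : FreeGLA deg →ₗ[ℚ] FreeGLA deg}
    (hD : IsGradedDerivation D) {p : NCSeries G} (hp : p ∈ total deg) :
    diffAt D p = derivExt deg (fun g => (D (gen deg g)).1) p := by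
  rw [diffAt, dif_pos hp]
  exact hD.eq_derivExt ⟨p, hp⟩

/-- The derivation of the completed free Lie algebra with given values on the generators. -/
noncomputable def deriv {δ : G → NCSeries G} (hδ : ∀ g, δ g ∈ piece deg (deg g - 1)) :
    FreeGLA deg →ₗ[ℚ] FreeGLA deg :=
  (derivExt deg δ).restrict fun _ hp => derivExt_mem_total hδ hp

variable {δ : G → NCSeries G} (hδ : ∀ g, δ g ∈ piece deg (deg g - 1))

theorem coe_deriv (x : FreeGLA deg) : (deriv hδ x).1 = derivExt deg δ x.1 := rfl

theorem coe_deriv_gen (g : G) : (deriv hδ (gen deg g)).1 = δ g := derivExt_of g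

theorem isGradedDerivation_deriv : IsGradedDerivation (deriv hδ) where
  filtered m x hx := filtered_derivExt (fun g => piece_mem_ord (hδ g)) m x.1 hx
  mem _ _ hx := derivExt_mem_piece hδ hx
  leibniz _ _ _ _ hx hy := Subtype.ext (derivExt_bracket (fun g => (hδ g).2) hx.2 hy.2)

theorem diffAt_deriv {p : NCSeries G} (hp : p ∈ total deg) :
    diffAt (deriv hδ) p = derivExt deg δ p := by
  rw [diffAt, dif_pos hp]; rfl

end FreeGLA

namespace NCSeries

variable {G : Type} {deg : G → ℤ} [Fintype G] {δ : G → NCSeries G}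

/-! ### Flows and twisted differentials -/

/-- The flow by `e` takes `p` to `q`, as an identity between series: `p e^x + ∂ e^x = e^x q`. -/
def FlowsTo (deg : G → ℤ) (δ : G → NCSeries G) (p x q : NCSeries G) : Prop :=
  p * exp x + derivExt deg δ (exp x) = exp x * q

/-- The twisted differential `∂ + [p, ·]` for `p` of degree `-1`, as a linear map. -/
noncomputable def twist (deg : G → ℤ) (δ : G → NCSeries G) (p : NCSeries G) :
    Module.End ℚ (NCSeries G) :=
  derivExt deg δ + LinearMap.mulLeft ℚ p - LinearMap.mulRight ℚ p ∘ₗ sgn deg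

theorem twist_apply (p q : NCSeries G) :
    twist deg δ p q = derivExt deg δ q + p * q - sgn deg q * p := rfl

theorem twist_eq {p : NCSeries G} (hp : p ∈ homDeg deg (-1)) (q : NCSeries G) :
    twist deg δ p q = derivExt deg δ q + bracket deg p q := by
  rw [bracket_neg_one hp, twist_apply]
  abel

theorem filtered_twist (hδ : ∀ g, δ g ∈ ord G 1) (p : NCSeries G) : Filtered (twist deg δ p) :=
  fun m q hq => Submodule.sub_mem _ (Submodule.add_mem _ (filtered_derivExt hδ m q hq)
    (filtered_mulLeft p m q hq)) (filtered_mulRight p m _ (filtered_sgn m q hq))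

theorem twist_one (p : NCSeries G) : twist deg δ p 1 = 0 := by
  rw [twist_apply, derivExt_one, sgn_one]
  simp

theorem twist_mul (p q r : NCSeries G) :
    twist deg δ p (q * r) = twist deg δ p q * r + sgn deg q * twist deg δ p r := by
  simp only [twist_apply, derivExt_mul, sgn_mul]
  noncomm_ring

theorem twist_even_mul {z : NCSeries G} (hz : z ∈ homDeg deg 0) (p q : NCSeries G) :
    twist deg δ p (z * q) = twist deg δ p z * q + z * twist deg δ p q := by
  rw [twist_mul, sgn_even hz]

theorem twist_bracket {z : NCSeries G} (hz : z ∈ homDeg deg 0) {p : NCSeries G}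
    (h : twist deg δ p z = 0) (q : NCSeries G) :
    twist deg δ p (bracket deg z q) = bracket deg z (twist deg δ p q) := by
  rw [bracket_even hz, bracket_even hz, map_sub, twist_mul, twist_mul, h, sgn_even hz]
  simp

/-- `∂_p²` differs from `∂²` by the commutator with `∂p + p²`, which vanishes at a point. Hence `∂²
c = 0` may be checked at whichever point is most convenient. -/
theorem twist_twist (hδ : ∀ g, δ g ∈ homDeg deg (deg g - 1)) {p : NCSeries G}
    (hp : p ∈ homDeg deg (-1)) (h : derivExt deg δ p = -(p * p)) (q : NCSeries G) :
    twist deg δ p (twist deg δ p q) = derivExt deg δ (derivExt deg δ q) := by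
  simp only [twist_apply, map_sub, map_add, derivExt_mul, sgn_mul, derivExt_sgn hδ, sgn_sgn,
    sgn_neg_one hp, h]
  noncomm_ring

/-- The Leibniz rule for `e^x e^y`, with the two gauge equations inserted in turn. -/
theorem FlowsTo.trans {p q r x y : NCSeries G} (hx : x ∈ ord G 1) (hy : y ∈ ord G 1)
    (hdx : x ∈ homDeg deg 0) (h : FlowsTo deg δ p x q)
    (h' : FlowsTo deg δ q y r) : FlowsTo deg δ p (bch x y) r := by
  unfold FlowsTo at *
  rw [exp_bch hx hy, derivExt_even_mul (exp_mem_homDeg hdx), mul_assoc, ← h', mul_add, ← mul_assoc,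
    ← mul_assoc, ← h]
  noncomm_ring

theorem FlowsTo.symm {p q x : NCSeries G} (hx : x ∈ ord G 1) (hdx : x ∈ homDeg deg 0)
    (h : FlowsTo deg δ p x q) : FlowsTo deg δ q (-x) p := by
  unfold FlowsTo at *
  have h1 := congrArg (derivExt deg δ) (exp_mul_exp_neg hx)
  rw [derivExt_one, derivExt_even_mul (exp_mem_homDeg hdx)] at h1
  have h2 : exp (-x) * (exp x * q) * exp (-x) = q * exp (-x) := by
    rw [← mul_assoc, exp_neg_mul_exp hx, one_mul]
  have h3 : exp (-x) * (derivExt deg δ (exp x) * exp (-x)) = -derivExt deg δ (exp (-x)) := by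
    rw [eq_neg_of_add_eq_zero_left h1, mul_neg, ← mul_assoc, exp_neg_mul_exp hx, one_mul]
  rw [← h2, ← h, mul_add, add_mul, mul_assoc (exp (-x)) (derivExt deg δ (exp x)), h3, mul_assoc,
    mul_assoc, exp_mul_exp_neg hx]
  simp

/-- A flow from `p` to `p` means `∂_p e^z = 0`. As `e^z - 1` and `z` are power series in each other
and `∂_p` is a derivation, this is the same as `∂_p z = 0`. The condition on loops thus becomes
linear. -/
theorem flowsTo_self_iff (hδ : ∀ g, δ g ∈ ord G 1) {p z : NCSeries G} (hz : z ∈ ord G 1)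
    (hdz : z ∈ homDeg deg 0) : FlowsTo deg δ p z p ↔ twist deg δ p z = 0 := by
  have hd := exp_mem_homDeg hdz
  have h : FlowsTo deg δ p z p ↔ twist deg δ p (exp z) = 0 := by
    rw [FlowsTo, twist_apply, sgn_even hd, sub_eq_zero, add_comm]
  rw [h]
  constructor
  · intro h
    have h1 : twist deg δ p (exp z - 1) = 0 := by rw [map_sub, h, twist_one, sub_zero]
    rw [← log_exp hz]
    refine map_serEval_eq_zero (filtered_twist hδ p) (twist_one p) (exp_sub_one_mem_ord hz)
      (fun q => ?_) _
    rw [twist_even_mul (Submodule.sub_mem _ hd one_mem_homDeg), h1, zero_mul, zero_add]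
  · intro h
    rw [exp_eq]
    refine map_serEval_eq_zero (filtered_twist hδ p) (twist_one p) hz (fun q => ?_) _
    rw [twist_even_mul hdz, h, zero_mul, zero_add]

/-- The endpoint of a flow from a point is a point. -/
theorem FlowsTo.point {p q x : NCSeries G} (hx : x ∈ ord G 1)
    (hdx : x ∈ homDeg deg 0) (hp : p ∈ homDeg deg (-1))
    (hd2 : derivExt deg δ (derivExt deg δ (exp x)) = 0)
    (h : FlowsTo deg δ p x q) (hpp : derivExt deg δ p = -(p * p)) :
    derivExt deg δ q = -(q * q) := by
  unfold FlowsTo at h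
  have h1 := congrArg (derivExt deg δ) h
  rw [derivExt_even_mul (exp_mem_homDeg hdx), map_add, derivExt_mul, hd2, sgn_neg_one hp, hpp,
    add_zero] at h1
  have h2 : exp x * derivExt deg δ q = exp x * -(q * q) := by
    have h3 : derivExt deg δ (exp x) = exp x * q - p * exp x := by rw [← h]; abel
    rw [h3] at h1
    have h4 : exp x * derivExt deg δ q = (exp x * q - p * exp x) * q + exp x * derivExt deg δ q -
      (exp x * q - p * exp x) * q := by abel
    rw [h4, ← h1]
    noncomm_ring
  have h5 := congrArg (exp (-x) * ·) h2
  simpa only [← mul_assoc, exp_neg_mul_exp hx, one_mul] using h5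

/-- If `x` flows from a point to a point, then `∂² x = 0`. -/
theorem FlowsTo.derivExt_derivExt (hδ1 : ∀ g, δ g ∈ ord G 1)
    (hδ : ∀ g, δ g ∈ homDeg deg (deg g - 1)) {p q x : NCSeries G}
    (hx : x ∈ ord G 1) (hdx : x ∈ homDeg deg 0) (hp : p ∈ homDeg deg (-1))
    (h : FlowsTo deg δ p x q) (hpp : derivExt deg δ p = -(p * p))
    (hqq : derivExt deg δ q = -(q * q)) : derivExt deg δ (derivExt deg δ x) = 0 := by
  have hd := exp_mem_homDeg hdx
  unfold FlowsTo at h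
  have h1 := congrArg (derivExt deg δ) h
  have h3 : derivExt deg δ (exp x) = exp x * q - p * exp x := by rw [← h]; abel
  rw [derivExt_even_mul hd, map_add, derivExt_mul, sgn_neg_one hp, hpp, hqq, h3] at h1
  have h2 : derivExt deg δ (derivExt deg δ (exp x)) = 0 := by
    rw [h3, eq_sub_of_add_eq' h1]
    noncomm_ring
  have h4 : derivExt deg δ (derivExt deg δ (exp x - 1)) = 0 := by
    rw [map_sub, map_sub, h2, derivExt_one, map_zero, sub_zero]
  -- `∂²` is an ordinary derivation, so vanishing on `e^x - 1` passes to its logarithm `x`.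
  rw [← log_exp hx]
  refine map_serEval_eq_zero (Ψ := derivExt deg δ ∘ₗ derivExt deg δ)
    ((filtered_derivExt hδ1).comp (filtered_derivExt hδ1)) ?_ (exp_sub_one_mem_ord hx)
    (fun q => ?_) _
  · rw [LinearMap.comp_apply, derivExt_one, map_zero]
  · rw [LinearMap.comp_apply, derivExt_derivExt_mul hδ, h4, zero_mul, zero_add]
    rfl

theorem derivExt_derivExt_exp (hδ1 : ∀ g, δ g ∈ ord G 1)
    (hδ : ∀ g, δ g ∈ homDeg deg (deg g - 1)) {x : NCSeries G} (hx : x ∈ ord G 1)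
    (h : derivExt deg δ (derivExt deg δ x) = 0) :
    derivExt deg δ (derivExt deg δ (exp x)) = 0 := by
  rw [exp_eq]
  refine map_serEval_eq_zero (Ψ := derivExt deg δ ∘ₗ derivExt deg δ)
    ((filtered_derivExt hδ1).comp (filtered_derivExt hδ1)) ?_ hx (fun q => ?_) _
  · rw [LinearMap.comp_apply, derivExt_one, map_zero]
  · rw [LinearMap.comp_apply, derivExt_derivExt_mul hδ, h, zero_mul, zero_add]
    rfl

/-- The flow by `e` intertwines the twisted differentials at its endpoints. -/
theorem FlowsTo.twist_conj {p q x : NCSeries G} (hx : x ∈ ord G 1) (hdx : x ∈ homDeg deg 0)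
    (h : FlowsTo deg δ p x q) (r : NCSeries G) :
    twist deg δ q (exp (-x) * r * exp x) = exp (-x) * twist deg δ p r * exp x := by
  have h' := h.symm hx hdx
  unfold FlowsTo at h h'
  have hd := exp_mem_homDeg hdx
  have hd' := exp_mem_homDeg (Submodule.neg_mem _ hdx)
  have h1 : derivExt deg δ (exp x) = exp x * q - p * exp x := by rw [← h]; abel
  have h2 : derivExt deg δ (exp (-x)) = exp (-x) * p - q * exp (-x) := by rw [← h']; abel
  rw [twist_apply, twist_apply, mul_assoc, derivExt_even_mul hd', derivExt_mul, h1, h2, sgn_mul,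
    sgn_mul, sgn_even hd, sgn_even hd']
  noncomm_ring

/-- The operator `(1 - e^{-ad e}) / ad e` turns `∂e` into the logarithmic derivative `e^{-e}
∂(e^e)`: the flow is the gauge action of `e^e`. -/
theorem flow_eq {D : FreeGLA deg →ₗ[ℚ] FreeGLA deg} {e a : NCSeries G}
    (hδ1 : ∀ g, δ g ∈ ord G 1) (hD : diffAt D e = derivExt deg δ e) (he : e ∈ ord G 1)
    (hd : e ∈ homDeg deg 0) :
    flow D e a = exp (-e) * a * exp e + exp (-e) * derivExt deg δ (exp e) := by
  have h1 : (-bracket deg e : NCSeries G → NCSeries G) = bracket deg (-e) := by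
    rw [← coe_adOp, ← coe_adOp, adOp_neg]; rfl
  rw [flow, h1, expOp_bracket (Submodule.neg_mem _ he) (Submodule.neg_mem _ hd), neg_neg, hD,
    exp_neg_mul_derivation_exp (filtered_derivExt hδ1) derivExt_one he
      (fun q => derivExt_even_mul hd q), ← adOp_even hd]
  congr 1
  change opSeries _ _ _ = opSeries _ _ _
  congr 1
  funext k
  rw [PowerSeries.expQuot, PowerSeries.coeff_mk]

theorem flow_eq_iff {D : FreeGLA deg →ₗ[ℚ] FreeGLA deg} {e a b : NCSeries G}
    (hδ1 : ∀ g, δ g ∈ ord G 1) (hD : diffAt D e = derivExt deg δ e) (he : e ∈ ord G 1)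
    (hd : e ∈ homDeg deg 0) : flow D e a = b ↔ FlowsTo deg δ a e b := by
  rw [flow_eq hδ1 hD he hd, mul_assoc, ← mul_add, FlowsTo]
  constructor
  · rintro rfl
    rw [← mul_assoc, exp_mul_exp_neg he, one_mul]
  · intro h
    rw [h, ← mul_assoc, exp_neg_mul_exp he, one_mul]

end NCSeries

namespace NCSeries

/-! ### Signed permutations of the generators -/

section Relabel

variable {G : Type}

/-- The algebra endomorphism induced by a signed permutation of the generators: it maps
`of (π c)` to `s c • of c`. -/
noncomputable def relabel (π : Equiv.Perm G) (s : G → ℚ) : Module.End ℚ (NCSeries G) where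
  toFun p := fun w => (w.map s).prod * p (w.map π)
  map_add' p q := by ext w; exact mul_add _ _ _
  map_smul' c p := by ext w; exact mul_left_comm _ _ _

theorem relabel_apply (π : Equiv.Perm G) (s : G → ℚ) (p : NCSeries G) (w : List G) :
    relabel π s p w = (w.map s).prod * p (w.map π) := rfl

theorem filtered_relabel (π : Equiv.Perm G) (s : G → ℚ) : Filtered (relabel π s) :=
  fun m p hp w hw => by rw [relabel_apply, hp _ (by rwa [List.length_map]), mul_zero]

theorem relabel_one (π : Equiv.Perm G) (s : G → ℚ) : relabel π s 1 = 1 := by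
  ext w
  cases w with
  | nil => rw [relabel_apply, List.map_nil, List.map_nil, List.prod_nil, one_nil, one_mul]
  | cons a w => rw [relabel_apply, List.map_cons, List.map_cons, one_cons, one_cons, mul_zero]

theorem relabel_mul (π : Equiv.Perm G) (s : G → ℚ) (p q : NCSeries G) :
    relabel π s (p * q) = relabel π s p * relabel π s q := by
  ext w
  rw [relabel_apply, mul_apply, mul_apply, Finset.mul_sum, List.length_map]
  refine Finset.sum_congr rfl fun i _ => ?_
  rw [relabel_apply, relabel_apply, ← List.map_take, ← List.map_drop]
  nth_rewrite 1 [← List.take_append_drop i w]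
  rw [List.map_append, List.prod_append]
  ring

theorem relabel_of (π : Equiv.Perm G) (s : G → ℚ) (c : G) :
    relabel π s (of (π c)) = s c • of c := by
  ext w
  rw [relabel_apply, smul_apply, of, of]
  by_cases h : w = [c]
  · subst h
    simp
  · rw [if_neg h, if_neg, mul_zero, mul_zero]
    intro e
    refine h (List.map_injective_iff.2 π.injective ?_)
    rw [e]; rfl

theorem relabel_relabel (π π' : Equiv.Perm G) (s s' : G → ℚ) (h : ∀ c, π (π' c) = c)
    (hs : ∀ c, s' c * s (π' c) = 1) (p : NCSeries G) : relabel π' s' (relabel π s p) = p := by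
  ext w
  rw [relabel_apply, relabel_apply, List.map_map, List.map_map, ← mul_assoc]
  have h1 : ⇑π ∘ ⇑π' = id := funext h
  have h2 : (w.map s').prod * (w.map (s ∘ π')).prod = 1 := by
    induction w with
    | nil => simp
    | cons a w ih =>
      rw [List.map_cons, List.map_cons, List.prod_cons, List.prod_cons, mul_mul_mul_comm, ih,
        Function.comp_apply, hs, mul_one]
  rw [h1, h2, List.map_id, one_mul]

variable {deg : G → ℤ}

theorem relabel_mem_homDeg {π : Equiv.Perm G} (hπ : ∀ c, deg (π c) = deg c) (s : G → ℚ) {d : ℤ}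
    {p : NCSeries G} (hp : p ∈ homDeg deg d) : relabel π s p ∈ homDeg deg d := fun w hw => by
  rw [← hp _ (right_ne_zero_of_mul hw), wordDeg, wordDeg, List.map_map]
  congr 2
  exact funext fun c => (hπ c).symm

theorem relabel_bracket {π : Equiv.Perm G} (hπ : ∀ c, deg (π c) = deg c) (s : G → ℚ)
    (p q : NCSeries G) :
    relabel π s (bracket deg p q) = bracket deg (relabel π s p) (relabel π s q) := by
  have hw : ∀ u : List G, wordDeg deg (u.map π) = wordDeg deg u := fun u => by
    rw [wordDeg, wordDeg, List.map_map]
    congr 2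
    exact funext hπ
  ext w
  rw [relabel_apply, bracket_apply, bracket_apply, Finset.mul_sum, List.length_map]
  refine Finset.sum_congr rfl fun i _ => ?_
  rw [relabel_apply, relabel_apply, relabel_apply, relabel_apply, ← List.map_take, ← List.map_drop,
    hw, hw]
  nth_rewrite 1 [← List.take_append_drop i w]
  rw [List.map_append, List.prod_append]
  ring

theorem relabel_mem_lieSeries {π : Equiv.Perm G} (hπ : ∀ c, deg (π c) = deg c) (s : G → ℚ)
    {p : NCSeries G} (hp : p ∈ lieSeries deg Set.univ) :
    relabel π s p ∈ lieSeries deg Set.univ := by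
  refine map_mem_lieSeries (filtered_relabel π s) (fun p hp => ?_) hp
  induction hp with
  | zero => rw [map_zero]; exact Submodule.zero_mem _
  | of c _ =>
    obtain ⟨c, rfl⟩ := π.surjective c
    rw [relabel_of]
    exact Submodule.smul_mem _ _ (of_mem_lieSeries (Set.mem_univ _))
  | add p q _ _ hp hq => rw [map_add]; exact Submodule.add_mem _ hp hq
  | smul c p _ hp => rw [map_smul]; exact Submodule.smul_mem _ c hp
  | bracket p q _ _ hp hq =>
    rw [relabel_bracket hπ]
    exact bracket_mem_lieSeries deg hp hq

theorem relabel_mem_piece {π : Equiv.Perm G} (hπ : ∀ c, deg (π c) = deg c) (s : G → ℚ) {d : ℤ}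
    {p : NCSeries G} (hp : p ∈ piece deg d) : relabel π s p ∈ piece deg d :=
  ⟨relabel_mem_lieSeries hπ s hp.1, relabel_mem_homDeg hπ s hp.2⟩

theorem relabel_mem_total {π : Equiv.Perm G} (hπ : ∀ c, deg (π c) = deg c) (s : G → ℚ)
    {p : NCSeries G} (hp : p ∈ total deg) : relabel π s p ∈ total deg := by
  refine Submodule.iSup_induction (piece deg) (motive := fun p => relabel π s p ∈ total deg)
    hp (fun m x hx => piece_le_total deg _ (relabel_mem_piece hπ s hx)) ?_ fun x y hx hy => ?_
  · rw [map_zero]; exact Submodule.zero_mem _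
  · rw [map_add]; exact Submodule.add_mem _ hx hy

end Relabel

/-! ### Existence of universal averages -/

section Average

variable {ι : Type} [Fintype ι]

/-- The sum of the differences `bch x_i (-c)` between the variables and a candidate `c` for their
average. -/
noncomputable def defect (c : NCSeries ι) : NCSeries ι := ∑ i, bch (of i) (-c)

/-- Newton approximations to a zero of `defect`. -/
noncomputable def meanSeq (i₀ : ι) : ℕ → NCSeries ι
  | 0 => of i₀
  | k + 1 => bch ((Fintype.card ι : ℚ)⁻¹ • defect (meanSeq i₀ k)) (meanSeq i₀ k)

/-- The barycentre of the variables: the solution of `defect c = 0`. -/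
noncomputable def mean (i₀ : ι) : NCSeries ι := fun w => meanSeq i₀ w.length w

theorem defect_mem_lieSeries {c : NCSeries ι} (hc : c ∈ lieSeries (fun _ : ι => (0 : ℤ)) Set.univ) :
    defect c ∈ lieSeries (fun _ : ι => (0 : ℤ)) Set.univ :=
  Submodule.sum_mem _ fun i _ => bch_mem_lieSeries (of_mem_lieSeries (Set.mem_univ i))
    (Submodule.neg_mem _ hc) (mem_homDeg_zero _) (mem_homDeg_zero _)

theorem meanSeq_mem_lieSeries (i₀ : ι) (k : ℕ) :
    meanSeq i₀ k ∈ lieSeries (fun _ : ι => (0 : ℤ)) Set.univ := by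
  induction k with
  | zero => exact of_mem_lieSeries (Set.mem_univ i₀)
  | succ k ih =>
    exact bch_mem_lieSeries (Submodule.smul_mem _ _ (defect_mem_lieSeries ih)) ih
      (mem_homDeg_zero _) (mem_homDeg_zero _)

theorem meanSeq_mem_ord (i₀ : ι) (k : ℕ) : meanSeq i₀ k ∈ ord ι 1 :=
  lieSeries_mem_ord (meanSeq_mem_lieSeries i₀ k)

theorem defect_mem_ord {c : NCSeries ι} (hc : c ∈ ord ι 1) : defect c ∈ ord ι 1 :=
  Submodule.sum_mem _ fun i _ => bch_mem_ord (of_mem_ord i) (Submodule.neg_mem _ hc)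

/-- Replacing `c` by `BCH(m, c)` lowers each summand `BCH(x_i, -c)` by `m` to first order. With `m`
the average of the summands the leading part of the defect cancels, so each step gains a letter. -/
theorem defect_meanSeq_mem_ord (i₀ : ι) (k : ℕ) : defect (meanSeq i₀ k) ∈ ord ι (k + 1) := by
  induction k with
  | zero => exact defect_mem_ord (meanSeq_mem_ord i₀ 0)
  | succ k ih =>
    have hN : (Fintype.card ι : ℚ) ≠ 0 := by
      have : Nonempty ι := ⟨i₀⟩
      exact_mod_cast Fintype.card_ne_zero
    rw [meanSeq]
    set c := meanSeq i₀ k with hcdef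
    have hc : c ∈ ord ι 1 := meanSeq_mem_ord i₀ k
    set m := (Fintype.card ι : ℚ)⁻¹ • defect c with hmdef
    have hm : m ∈ ord ι (k + 1) := Submodule.smul_mem _ _ ih
    have hm1 : m ∈ ord ι 1 := ord_mono (by omega) hm
    have hc' := Submodule.neg_mem _ hc
    -- By associativity `BCH(x_i, -BCH(m,c)) = BCH(BCH(x_i, -c), -m)`, which is linearised in `m`.
    have key : ∀ i, bch (of i) (-bch m c) - bch (of i) (-c) + m ∈ ord ι (k + 1 + 1) := fun i => by
      have hz := bch_mem_ord (of_mem_ord i) hc'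
      have := bch_sub_bch_sub_mem_ord (l := k + 1) hz (Submodule.neg_mem _ hm1)
        (Submodule.zero_mem _) (by rw [sub_zero]; exact Submodule.neg_mem _ hm)
      rwa [bch_zero hz, sub_zero, sub_neg_eq_add, bch_assoc (of_mem_ord i) hc'
        (Submodule.neg_mem _ hm1), ← neg_bch hm1 hc] at this
    have hsum := Submodule.sum_mem (ord ι (k + 1 + 1)) (t := Finset.univ) fun i _ => key i
    rw [Finset.sum_add_distrib, Finset.sum_sub_distrib, Finset.sum_const, Finset.card_univ,
      ← Nat.cast_smul_eq_nsmul ℚ, hmdef, smul_smul, mul_inv_cancel₀ hN, one_smul] at hsum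
    change defect _ - defect c + defect c ∈ _ at hsum
    rwa [sub_add_cancel] at hsum

/-- Approximate zeros of `defect` are unique. -/
theorem sub_mem_ord_of_defect (i₀ : ι) {c c' : NCSeries ι} {m : ℕ} (hc : c ∈ ord ι 1)
    (hc' : c' ∈ ord ι 1) (h : defect c ∈ ord ι m) (h' : defect c' ∈ ord ι m) :
    c - c' ∈ ord ι m := by
  have hN : (Fintype.card ι : ℚ) ≠ 0 := by
    have : Nonempty ι := ⟨i₀⟩
    exact_mod_cast Fintype.card_ne_zero
  suffices key : ∀ l, l ≤ m → c - c' ∈ ord ι l from key m le_rfl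
  intro l
  induction l with
  | zero => exact fun _ => mem_ord_zero _
  | succ l ih =>
    intro hl
    have hcc := ih (by omega)
    have hneg : -c - -c' ∈ ord ι l := by
      have := Submodule.neg_mem _ hcc
      rwa [neg_sub, ← neg_sub_neg] at this
    -- Summed over `i`, this says that the defect changes by `-card ι • (c - c')` to first order.
    -- Since both defects are small, `c - c'` gains a letter.
    have key : ∀ i ∈ Finset.univ, bch (of i) (-c) - bch (of i) (-c') - (-c - -c') ∈ ord ι (l + 1) :=
      fun i _ => bch_sub_bch_sub_mem_ord (of_mem_ord i) (Submodule.neg_mem _ hc)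
        (Submodule.neg_mem _ hc') hneg
    have hsum := Submodule.sum_mem _ key
    rw [Finset.sum_sub_distrib, Finset.sum_sub_distrib, Finset.sum_const, Finset.card_univ,
      ← Nat.cast_smul_eq_nsmul ℚ] at hsum
    change defect c - defect c' - _ ∈ _ at hsum
    have h1 := Submodule.sub_mem _ hsum (ord_mono hl (Submodule.sub_mem _ h h'))
    rw [sub_sub_cancel_left] at h1
    have h2 := Submodule.smul_mem _ ((Fintype.card ι : ℚ)⁻¹) h1
    rw [smul_neg, smul_smul, inv_mul_cancel₀ hN, one_smul] at h2
    have e : c - c' = -(-c - -c') := by abel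
    rwa [e]

theorem mean_sub_meanSeq_mem_ord (i₀ : ι) (k : ℕ) : mean i₀ - meanSeq i₀ k ∈ ord ι (k + 1) := by
  intro w hw
  exact sub_mem_ord_of_defect i₀ (meanSeq_mem_ord i₀ w.length) (meanSeq_mem_ord i₀ k)
    (defect_meanSeq_mem_ord i₀ w.length)
    (ord_mono (by omega) (defect_meanSeq_mem_ord i₀ k)) w (Nat.lt_succ_self _)

theorem mean_mem_lieSeries (i₀ : ι) :
    mean i₀ ∈ lieSeries (fun _ : ι => (0 : ℤ)) Set.univ := fun m => by
  rw [homPart_congr (Nat.lt_succ_self m) (mean_sub_meanSeq_mem_ord i₀ m)]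
  exact meanSeq_mem_lieSeries i₀ m m

theorem defect_relabel (π : Equiv.Perm ι) {c : NCSeries ι} (hc : c ∈ ord ι 1) :
    defect (relabel π (fun _ => 1) c) = relabel π (fun _ => 1) (defect c) := by
  rw [defect, defect, map_sum, ← Equiv.sum_comp π fun i => relabel π (fun _ => 1) (bch (of i) (-c))]
  refine Finset.sum_congr rfl fun i _ => ?_
  rw [map_bch (filtered_relabel _ _) (relabel_one _ _) (relabel_mul _ _) (of_mem_ord _)
    (Submodule.neg_mem _ hc), relabel_of, one_smul, map_neg]

/-- The starting variable `i₀` breaks the symmetry, but the defect is equivariant: a permuted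
approximation is again an approximate zero, and these are unique. -/
theorem mean_symmetric (i₀ : ι) (π : Equiv.Perm ι) (w : List ι) :
    mean i₀ (w.map π) = mean i₀ w := by
  have h := sub_mem_ord_of_defect i₀ (filtered_relabel π (fun _ => 1) _ _
    (meanSeq_mem_ord i₀ w.length)) (meanSeq_mem_ord i₀ w.length) (by
      rw [defect_relabel π (meanSeq_mem_ord i₀ _)]
      exact filtered_relabel _ _ _ _ (defect_meanSeq_mem_ord i₀ w.length))
    (defect_meanSeq_mem_ord i₀ w.length) w (Nat.lt_succ_self _)
  rw [sub_apply, sub_eq_zero, relabel_apply] at h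
  rw [mean, mean, List.length_map, ← h]
  simp

variable {G : Type} {deg : G → ℤ} [Fintype G] {δ : G → NCSeries G}

/-- If `c` flows from `a` to `b`, each `BCH(x_i, -c)` is a loop at `a`, hence in the kernel of
`∂_a`. Their average is therefore again a loop at `a`, and following it by `c` still leads to `b`.
-/
theorem flowsTo_substLin_meanSeq (hδ : ∀ g, δ g ∈ ord G 1) (i₀ : ι) {a b : NCSeries G}
    {x : ι → NCSeries G} (hx : ∀ i, x i ∈ ord G 1) (hdx : ∀ i, x i ∈ homDeg deg 0)
    (h : ∀ i, FlowsTo deg δ a (x i) b) (k : ℕ) :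
    FlowsTo deg δ a (substLin x (meanSeq i₀ k)) b := by
  induction k with
  | zero => rw [meanSeq, substLin_of hx]; exact h i₀
  | succ k ih =>
    have hΨ := filtered_substLin hx
    have hc := meanSeq_mem_ord i₀ k
    have hc1 := hΨ _ _ hc
    have hdc := substLin_mem_homDeg hdx (meanSeq i₀ k)
    have hm : (Fintype.card ι : ℚ)⁻¹ • defect (meanSeq i₀ k) ∈ ord ι 1 :=
      Submodule.smul_mem _ _ (defect_mem_ord hc)
    have hdm := substLin_mem_homDeg hdx ((Fintype.card ι : ℚ)⁻¹ • defect (meanSeq i₀ k))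
    rw [meanSeq, map_bch hΨ (substLin_one hx) (substLin_mul hx) hm hc]
    refine FlowsTo.trans (hΨ _ _ hm) hc1 hdm ?_ ih
    rw [flowsTo_self_iff hδ (hΨ _ _ hm) hdm, map_smul, map_smul, defect, map_sum, map_sum,
      Finset.sum_eq_zero, smul_zero]
    intro i _
    have hn := Submodule.neg_mem _ hc1
    rw [map_bch hΨ (substLin_one hx) (substLin_mul hx) (of_mem_ord i) (Submodule.neg_mem _ hc),
      substLin_of hx, map_neg, ← flowsTo_self_iff hδ (bch_mem_ord (hx i) hn)
      (bch_mem_homDeg (hdx i) (Submodule.neg_mem _ hdc))]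
    exact FlowsTo.trans (hx i) hn (hdx i) (h i) (ih.symm hc1 hdc)

/-- Both sides of the gauge equation are continuous in `e^x`, so it passes to limits. -/
theorem FlowsTo.of_limit (hδ : ∀ g, δ g ∈ ord G 1) {a b x : NCSeries G} {y : ℕ → NCSeries G}
    (hx : x ∈ ord G 1) (hy : ∀ k, y k ∈ ord G 1) (hxy : ∀ k, x - y k ∈ ord G k)
    (h : ∀ k, FlowsTo deg δ a (y k) b) : FlowsTo deg δ a x b := by
  unfold FlowsTo at *
  refine eq_of_forall_sub_mem_ord fun k => ?_
  have he : exp x - exp (y k) ∈ ord G k := by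
    rw [exp_eq, exp_eq]; exact serEval_sub_mem_ord hx (hy k) (hxy k) _
  have e : a * exp x + derivExt deg δ (exp x) - exp x * b = a * (exp x - exp (y k)) +
      derivExt deg δ (exp x - exp (y k)) - (exp x - exp (y k)) * b := by
    rw [map_sub, mul_sub, sub_mul, ← h k]
    abel
  rw [e]
  exact Submodule.sub_mem _ (Submodule.add_mem _ (filtered_mulLeft a k _ he)
    (filtered_derivExt hδ k _ he)) (filtered_mulRight b k _ he)

end Average

theorem isUniversalAverage_mean {ι : Type} [Fintype ι] (i₀ : ι) : IsUniversalAverage (mean i₀) where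
  lie := mean_mem_lieSeries i₀
  symmetric := mean_symmetric i₀
  flow_eq := by
    intro G _ deg D hD hfilt a b x _ _ hx
    have := Fintype.ofFinite G
    have hgd : IsGradedDerivation D := ⟨hfilt, hD.d_mem, hD.leibniz⟩
    have hδ : ∀ g, (D (FreeGLA.gen deg g)).1 ∈ ord G 1 := fun g => piece_mem_ord (hgd.mem_piece g)
    have hx1 : ∀ i, x i ∈ ord G 1 := fun i => piece_mem_ord (hx i).1
    have hd : ∀ i, x i ∈ homDeg deg 0 := fun i => (hx i).1.2
    have hμ : mean i₀ ∈ ord ι 1 := lieSeries_mem_ord (mean_mem_lieSeries i₀)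
    have hv : substLin x (mean i₀) ∈ piece deg 0 :=
      ⟨substLin_mem_lieSeries (fun i => (hx i).1.1) hd (mean_mem_lieSeries i₀),
        substLin_mem_homDeg hd _⟩
    rw [← substLin_apply, flow_eq_iff hδ (hgd.diffAt_eq (piece_le_total deg 0 hv))
      (piece_mem_ord hv) hv.2]
    have hfl : ∀ i, FlowsTo deg (fun g => (D (FreeGLA.gen deg g)).1) a (x i) b := fun i =>
      (flow_eq_iff hδ (hgd.diffAt_eq (piece_le_total deg 0 (hx i).1)) (hx1 i) (hd i)).1 (hx i).2
    refine FlowsTo.of_limit hδ (piece_mem_ord hv)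
      (fun k => filtered_substLin hx1 _ _ (meanSeq_mem_ord i₀ k)) (fun k => ?_)
      (fun k => flowsTo_substLin_meanSeq hδ i₀ hx1 hd hfl k)
    rw [← map_sub]
    exact filtered_substLin hx1 _ _ (ord_mono (Nat.le_succ k) (mean_sub_meanSeq_mem_ord i₀ k))

/-! ### Existence of the remainder of the Baker-Campbell-Hausdorff series -/

section Remainder

/-- Every Lie polynomial in `x` and `y` is of the form `c x + P(ad x, ad y) y`. -/
theorem IsLiePoly_eq_evalLin {p : NCSeries (Fin 2)} (hp : IsLiePoly (fun _ => 0) Set.univ p) :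
    ∃ (c : ℚ) (P : NCSeries (Fin 2)),
      p = c • of 0 + evalLin (fun i => adOp (fun _ => 0) (of i)) P (of 1) := by
  set T : Fin 2 → Module.End ℚ (NCSeries (Fin 2)) := fun i => adOp (fun _ => 0) (of i) with hTdef
  have hT : ∀ i, Contracting (T i) := fun i => contracting_adOp (of_mem_ord i)
  let V : Submodule ℚ (NCSeries (Fin 2)) :=
    Submodule.span ℚ {of 0} ⊔ LinearMap.range ((evalLin T).flip (of 1))
  have hmem : ∀ q, q ∈ V ↔ ∃ (c : ℚ) (P : NCSeries (Fin 2)), q = c • of 0 + evalLin T P (of 1) := by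
    intro q
    rw [Submodule.mem_sup]
    constructor
    · rintro ⟨y, hy, z, ⟨P, rfl⟩, rfl⟩
      obtain ⟨c, rfl⟩ := Submodule.mem_span_singleton.1 hy
      exact ⟨c, P, rfl⟩
    · rintro ⟨c, P, rfl⟩
      exact ⟨_, Submodule.mem_span_singleton.2 ⟨c, rfl⟩, _, ⟨P, rfl⟩, rfl⟩
  have hof : ∀ i, of i ∈ V := by
    intro i
    fin_cases i
    · exact (hmem _).2 ⟨1, 0, by simp⟩
    · exact (hmem _).2 ⟨0, 1, by rw [evalLin_one hT, zero_smul, zero_add]; rfl⟩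
  have had : ∀ i, ∀ q ∈ V, T i q ∈ V := by
    intro i q hq
    obtain ⟨c, P, rfl⟩ := (hmem q).1 hq
    rw [map_add, map_smul]
    refine Submodule.add_mem _ (Submodule.smul_mem _ _ ?_) ?_
    · fin_cases i
      · have : T 0 (of 0) = 0 := by
          rw [hTdef, adOp_apply, bracket_even (mem_homDeg_zero _), sub_self]
        exact (congrArg (· ∈ V) this).mpr (Submodule.zero_mem _)
      -- `[y, x] = -[x, y]` is of the required form, with `P = -X`.
      · have : T 1 (of 0) = evalLin T (-of 0) (of 1) := by
          rw [map_neg, LinearMap.neg_apply, evalLin_of hT, hTdef, adOp_apply, adOp_apply,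
            bracket_even (mem_homDeg_zero _), bracket_even (mem_homDeg_zero _), neg_sub]
        exact (hmem _).2 ⟨0, -of 0, by rw [zero_smul, zero_add]; exact this⟩
    · exact (hmem _).2 ⟨0, of i * P, by rw [zero_smul, zero_add, evalLin_mul hT, evalLin_of hT]⟩
  rw [← hmem]
  -- Membership alone does not pass to brackets; with stability of `V` under `ad p` added, the
  -- Jacobi identity closes the induction.
  suffices h : p ∈ V ∧ ∀ q ∈ V, bracket (fun _ => 0) p q ∈ V from h.1
  have hjac : ∀ p q r : NCSeries (Fin 2), bracket (fun _ => 0) (bracket (fun _ => 0) p q) r =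
      bracket (fun _ => 0) p (bracket (fun _ => 0) q r) -
        bracket (fun _ => 0) q (bracket (fun _ => 0) p r) := fun p q r => by
    simp only [bracket_even (mem_homDeg_zero _)]
    noncomm_ring
  induction hp with
  | zero =>
    refine ⟨Submodule.zero_mem _, fun q _ => ?_⟩
    have : bracket (fun _ => 0) 0 q = 0 := by
      rw [bracket_even (mem_homDeg_zero _), zero_mul, mul_zero, sub_zero]
    rw [this]; exact Submodule.zero_mem _
  | of i _ => exact ⟨hof i, had i⟩
  | add p q _ _ hp hq =>
    refine ⟨Submodule.add_mem _ hp.1 hq.1, fun r hr => ?_⟩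
    rw [bracket_add_left]
    exact Submodule.add_mem _ (hp.2 r hr) (hq.2 r hr)
  | smul c p _ hp =>
    refine ⟨Submodule.smul_mem _ c hp.1, fun r hr => ?_⟩
    rw [bracket_smul_left]
    exact Submodule.smul_mem _ c (hp.2 r hr)
  | bracket p q _ _ hp hq =>
    refine ⟨hp.2 q hq.1, fun r hr => ?_⟩
    rw [hjac]
    exact Submodule.sub_mem _ (hp.2 _ (hq.2 r hr)) (hq.2 _ (hp.2 r hr))

theorem of_apply_singleton {G : Type} (g : G) : of g [g] = 1 := by rw [of, if_pos rfl]

theorem of_apply_singleton_ne {G : Type} {g h : G} (hne : h ≠ g) : of g [h] = 0 := by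
  rw [of, if_neg (by simpa using hne)]

theorem apply_eq_of_sub_mem_ord {G : Type} {p q : NCSeries G} {m : ℕ} (h : p - q ∈ ord G m)
    {w : List G} (hw : w.length < m) : p w = q w := by
  have := h w hw
  rwa [sub_apply, sub_eq_zero] at this

theorem remainder_operators :
    (![bracket (fun _ => 0) (of 0), bracket (fun _ => 0) (of 1)] :
      Fin 2 → NCSeries (Fin 2) → NCSeries (Fin 2)) = fun i => ⇑(adOp (fun _ => 0) (of i)) := by
  funext i; fin_cases i <;> rfl

/-- The coefficients of `Q(ad x, ad y) y` and of `Q` in adjacent lengths correspond. -/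
theorem homPart_evalLin_of (Q : NCSeries (Fin 2)) (m : ℕ) :
    homPart (m + 1) (evalLin (fun i => adOp (fun _ => 0) (of i)) Q (of 1)) =
      evalLin (fun i => adOp (fun _ => 0) (of i)) (homPart m Q) (of 1) := by
  have hT : ∀ i : Fin 2, Contracting (adOp (fun _ => 0) (of i)) :=
    fun i => contracting_adOp (of_mem_ord i)
  set T : Fin 2 → Module.End ℚ (NCSeries (Fin 2)) := fun i => adOp (fun _ => 0) (of i) with hTdef
  have hhom : ∀ (k : ℕ) (p : NCSeries (Fin 2)) (n : ℕ), (∀ w, p w ≠ 0 → w.length = n) →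
      ∀ i w, T i p w ≠ 0 → w.length = n + 1 := by
    intro k p n hp i w hw
    rw [hTdef, adOp_apply, bracket_even (mem_homDeg_zero _), sub_apply] at hw
    have hlw : ∀ (q r : NCSeries (Fin 2)) (a b : ℕ), (∀ w, q w ≠ 0 → w.length = a) →
        (∀ w, r w ≠ 0 → w.length = b) → ∀ w, (q * r) w ≠ 0 → w.length = a + b := by
      intro q r a b hq hr w hw
      rw [mul_apply] at hw
      obtain ⟨j, -, hj⟩ := Finset.exists_ne_zero_of_sum_ne_zero hw
      rw [← List.take_append_drop j w, List.length_append, hq _ (left_ne_zero_of_mul hj),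
        hr _ (right_ne_zero_of_mul hj)]
    have hofl : ∀ w, (of i : NCSeries (Fin 2)) w ≠ 0 → w.length = 1 := fun w hw => by
      by_contra hne
      refine hw ?_
      rw [of, if_neg]
      rintro rfl
      exact hne rfl
    by_cases h1 : (of i * p) w = 0
    · have h2 : (p * of i) w ≠ 0 := fun h2 => hw (by rw [h1, h2, sub_zero])
      exact hlw p (of i) n 1 hp hofl w h2
    · rw [hlw (of i) p 1 n hofl hp w h1, add_comm]
  have hpart : ∀ k Q w, evalPart T Q k (of 1) w ≠ 0 → w.length = k + 1 := by
    intro k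
    induction k with
    | zero =>
      intro Q w hw
      rw [evalPart_zero, smul_apply] at hw
      by_contra hne
      refine right_ne_zero_of_mul hw ?_
      rw [of, if_neg]
      rintro rfl
      exact hne rfl
    | succ k ih =>
      intro Q w hw
      rw [evalPart_succ, sum_apply] at hw
      obtain ⟨i, -, hi⟩ := Finset.exists_ne_zero_of_sum_ne_zero hw
      exact hhom k _ (k + 1) (ih (shift i Q)) i w hi
  have hQ : ∀ k, evalPart T (homPart m Q) k = if k = m then evalPart T Q m else 0 := by
    intro k
    split_ifs with h
    · subst h
      exact Finset.sum_congr rfl fun u _ => by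
        rw [homPart_apply, if_pos (List.length_ofFn)]
    · exact Finset.sum_eq_zero fun u _ => by
        rw [homPart_apply, if_neg (by rwa [List.length_ofFn]), zero_smul]
  ext w
  rw [homPart_apply, evalLin_eq, evalLin_eq]
  simp only [seriesSum, hQ]
  by_cases hw : w.length = m + 1
  · rw [if_pos hw, Finset.sum_eq_single m, Finset.sum_eq_single m, if_pos rfl]
    · intro k _ hk; rw [if_neg hk]; rfl
    · intro h; exact absurd (Finset.mem_range.2 (by omega)) h
    · intro k _ hk
      by_contra hne
      have := hpart k Q w hne
      omega
    · intro h; exact absurd (Finset.mem_range.2 (by omega)) h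
  · rw [if_neg hw]
    symm
    refine Finset.sum_eq_zero fun k _ => ?_
    split_ifs with hk
    · by_contra hne
      exact hw (hpart m Q w hne)
    · rfl

/-- The part of length `m` of BCH is `c x + P_m(ad x, ad y) y`, and only the words of length `m - 1`
in `P_m` contribute to that length. Gluing these pieces for all `m` gives one series; for `m ≥ 2`
the multiple of `x` has the wrong length and drops out. -/
theorem exists_isBCHRemainder : ∃ Q : NCSeries (Fin 2), IsBCHRemainder Q := by
  set T : Fin 2 → Module.End ℚ (NCSeries (Fin 2)) := fun i => adOp (fun _ => 0) (of i) with hTdef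
  have hT : ∀ i, Contracting (T i) := fun i => contracting_adOp (of_mem_ord i)
  set Z : NCSeries (Fin 2) := bch (of 0) (of 1) with hZ
  have hlie : Z ∈ lieSeries (fun _ => 0) Set.univ :=
    bch_mem_lieSeries (of_mem_lieSeries (Set.mem_univ _)) (of_mem_lieSeries (Set.mem_univ _))
      (mem_homDeg_zero _) (mem_homDeg_zero _)
  choose c P hP using fun m => IsLiePoly_eq_evalLin (hlie m)
  have hZ1 := bch_sub_add_mem_ord (of_mem_ord (0 : Fin 2)) (of_mem_ord (1 : Fin 2))
  -- A word `w` acting on `y` has total length `w.length + 1`, hence the index of `P`. Subtracting 1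
  -- removes the linear term `y`, which the identity lists separately.
  let Q : NCSeries (Fin 2) := fun w => P (w.length + 1) w - (1 : NCSeries (Fin 2)) w
  refine ⟨Q, ?_⟩
  rw [IsBCHRemainder, remainder_operators, ← evalLin_apply]
  have h0 : ∀ m, homPart (m + 2) (of (0 : Fin 2)) = 0 := fun m => by
    ext w
    rw [homPart_apply]
    split_ifs with h
    · rw [of, if_neg]
      · rfl
      · rintro rfl; simp at h
    · rfl
  rw [← seriesSum_homPart (bch _ _), ← seriesSum_homPart (of 0 + of 1 + _)]
  congr 1
  funext m
  match m with
  | 0 =>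
    rw [homPart_eq_zero one_pos (bch_mem_ord (of_mem_ord _) (of_mem_ord _)),
      homPart_eq_zero one_pos (Submodule.add_mem _ (Submodule.add_mem _ (of_mem_ord _)
        (of_mem_ord _)) (filtered_evalLin hT _ _ _ (of_mem_ord _)))]
  | 1 =>
    have hQ0 : homPart 0 Q = 0 := by
      -- The coefficient of `y` in the linear part `x + y`, read off at the word `[1]`.
      have hP1 : P 1 [] = 1 := by
        have h1 := congrFun (hP 1) [1]
        rw [homPart_apply, if_pos (by rfl), hZ, apply_eq_of_sub_mem_ord hZ1 (by simp), add_apply, add_apply,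
          smul_apply, of_apply_singleton, of_apply_singleton_ne (by decide), mul_zero, zero_add,
          zero_add, apply_eq_of_sub_mem_ord (evalLin_sub_smul_mem_ord hT (P 1) (of_mem_ord 1))
          (by simp), smul_apply, of_apply_singleton, mul_one] at h1
        exact h1.symm
      ext w
      rw [homPart_apply]
      split_ifs with h
      · rw [List.length_eq_zero_iff] at h
        subst h
        change P 1 [] - 1 = 0
        rw [hP1, sub_self]
      · rfl
    rw [homPart_congr (by norm_num : 1 < 2) hZ1, homPart_add 1 (of 0 + of 1), homPart_evalLin_of,
      hQ0, map_zero, LinearMap.zero_apply, add_zero]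
  | m + 2 =>
    have h1 : ∀ m, homPart (m + 2) (of (1 : Fin 2)) = 0 := fun m => by
      ext w
      rw [homPart_apply]
      split_ifs with h
      · rw [of, if_neg]
        · rfl
        · rintro rfl; simp at h
      · rfl
    have hQ : homPart (m + 1) Q = homPart (m + 1) (P (m + 2)) := by
      ext w
      rw [homPart_apply, homPart_apply]
      split_ifs with h
      · change P (w.length + 1) w - (1 : NCSeries (Fin 2)) w = _
        rw [h]
        cases w with
        | nil => simp at h
        | cons a w => rw [one_cons, sub_zero]
      · rfl
    rw [homPart_add, homPart_add, h0, h1, homPart_evalLin_of, hQ, ← homPart_evalLin_of, zero_add,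
      zero_add]
    have := congrArg (homPart (m + 2)) (hP (m + 2))
    rw [homPart_homPart, if_pos rfl, homPart_add, homPart_smul, h0, smul_zero, zero_add] at this
    exact this

/-- The constant term of the remainder vanishes. -/
theorem _root_.IsBCHRemainder.nil {Q : NCSeries (Fin 2)} (hQ : IsBCHRemainder Q) : Q [] = 0 := by
  have hT : ∀ i : Fin 2, Contracting (adOp (fun _ => 0) (of i)) :=
    fun i => contracting_adOp (of_mem_ord i)
  have h := congrFun hQ [1]
  rw [remainder_operators, ← evalLin_apply, apply_eq_of_sub_mem_ord
    (bch_sub_add_mem_ord (of_mem_ord (0 : Fin 2)) (of_mem_ord (1 : Fin 2))) (by simp), add_apply,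
    add_apply, apply_eq_of_sub_mem_ord (evalLin_sub_smul_mem_ord hT Q (of_mem_ord 1)) (by simp),
    smul_apply, of_apply_singleton, add_apply] at h
  rw [of_apply_singleton] at h
  linarith

end Remainder

end NCSeries

/-! ### Leading terms and conjugation -/

namespace NCSeries

variable {G : Type} {deg : G → ℤ}

theorem opEval_sub_smul_mem_ord {T : Module.End ℚ (NCSeries G)} (hT : Contracting T)
    (f : PowerSeries ℚ) {m : ℕ} {p : NCSeries G} (hp : p ∈ ord G m) :
    opEval T f p - PowerSeries.constantCoeff f • p ∈ ord G (m + 1) := by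
  have h1 : opEval T (PowerSeries.C (PowerSeries.constantCoeff f)) p =
      PowerSeries.constantCoeff f • p := by
    rw [opEval_apply]
    symm
    have key : ∀ k, PowerSeries.coeff k (PowerSeries.C (PowerSeries.constantCoeff f)) • (T ^ k) p =
        if k = 0 then PowerSeries.constantCoeff f • p else 0 := fun k => by
      rw [PowerSeries.coeff_C]
      split_ifs with h
      · rw [h]; rfl
      · rw [zero_smul]
    simp only [key]
    ext w
    rw [seriesSum, Finset.sum_eq_single 0]
    · rfl
    · intro k _ hk; rw [if_neg hk]; rfl
    · simp
  have h2 : opEval T f p - PowerSeries.constantCoeff f • p =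
      opEval T (f + -PowerSeries.C (PowerSeries.constantCoeff f)) p := by
    rw [opEval_add, opEval_neg, LinearMap.add_apply, LinearMap.neg_apply, h1, sub_eq_add_neg]
  rw [h2]
  refine opEval_mem_ord hT (fun k hk => ?_) hp
  rw [Nat.lt_one_iff.1 hk, map_add, map_neg, PowerSeries.coeff_C, if_pos rfl,
    PowerSeries.coeff_zero_eq_constantCoeff_apply, add_neg_cancel]

theorem opEval_evalNegHom (T : Module.End ℚ (NCSeries G)) (f : PowerSeries ℚ) :
    opEval T (PowerSeries.evalNegHom f) = opEval (-T) f := by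
  refine LinearMap.ext fun p => ?_
  rw [opEval_apply, opEval_apply]
  congr 1
  funext k
  have h4 : ((-T) ^ k) p = ((-1 : ℚ) ^ k) • (T ^ k) p := by
    rw [neg_pow, Module.End.mul_apply]
    rcases Nat.even_or_odd k with he | ho
    · rw [he.neg_one_pow, he.neg_one_pow, one_smul]; rfl
    · rw [ho.neg_one_pow, ho.neg_one_pow, neg_smul, one_smul]; rfl
  rw [PowerSeries.evalNegHom, PowerSeries.coeff_rescale, h4, smul_smul, mul_comm]

theorem expOp_bracket_eq (x p : NCSeries G) :
    expOp (bracket deg x) p = opEval (adOp deg x) (PowerSeries.exp ℚ) p := expOp_eq (adOp deg x) p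

/-- `exp (-ad h) z` as a Baker-Campbell-Hausdorff product. -/
theorem bch_conj {h z : NCSeries G} (hh : h ∈ ord G 1) (hz : z ∈ ord G 1)
    (hd : h ∈ homDeg deg 0) :
    bch (bch (-h) z) h = expOp (bracket deg (-h)) z := by
  have hh' := Submodule.neg_mem _ hh
  rw [expOp_bracket hh' (Submodule.neg_mem _ hd), neg_neg]
  -- Conjugation by `e^{-h}` is a filtered algebra homomorphism, so it commutes with `exp`;
  -- injectivity of `exp` then gives the claim.
  let Ψ : Module.End ℚ (NCSeries G) := LinearMap.mulLeft ℚ (exp (-h)) ∘ₗ LinearMap.mulRight ℚ (exp h)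
  have hΨ : Filtered Ψ := (filtered_mulLeft _).comp (filtered_mulRight _)
  have hΨa : ∀ p, Ψ p = exp (-h) * p * exp h := fun p => (mul_assoc _ _ _).symm
  have h1 : Ψ 1 = 1 := by rw [hΨa, mul_one, exp_neg_mul_exp hh]
  have hmul : ∀ p q, Ψ (p * q) = Ψ p * Ψ q := fun p q => by
    rw [hΨa, hΨa, hΨa]
    calc exp (-h) * (p * q) * exp h = exp (-h) * p * (exp h * exp (-h)) * q * exp h := by
          rw [exp_mul_exp_neg hh]; noncomm_ring
      _ = _ := by noncomm_ring
  refine exp_injOn (bch_mem_ord (bch_mem_ord hh' hz) hh) (by rw [← hΨa]; exact hΨ _ _ hz) ?_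
  rw [← hΨa, ← map_exp hΨ h1 hmul hz, hΨa, exp_bch (bch_mem_ord hh' hz) hh, exp_bch hh' hz]

theorem expOp_bracket_mem_lieSeries {S : Set G} {x p : NCSeries G} (hx : x ∈ lieSeries deg S)
    (hp : p ∈ lieSeries deg S) : expOp (bracket deg x) p ∈ lieSeries deg S := by
  rw [expOp_bracket_eq]
  exact opEval_adOp_mem_lieSeries hx hp _

theorem opEval_adOp_mem_homDeg {d : ℤ} {x p : NCSeries G} (hx : x ∈ homDeg deg 0)
    (hp : p ∈ homDeg deg d) (f : PowerSeries ℚ) : opEval (adOp deg x) f p ∈ homDeg deg d :=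
  opEval_mem (fun _ => seriesSum_mem_homDeg) (fun q hq => by
    have := bracket_mem_homDeg hx hq
    rwa [zero_add] at this) f hp

theorem expOp_bracket_mem_homDeg {d : ℤ} {x p : NCSeries G} (hx : x ∈ homDeg deg 0)
    (hp : p ∈ homDeg deg d) : expOp (bracket deg x) p ∈ homDeg deg d := by
  rw [expOp_bracket_eq]
  exact opEval_adOp_mem_homDeg hx hp _

theorem expOp_bracket_smul (x : NCSeries G) (c : ℚ) (p : NCSeries G) :
    expOp (bracket deg x) (c • p) = c • expOp (bracket deg x) p := by
  simp only [expOp_bracket_eq, map_smul]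

theorem expOp_bracket_neg_cancel {x : NCSeries G} (hx : x ∈ ord G 1) (hd : x ∈ homDeg deg 0)
    (p : NCSeries G) : expOp (bracket deg x) (expOp (bracket deg (-x)) p) = p := by
  rw [expOp_bracket hx hd, expOp_bracket (Submodule.neg_mem _ hx) (Submodule.neg_mem _ hd), neg_neg]
  calc exp x * (exp (-x) * p * exp x) * exp (-x) =
        (exp x * exp (-x)) * p * (exp x * exp (-x)) := by noncomm_ring
    _ = p := by rw [exp_mul_exp_neg hx, one_mul, mul_one]

/-! ### Endpoints of flows -/

section FlowEnd

variable [Fintype G] {δ : G → NCSeries G}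

/-- The endpoint of the flow of `a` by `e`. -/
noncomputable def flowEnd (deg : G → ℤ) (δ : G → NCSeries G) (e a : NCSeries G) : NCSeries G :=
  expOp (bracket deg (-e)) a + opEval (adOp deg e) PowerSeries.expQuot (derivExt deg δ e)

theorem flow_eq_flowEnd {D : FreeGLA deg →ₗ[ℚ] FreeGLA deg} {e : NCSeries G} (a : NCSeries G)
    (hD : diffAt D e = derivExt deg δ e) : flow D e a = flowEnd deg δ e a := by
  have h1 : (-bracket deg e : NCSeries G → NCSeries G) = bracket deg (-e) := by
    rw [← coe_adOp, ← coe_adOp, adOp_neg]; rfl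
  rw [flow, h1, hD, flowEnd]
  congr 1
  change opSeries _ _ _ = opSeries _ _ _
  congr 1
  funext k
  rw [PowerSeries.expQuot, PowerSeries.coeff_mk]

theorem flowsTo_iff_flowEnd {e a b : NCSeries G}
    (hδ1 : ∀ g, δ g ∈ ord G 1) (he : e ∈ ord G 1)
    (hd : e ∈ homDeg deg 0) : FlowsTo deg δ a e b ↔ flowEnd deg δ e a = b := by
  rw [flowEnd, expOp_bracket (Submodule.neg_mem _ he) (Submodule.neg_mem _ hd), neg_neg,
    adOp_even hd, ← exp_neg_mul_derivation_exp (filtered_derivExt hδ1) derivExt_one he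
      (fun q => derivExt_even_mul hd q), mul_assoc, ← mul_add, FlowsTo]
  constructor
  · intro h
    rw [h, ← mul_assoc, exp_neg_mul_exp he, one_mul]
  · rintro rfl
    rw [← mul_assoc, exp_mul_exp_neg he, one_mul]

theorem flowsTo_flowEnd {e : NCSeries G} (a : NCSeries G)
    (hδ1 : ∀ g, δ g ∈ ord G 1) (he : e ∈ ord G 1)
    (hd : e ∈ homDeg deg 0) : FlowsTo deg δ a e (flowEnd deg δ e a) :=
  (flowsTo_iff_flowEnd hδ1 he hd).2 rfl

theorem flowEnd_mem_lieSeries {S : Set G} {e a : NCSeries G} (he : e ∈ lieSeries deg S)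
    (ha : a ∈ lieSeries deg S) (hde : derivExt deg δ e ∈ lieSeries deg S) :
    flowEnd deg δ e a ∈ lieSeries deg S :=
  Submodule.add_mem _ (expOp_bracket_mem_lieSeries (Submodule.neg_mem _ he) ha)
    (opEval_adOp_mem_lieSeries he hde _)

theorem flowEnd_mem_homDeg (hδ : ∀ g, δ g ∈ homDeg deg (deg g - 1)) {e a : NCSeries G}
    (he : e ∈ homDeg deg 0) (ha : a ∈ homDeg deg (-1)) :
    flowEnd deg δ e a ∈ homDeg deg (-1) :=
  Submodule.add_mem _ (expOp_bracket_mem_homDeg (Submodule.neg_mem _ he) ha)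
    (opEval_adOp_mem_homDeg he (by simpa using derivExt_mem_homDeg hδ he) _)

/-- Being a point, for a series of degree `-1`. -/
theorem isPoint_deriv_iff (hδ : ∀ g, δ g ∈ piece deg (deg g - 1)) {p : NCSeries G}
    (hp : p ∈ piece deg (-1)) : IsPoint (FreeGLA.deriv hδ) p ↔ derivExt deg δ p = -(p * p) := by
  have h : (1 / 2 : ℚ) • bracket deg p p = p * p := by
    rw [bracket_neg_one hp.2, sgn_neg_one hp.2, neg_mul, sub_neg_eq_add, ← two_smul ℚ, smul_smul]
    norm_num
  rw [IsPoint, FreeGLA.diffAt_deriv hδ (piece_le_total deg _ hp), h]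
  exact ⟨fun h => eq_neg_of_add_eq_zero_left h.2, fun h => ⟨hp, by rw [h, neg_add_cancel]⟩⟩

end FlowEnd

/-! ### Equivariance -/

section Equivariance

variable {π : Equiv.Perm G} {s : G → ℚ}

theorem relabel_opEval_adOp (hπ : ∀ c, deg (π c) = deg c) {x : NCSeries G} (hx : x ∈ ord G 1)
    (f : PowerSeries ℚ) (p : NCSeries G) : relabel π s (opEval (adOp deg x) f p) =
      opEval (adOp deg (relabel π s x)) f (relabel π s p) :=
  map_opEval (T' := adOp deg (relabel π s x)) (filtered_relabel π s) (contracting_adOp hx)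
    (fun q => relabel_bracket hπ s x q) f p

theorem relabel_expOp_bracket (hπ : ∀ c, deg (π c) = deg c) {x : NCSeries G} (hx : x ∈ ord G 1)
    (p : NCSeries G) : relabel π s (expOp (bracket deg x) p) =
      expOp (bracket deg (relabel π s x)) (relabel π s p) := by
  rw [expOp_bracket_eq, relabel_opEval_adOp hπ hx, expOp_bracket_eq]

theorem relabel_bch {x y : NCSeries G} (hx : x ∈ ord G 1) (hy : y ∈ ord G 1) :
    relabel π s (bch x y) = bch (relabel π s x) (relabel π s y) :=
  map_bch (filtered_relabel π s) (relabel_one π s) (relabel_mul π s) hx hy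

variable [Fintype G] {δ : G → NCSeries G}

/-- Both composites satisfy the same Leibniz rule along the relabelling, so agreement on generators
extends to brackets, and by continuity to all Lie series. -/
theorem relabel_derivExt (hπ : ∀ c, deg (π c) = deg c) (hδ : ∀ g, δ g ∈ piece deg (deg g - 1))
    (h : ∀ c, relabel π s (δ (π c)) = s c • δ c) {p : NCSeries G}
    (hp : p ∈ lieSeries deg Set.univ) :
    relabel π s (derivExt deg δ p) = derivExt deg δ (relabel π s p) := by
  have hδ1 : ∀ g, δ g ∈ ord G 1 := fun g => piece_mem_ord (hδ g)
  have hδ2 : ∀ g, δ g ∈ homDeg deg (deg g - 1) := fun g => (hδ g).2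
  have hfr := filtered_relabel π s
  have hfd := filtered_derivExt (deg := deg) hδ1
  rw [← sub_eq_zero]
  refine map_eq_zero_of_mem_lieSeries (deg := deg) (S := Set.univ)
    (Ψ := relabel π s ∘ₗ derivExt deg δ - derivExt deg δ ∘ₗ relabel π s)
    (fun m q hq => Submodule.sub_mem _ (hfr _ _ (hfd _ _ hq)) (hfd _ _ (hfr _ _ hq)))
    (fun p hp => ?_) hp
  rw [LinearMap.sub_apply, sub_eq_zero, LinearMap.comp_apply, LinearMap.comp_apply]
  refine isLiePoly_homogeneous_induction
    (P := fun p => relabel π s (derivExt deg δ p) = derivExt deg δ (relabel π s p))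
    ?_ (fun g _ => ?_) (fun p q hp hq => ?_) (fun c p hp => ?_)
    (fun d e p q hd he hp hq hp' hq' => ?_) hp
  · simp only [map_zero]
  · obtain ⟨c, rfl⟩ := π.surjective g
    rw [derivExt_of, relabel_of, map_smul, derivExt_of, h]
  · simp only [map_add, hp, hq]
  · simp only [map_smul, hp]
  · rw [derivExt_bracket hδ2 hd he, relabel_bracket hπ,
      derivExt_bracket hδ2 (relabel_mem_homDeg hπ s hd) (relabel_mem_homDeg hπ s he), map_add,
      map_smul, relabel_bracket hπ, relabel_bracket hπ, hp', hq']

theorem relabel_flowEnd (hπ : ∀ c, deg (π c) = deg c) (hδ : ∀ g, δ g ∈ piece deg (deg g - 1))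
    (h : ∀ c, relabel π s (δ (π c)) = s c • δ c) {e : NCSeries G}
    (he : e ∈ lieSeries deg Set.univ) (a : NCSeries G) :
    relabel π s (flowEnd deg δ e a) = flowEnd deg δ (relabel π s e) (relabel π s a) := by
  have he1 := lieSeries_mem_ord he
  rw [flowEnd, map_add, relabel_expOp_bracket hπ (Submodule.neg_mem _ he1),
    relabel_opEval_adOp hπ he1, relabel_derivExt hπ hδ h he, map_neg, flowEnd]

end Equivariance

/-- Symmetry of `μ` turns a permutation of the arguments into a reindexing of the words of each
length. -/
theorem substLin_comp_perm {ι : Type} [Fintype ι] (x : ι → NCSeries G) {μ : NCSeries ι}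
    (π : Equiv.Perm ι) (h : ∀ w : List ι, μ (w.map π) = μ w) :
    substLin (fun i => x (π i)) μ = substLin x μ := by
  change evalLin _ μ 1 = evalLin _ μ 1
  rw [evalLin_eq, evalLin_eq]
  congr 1
  funext k
  congr 1
  rw [evalPart, evalPart]
  refine Eq.trans ?_ (Equiv.sum_comp (Equiv.arrowCongr (Equiv.refl (Fin k)) π) _)
  refine Finset.sum_congr rfl fun u _ => ?_
  have e : List.ofFn ((Equiv.arrowCongr (Equiv.refl (Fin k)) π) u) = (List.ofFn u).map π := by
    rw [List.map_ofFn]; rfl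
  rw [e, h, List.map_map]
  rfl

end NCSeries


/-! ### The DGLA axioms -/

namespace FreeGLA

variable {G : Type} {deg : G → ℤ}

/-- The part of degree `d` of a series. -/
noncomputable def degPart (deg : G → ℤ) (d : ℤ) : Module.End ℚ (NCSeries G) where
  toFun p := fun w => if wordDeg deg w = d then p w else 0
  map_add' p q := by
    ext w
    change (if _ then p w + q w else 0) = (if _ then p w else 0) + (if _ then q w else 0)
    split_ifs <;> simp
  map_smul' c p := by
    ext w
    change (if _ then c * p w else 0) = c * (if _ then p w else 0)
    split_ifs <;> simp

theorem degPart_of_mem {d : ℤ} {p : NCSeries G} (hp : p ∈ homDeg deg d) (e : ℤ) :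
    degPart deg e p = if d = e then p else 0 := by
  ext w
  change (if wordDeg deg w = e then p w else 0) = _
  by_cases h : p w = 0
  · split_ifs <;> simp [h, NCSeries.zero_apply]
  · rw [hp w h]
    split_ifs <;> rfl

/-- Independence comes from the projection `degPart`, the identity on one degree and zero on the
others; spanning holds by definition of `total`. -/
theorem isInternal_grade (deg : G → ℤ) : DirectSum.IsInternal (grade deg) := by
  rw [DirectSum.isInternal_submodule_iff_iSupIndep_and_iSup_eq_top]
  constructor
  · rw [iSupIndep_def]
    intro d
    rw [Submodule.disjoint_def]
    intro x hx hx'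
    have h1 : degPart deg d x.1 = x.1 := (degPart_of_mem hx.2 d).trans (if_pos rfl)
    have h2 : (⨆ j, ⨆ (_ : j ≠ d), grade deg j) ≤
        LinearMap.ker (degPart deg d ∘ₗ (total deg).subtype) := by
      refine iSup_le fun j => iSup_le fun hj y hy => ?_
      rw [LinearMap.mem_ker, LinearMap.comp_apply]
      exact (degPart_of_mem hy.2 d).trans (if_neg hj)
    have h3 := h2 hx'
    rw [LinearMap.mem_ker, LinearMap.comp_apply] at h3
    exact Subtype.ext (h1.symm.trans h3)
  · rw [eq_top_iff]
    rintro ⟨x, hx⟩ -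
    have key : ∃ h : x ∈ total deg, (⟨x, h⟩ : FreeGLA deg) ∈ ⨆ d, grade deg d := by
      refine Submodule.iSup_induction (piece deg)
        (motive := fun x => ∃ h : x ∈ total deg, (⟨x, h⟩ : FreeGLA deg) ∈ ⨆ d, grade deg d) hx
        (fun d y hy => ⟨piece_le_total deg d hy,
          (le_iSup (grade deg) d) (show (⟨y, _⟩ : FreeGLA deg) ∈ grade deg d from hy)⟩)
        ⟨Submodule.zero_mem _, Submodule.zero_mem _⟩ ?_
      rintro y z ⟨hy, hy'⟩ ⟨hz, hz'⟩
      exact ⟨Submodule.add_mem _ hy hz, Submodule.add_mem _ hy' hz'⟩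
    exact key.2

theorem bracket_symm {m n : ℤ} {p q : NCSeries G} (hp : p ∈ homDeg deg m) (hq : q ∈ homDeg deg n) :
    bracket deg q p = -((-1 : ℚ) ^ (m * n) • bracket deg p q) := by
  rw [bracket_of_mem_homDeg hq hp, bracket_of_mem_homDeg hp hq, smul_sub, smul_smul,
    neg_one_zpow_mul_self, one_smul, mul_comm n m]
  abel

theorem bracket_jacobi {l m n : ℤ} {p q r : NCSeries G} (hp : p ∈ homDeg deg l)
    (hq : q ∈ homDeg deg m) (hr : r ∈ homDeg deg n) :
    (-1 : ℚ) ^ (l * m) • bracket deg (bracket deg q r) p +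
      (-1 : ℚ) ^ (m * n) • bracket deg (bracket deg r p) q +
      (-1 : ℚ) ^ (n * l) • bracket deg (bracket deg p q) r = 0 := by
  rw [bracket_of_mem_homDeg (bracket_mem_homDeg hq hr) hp,
    bracket_of_mem_homDeg (bracket_mem_homDeg hr hp) hq,
    bracket_of_mem_homDeg (bracket_mem_homDeg hp hq) hr, bracket_of_mem_homDeg hq hr,
    bracket_of_mem_homDeg hr hp, bracket_of_mem_homDeg hp hq]
  have e1 : (-1 : ℚ) ^ ((m + n) * l) = (-1 : ℚ) ^ (l * m) * (-1 : ℚ) ^ (n * l) := by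
    rw [← zpow_add₀ (by norm_num)]; ring_nf
  have e2 : (-1 : ℚ) ^ ((n + l) * m) = (-1 : ℚ) ^ (m * n) * (-1 : ℚ) ^ (l * m) := by
    rw [← zpow_add₀ (by norm_num)]; ring_nf
  have e3 : (-1 : ℚ) ^ ((l + m) * n) = (-1 : ℚ) ^ (n * l) * (-1 : ℚ) ^ (m * n) := by
    rw [← zpow_add₀ (by norm_num)]; ring_nf
  rw [e1, e2, e3]
  have q1 := neg_one_zpow_mul_self (l * m)
  have q2 := neg_one_zpow_mul_self (m * n)
  have q3 := neg_one_zpow_mul_self (n * l)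
  set A := (-1 : ℚ) ^ (l * m)
  set B := (-1 : ℚ) ^ (m * n)
  set C := (-1 : ℚ) ^ (n * l)
  -- The three signs are each `1` or `-1`; in all eight cases the expanded products cancel by
  -- associativity.
  rcases mul_self_eq_one_iff.1 q1 with h1 | h1 <;> rcases mul_self_eq_one_iff.1 q2 with h2 | h2 <;>
  rcases mul_self_eq_one_iff.1 q3 with h3 | h3 <;>
  · simp only [h1, h2, h3, one_smul, neg_smul, mul_one, mul_neg, neg_neg, sub_mul, mul_sub,
      mul_assoc, neg_mul]
    abel

/-- A derivation whose square vanishes on the generators is a differential. -/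
theorem isDGLA_deriv [Fintype G] {δ : G → NCSeries G} (hδ : ∀ g, δ g ∈ piece deg (deg g - 1))
    (h : ∀ g, derivExt deg δ (δ g) = 0) : IsDGLA (grade deg) (lie deg) (deriv hδ) where
  isInternal := isInternal_grade deg
  br_mem _ _ _ _ hx hy := bracket_mem_piece deg hx hy
  d_mem := (isGradedDerivation_deriv hδ).mem
  d_d x := Subtype.ext (derivExt_derivExt_eq_zero (S := Set.univ) (fun g => piece_mem_ord (hδ g))
    (fun g => (hδ g).2) (fun g _ => h g) (total_le_lieSeries x.2))
  br_symm _ _ _ _ hx hy := Subtype.ext (bracket_symm hx.2 hy.2)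
  jacobi _ _ _ _ _ _ hx hy hz := Subtype.ext (bracket_jacobi hx.2 hy.2 hz.2)
  leibniz := (isGradedDerivation_deriv hδ).leibniz

end FreeGLA

/-! ### Adjoint operators and averages of Lie series -/

namespace NCSeries

variable {G : Type} {deg : G → ℤ}

theorem half_bracket_self {p : NCSeries G} (hp : p ∈ homDeg deg (-1)) :
    (1 / 2 : ℚ) • bracket deg p p = p * p := by
  rw [bracket_neg_one hp, sgn_neg_one hp, neg_mul, sub_neg_eq_add, ← two_smul ℚ, smul_smul]
  norm_num

theorem bracket_neg_eq (x : NCSeries G) :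
    (-bracket deg x : NCSeries G → NCSeries G) = bracket deg (-x) := by
  rw [← coe_adOp, ← coe_adOp, adOp_neg]
  rfl

theorem evalOp_bracket (x y : NCSeries G) (Q : NCSeries (Fin 2)) (p : NCSeries G) :
    evalOp ![bracket deg x, bracket deg y] Q p = evalLin ![adOp deg x, adOp deg y] Q p := by
  rw [evalLin_apply]
  congr 1
  funext i
  fin_cases i <;> rfl

theorem contracting_adOp_pair {x y : NCSeries G} (hx : x ∈ ord G 1) (hy : y ∈ ord G 1)
    (i : Fin 2) : Contracting ((![adOp deg x, adOp deg y] : Fin 2 → Module.End ℚ (NCSeries G)) i) := by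
  fin_cases i
  exacts [contracting_adOp hx, contracting_adOp hy]

theorem evalLin_adOp_mem_lieSeries {S : Set G} {x y p : NCSeries G} (hx : x ∈ lieSeries deg S)
    (hy : y ∈ lieSeries deg S) (Q : NCSeries (Fin 2)) (hp : p ∈ lieSeries deg S) :
    evalLin ![adOp deg x, adOp deg y] Q p ∈ lieSeries deg S := by
  refine evalLin_mem (fun _ => seriesSum_mem_lieSeries) (fun i q hq => ?_) Q hp
  fin_cases i
  exacts [bracket_mem_lieSeries deg hx hq, bracket_mem_lieSeries deg hy hq]

theorem evalLin_adOp_mem_homDeg {d : ℤ} {x y p : NCSeries G} (hx : x ∈ homDeg deg 0)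
    (hy : y ∈ homDeg deg 0) (Q : NCSeries (Fin 2)) (hp : p ∈ homDeg deg d) :
    evalLin ![adOp deg x, adOp deg y] Q p ∈ homDeg deg d := by
  refine evalLin_mem (fun _ => seriesSum_mem_homDeg) (fun i q hq => ?_) Q hp
  fin_cases i
  · have := bracket_mem_homDeg hx hq
    rwa [zero_add] at this
  · have := bracket_mem_homDeg hy hq
    rwa [zero_add] at this

theorem average₂_mem_lieSeries {S : Set G} {x y : NCSeries G} (hx : x ∈ lieSeries deg S)
    (hy : y ∈ lieSeries deg S) (hdx : x ∈ homDeg deg 0) (hdy : y ∈ homDeg deg 0) :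
    average₂ x y ∈ lieSeries deg S :=
  bch_mem_lieSeries hx (Submodule.smul_mem _ _ (bch_mem_lieSeries (Submodule.neg_mem _ hx) hy
    (Submodule.neg_mem _ hdx) hdy)) hdx
    (Submodule.smul_mem _ _ (bch_mem_homDeg (Submodule.neg_mem _ hdx) hdy))

theorem average₂_mem_homDeg {x y : NCSeries G} (hdx : x ∈ homDeg deg 0) (hdy : y ∈ homDeg deg 0) :
    average₂ x y ∈ homDeg deg 0 :=
  bch_mem_homDeg hdx (Submodule.smul_mem _ _ (bch_mem_homDeg (Submodule.neg_mem _ hdx) hdy))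

end NCSeries

/-! ### The cells of the banana and the boundary formulas -/

namespace Banana

variable {n : ℕ}

noncomputable instance [NeZero n] : Fintype (BananaCell n) := by
  classical
  exact Fintype.ofSurjective (fun x : (Bool ⊕ Unit) ⊕ (ZMod n ⊕ ZMod n) => match x with
    | .inl (.inl true) => BananaCell.a
    | .inl (.inl false) => .b
    | .inl (.inr _) => .h
    | .inr (.inl i) => .e i
    | .inr (.inr i) => .f i) fun c => by
      cases c with
      | a => exact ⟨.inl (.inl true), rfl⟩
      | b => exact ⟨.inl (.inl false), rfl⟩
      | h => exact ⟨.inl (.inr ()), rfl⟩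
      | e i => exact ⟨.inr (.inl i), rfl⟩
      | f i => exact ⟨.inr (.inr i), rfl⟩

/-- The degrees of the generators. -/
abbrev deg : BananaCell n → ℤ := cellDeg dim

theorem a_mem_homDeg : of (.a : BananaCell n) ∈ homDeg deg (-1) := of_mem_homDeg _

theorem b_mem_homDeg : of (.b : BananaCell n) ∈ homDeg deg (-1) := of_mem_homDeg _

theorem e_mem_homDeg (i : ZMod n) : of (.e i : BananaCell n) ∈ homDeg deg 0 := of_mem_homDeg _

theorem f_mem_homDeg (i : ZMod n) : of (.f i : BananaCell n) ∈ homDeg deg 1 := of_mem_homDeg _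

theorem h_mem_homDeg : of (.h : BananaCell n) ∈ homDeg deg 2 := of_mem_homDeg _

/-- The vertices and the edges with index in `I`. -/
def star (I : Set (ZMod n)) : Set (BananaCell n) := {.a, .b} ∪ BananaCell.e '' I

theorem a_mem_star (I : Set (ZMod n)) : (.a : BananaCell n) ∈ star I := .inl (.inl rfl)

theorem b_mem_star (I : Set (ZMod n)) : (.b : BananaCell n) ∈ star I := .inl (.inr rfl)

theorem e_mem_star {I : Set (ZMod n)} {i : ZMod n} (hi : i ∈ I) : (.e i : BananaCell n) ∈ star I :=
  .inr ⟨i, hi, rfl⟩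

theorem star_mono {I J : Set (ZMod n)} (h : I ⊆ J) : star I ⊆ star J :=
  Set.union_subset_union_right _ (Set.image_mono h)

/-- The values of the differential on the vertices and the edges. -/
noncomputable def edgeVal : BananaCell n → NCSeries (BananaCell n)
  | .a => -((1 / 2 : ℚ) • bracket deg (of .a) (of .a))
  | .b => -((1 / 2 : ℚ) • bracket deg (of .b) (of .b))
  | .e i => opSeries (fun k => -(bernoulli k / (k.factorial : ℚ))) (E i) (of .a) +
      opSeries (fun k => bernoulli' k / (k.factorial : ℚ)) (E i) (of .b)
  | _ => 0

theorem edgeVal_a : edgeVal (.a : BananaCell n) = -(of .a * of .a) := by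
  rw [edgeVal, half_bracket_self a_mem_homDeg]

theorem edgeVal_b : edgeVal (.b : BananaCell n) = -(of .b * of .b) := by
  rw [edgeVal, half_bracket_self b_mem_homDeg]

theorem edgeVal_e (i : ZMod n) : edgeVal (.e i) =
    -opEval (adOp deg (of (.e i))) (bernoulliPowerSeries ℚ) (of .a) +
      opEval (adOp deg (of (.e i))) (bernoulli'PowerSeries ℚ) (of .b) := by
  have h1 : -opEval (adOp deg (of (.e i))) (bernoulliPowerSeries ℚ) (of (.a : BananaCell n)) =
      opEval (adOp deg (of (.e i))) (-bernoulliPowerSeries ℚ) (of .a) := by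
    rw [opEval_neg]; rfl
  rw [h1, edgeVal]
  congr 1
  · change _ = opSeries _ _ _
    congr 1
    funext k
    rw [map_neg, bernoulliPowerSeries, PowerSeries.coeff_mk]
    rfl
  · change _ = opSeries _ _ _
    congr 1
    funext k
    rw [bernoulli'PowerSeries, PowerSeries.coeff_mk]
    rfl

theorem edgeVal_mem_lieSeries (I : Set (ZMod n)) {g : BananaCell n} (hg : g ∈ star I) :
    edgeVal g ∈ lieSeries deg (star I) := by
  have ha := of_mem_lieSeries (deg := deg) (a_mem_star I)
  have hb := of_mem_lieSeries (deg := deg) (b_mem_star I)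
  cases g with
  | a => exact Submodule.neg_mem _ (Submodule.smul_mem _ _ (bracket_mem_lieSeries _ ha ha))
  | b => exact Submodule.neg_mem _ (Submodule.smul_mem _ _ (bracket_mem_lieSeries _ hb hb))
  | e i =>
    have he := of_mem_lieSeries (deg := deg) hg
    rw [edgeVal_e]
    exact Submodule.add_mem _ (Submodule.neg_mem _ (opEval_adOp_mem_lieSeries he ha _))
      (opEval_adOp_mem_lieSeries he hb _)
  | f i => exact Submodule.zero_mem _
  | h => exact Submodule.zero_mem _

theorem edgeVal_mem_homDeg (g : BananaCell n) : edgeVal g ∈ homDeg deg (deg g - 1) := by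
  cases g with
  | a => exact Submodule.neg_mem _ (Submodule.smul_mem _ _
      (bracket_mem_homDeg a_mem_homDeg a_mem_homDeg))
  | b => exact Submodule.neg_mem _ (Submodule.smul_mem _ _
      (bracket_mem_homDeg b_mem_homDeg b_mem_homDeg))
  | e i =>
    rw [edgeVal_e]
    exact Submodule.add_mem _ (Submodule.neg_mem _
      (opEval_adOp_mem_homDeg (e_mem_homDeg i) a_mem_homDeg _))
      (opEval_adOp_mem_homDeg (e_mem_homDeg i) b_mem_homDeg _)
  | f i => exact Submodule.zero_mem _
  | h => exact Submodule.zero_mem _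

theorem edgeVal_mem_piece (g : BananaCell n) : edgeVal g ∈ piece deg (deg g - 1) := by
  refine mem_piece.2 ⟨?_, edgeVal_mem_homDeg g⟩
  by_cases hg : g ∈ star Set.univ
  · exact lieSeries_mono (Set.subset_univ _) (edgeVal_mem_lieSeries _ hg)
  · cases g with
    | a => exact absurd (a_mem_star _) hg
    | b => exact absurd (b_mem_star _) hg
    | e i => exact absurd (e_mem_star (Set.mem_univ i)) hg
    | f i => exact Submodule.zero_mem _
    | h => exact Submodule.zero_mem _

/-! ### Loops -/

/-- The loop which runs along `e j` and back along `e k`. -/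
noncomputable def loop (j k : ZMod n) : NCSeries (BananaCell n) := bch (of (.e j)) (-of (.e k))

theorem loop_mem_ord (j k : ZMod n) : loop j k ∈ ord (BananaCell n) 1 :=
  bch_mem_ord (of_mem_ord _) (Submodule.neg_mem _ (of_mem_ord _))

theorem loop_mem_homDeg (j k : ZMod n) : loop j k ∈ homDeg deg 0 :=
  bch_mem_homDeg (e_mem_homDeg j) (Submodule.neg_mem _ (e_mem_homDeg k))

theorem loop_mem_lieSeries {S : Set (BananaCell n)} {j k : ZMod n} (hj : .e j ∈ S) (hk : .e k ∈ S) :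
    loop j k ∈ lieSeries deg S :=
  bch_mem_lieSeries (of_mem_lieSeries hj) (Submodule.neg_mem _ (of_mem_lieSeries hk))
    (e_mem_homDeg j) (Submodule.neg_mem _ (e_mem_homDeg k))

theorem loop_self (j : ZMod n) : loop j j = 0 := bch_neg_self (of_mem_ord _)

theorem neg_loop (j k : ZMod n) : -loop j k = loop k j := by
  rw [loop, neg_bch (of_mem_ord _) (Submodule.neg_mem _ (of_mem_ord _)), neg_neg, loop]

/-- The inner factor `e^{-e_j} e^{e_j}` cancels. This composition law supplies the arguments at
which the identity for `Q` is used. -/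
theorem bch_loop (i j k : ZMod n) : bch (loop i j) (loop j k) = loop i k := by
  have h (i : ZMod n) : of (.e i : BananaCell n) ∈ ord _ 1 := of_mem_ord _
  have h' (i : ZMod n) : -of (.e i : BananaCell n) ∈ ord _ 1 := Submodule.neg_mem _ (h i)
  refine exp_injOn (bch_mem_ord (loop_mem_ord _ _) (loop_mem_ord _ _)) (loop_mem_ord _ _) ?_
  rw [exp_bch (loop_mem_ord _ _) (loop_mem_ord _ _), loop, loop, loop, exp_bch (h _) (h' _),
    exp_bch (h _) (h' _), exp_bch (h _) (h' _)]
  calc _ = exp (of (.e i)) * (exp (-of (.e j)) * exp (of (.e j))) * exp (-of (.e k)) := by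
        noncomm_ring
    _ = _ := by rw [exp_neg_mul_exp (h j), mul_one]

/-- The BCH series of operators in the statement are adjoint actions of loops at `a`. -/
theorem bchOp_E (j k : ZMod n) : bchOp (E j) (-E k) = bracket deg (loop j k) := by
  rw [E, E, ad, ad, bracket_neg_eq, bchOp_bracket (of_mem_ord _) (Submodule.neg_mem _ (of_mem_ord _))
    (e_mem_homDeg j) (Submodule.neg_mem _ (e_mem_homDeg k)), loop]

theorem faceAxis_mem_lieSeries {S : Set (BananaCell n)} {i : ZMod n} (hi : .e i ∈ S)
    (hi' : .e (i + 1) ∈ S) : faceAxis i ∈ lieSeries deg S :=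
  average₂_mem_lieSeries (of_mem_lieSeries hi) (of_mem_lieSeries hi') (e_mem_homDeg _)
    (e_mem_homDeg _)

theorem faceAxis_mem_homDeg (i : ZMod n) : faceAxis i ∈ homDeg deg 0 :=
  average₂_mem_homDeg (e_mem_homDeg _) (e_mem_homDeg _)

theorem half_faceAxis_mem_ord (i : ZMod n) : (1 / 2 : ℚ) • faceAxis i ∈ ord (BananaCell n) 1 :=
  Submodule.smul_mem _ _ (average₂_mem_ord (of_mem_ord _) (of_mem_ord _))

theorem half_faceAxis_mem_homDeg (i : ZMod n) : (1 / 2 : ℚ) • faceAxis i ∈ homDeg deg 0 :=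
  Submodule.smul_mem _ _ (faceAxis_mem_homDeg i)

theorem half_faceAxis_mem_lieSeries {S : Set (BananaCell n)} {i : ZMod n} (hi : .e i ∈ S)
    (hi' : .e (i + 1) ∈ S) : (1 / 2 : ℚ) • faceAxis i ∈ lieSeries deg S :=
  Submodule.smul_mem _ _ (faceAxis_mem_lieSeries hi hi')

theorem twistedFace_mem_lieSeries {S : Set (BananaCell n)} {i : ZMod n} (hi : .e i ∈ S)
    (hi' : .e (i + 1) ∈ S) (hf : .f i ∈ S) : twistedFace i ∈ lieSeries deg S :=
  expOp_bracket_mem_lieSeries (half_faceAxis_mem_lieSeries hi hi') (of_mem_lieSeries hf)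

theorem twistedFace_mem_homDeg (i : ZMod n) : twistedFace i ∈ homDeg deg 1 :=
  expOp_bracket_mem_homDeg (half_faceAxis_mem_homDeg i) (f_mem_homDeg i)

/-- The loop around `f i`, based at the centre of `f i`. -/
noncomputable def faceLoop (i : ZMod n) : NCSeries (BananaCell n) :=
  bch (bch (bch (-((1 / 2 : ℚ) • faceAxis i)) (of (.e i))) (-of (.e (i + 1))))
    ((1 / 2 : ℚ) • faceAxis i)

/-- The path from the centre to `a`, around the bigon and back is conjugation by half the
centreline. -/
theorem faceLoop_eq (i : ZMod n) :
    faceLoop i = expOp (ad (-((1 / 2 : ℚ) • faceAxis i))) (loop i (i + 1)) := by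
  rw [faceLoop, bch_assoc (Submodule.neg_mem _ (half_faceAxis_mem_ord i)) (of_mem_ord _)
    (Submodule.neg_mem _ (of_mem_ord _)), ← loop,
    bch_conj (half_faceAxis_mem_ord i) (loop_mem_ord _ _) (half_faceAxis_mem_homDeg i)]

theorem faceLoop_mem_lieSeries {S : Set (BananaCell n)} {i : ZMod n} (hi : .e i ∈ S)
    (hi' : .e (i + 1) ∈ S) : faceLoop i ∈ lieSeries deg S := by
  rw [faceLoop_eq]
  exact expOp_bracket_mem_lieSeries (Submodule.neg_mem _ (half_faceAxis_mem_lieSeries hi hi'))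
    (loop_mem_lieSeries hi hi')

theorem faceLoop_mem_homDeg (i : ZMod n) : faceLoop i ∈ homDeg deg 0 := by
  rw [faceLoop_eq]
  exact expOp_bracket_mem_homDeg (Submodule.neg_mem _ (half_faceAxis_mem_homDeg i))
    (loop_mem_homDeg _ _)

section Solid

variable (Q : NCSeries (Fin 2))

/-- The contribution of the face `f i` and the edge `e j` to the boundary of the solid cell. -/
noncomputable def correction (i j : ZMod n) : NCSeries (BananaCell n) :=
  evalOp ![bchOp (E j) (-E i), bchOp (E i) (-E (i + 1))] Q (twistedFace i) +
    evalOp ![bchOp (E j) (-E (i + 1)), bchOp (E (i + 1)) (-E i)] Q (twistedFace i)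

theorem correction_eq (i j : ZMod n) : correction Q i j =
    evalLin ![adOp deg (loop j i), adOp deg (loop i (i + 1))] Q (twistedFace i) +
      evalLin ![adOp deg (loop j (i + 1)), adOp deg (loop (i + 1) i)] Q (twistedFace i) := by
  simp only [correction, bchOp_E, evalOp_bracket]

theorem correction_mem_lieSeries {S : Set (BananaCell n)} (hS : ∀ i, .e i ∈ S)
    (hS' : ∀ i, .f i ∈ S) (i j : ZMod n) : correction Q i j ∈ lieSeries deg S := by
  rw [correction_eq]
  have hf := twistedFace_mem_lieSeries (hS i) (hS (i + 1)) (hS' i)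
  exact Submodule.add_mem _
    (evalLin_adOp_mem_lieSeries (loop_mem_lieSeries (hS _) (hS _))
      (loop_mem_lieSeries (hS _) (hS _)) Q hf)
    (evalLin_adOp_mem_lieSeries (loop_mem_lieSeries (hS _) (hS _))
      (loop_mem_lieSeries (hS _) (hS _)) Q hf)

theorem correction_mem_homDeg (i j : ZMod n) : correction Q i j ∈ homDeg deg 1 := by
  rw [correction_eq]
  have hf := twistedFace_mem_homDeg i
  exact Submodule.add_mem _
    (evalLin_adOp_mem_homDeg (loop_mem_homDeg _ _) (loop_mem_homDeg _ _) Q hf)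
    (evalLin_adOp_mem_homDeg (loop_mem_homDeg _ _) (loop_mem_homDeg _ _) Q hf)

variable [NeZero n]

variable (n) in
/-- The boundary of the solid cell, localised at the vertex `a`. -/
noncomputable def solidBoundary : NCSeries (BananaCell n) :=
  ∑ i : ZMod n, twistedFace i +
    (1 / (2 * (n : ℚ))) • ∑ i : ZMod n, ∑ j : ZMod n with j ≠ i ∧ j ≠ i + 1, correction Q i j

theorem solidBoundary_mem_lieSeries {S : Set (BananaCell n)} (hS : ∀ i, .e i ∈ S)
    (hS' : ∀ i, .f i ∈ S) : solidBoundary n Q ∈ lieSeries deg S :=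
  Submodule.add_mem _
    (Submodule.sum_mem _ fun _ _ => twistedFace_mem_lieSeries (hS _) (hS _) (hS' _))
    (Submodule.smul_mem _ _ (Submodule.sum_mem _ fun i _ => Submodule.sum_mem _ fun j _ =>
      correction_mem_lieSeries Q hS hS' i j))

theorem solidBoundary_mem_homDeg : solidBoundary n Q ∈ homDeg deg 1 :=
  Submodule.add_mem _ (Submodule.sum_mem _ fun i _ => twistedFace_mem_homDeg i)
    (Submodule.smul_mem _ _ (Submodule.sum_mem _ fun i _ => Submodule.sum_mem _ fun j _ =>
      correction_mem_homDeg Q i j))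

theorem axis_eq (μ : NCSeries (ZMod n)) : axis μ = substLin (fun i => of (.e i)) μ := rfl

theorem axis_mem_homDeg (μ : NCSeries (ZMod n)) : axis μ ∈ homDeg deg 0 :=
  substLin_mem_homDeg (fun i => e_mem_homDeg i) μ

theorem axis_mem_lieSeries {S : Set (BananaCell n)} (hS : ∀ i, .e i ∈ S) {μ : NCSeries (ZMod n)}
    (hμ : μ ∈ lieSeries (fun _ => (0 : ℤ)) Set.univ) : axis μ ∈ lieSeries deg S :=
  substLin_mem_lieSeries (fun i => of_mem_lieSeries (hS i)) (fun i => e_mem_homDeg i) hμ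

end Solid

end Banana

/-! ### The square of the differential, from edges to the solid cell -/

namespace Banana

variable {n : ℕ}

/-- The values of a derivation of degree `-1` which has the required values on the vertices and
the edges. -/
structure ExtendsEdges (δ : BananaCell n → NCSeries (BananaCell n)) : Prop where
  piece : ∀ g, δ g ∈ piece deg (deg g - 1)
  edge : ∀ g ∈ star Set.univ, δ g = edgeVal g

theorem extendsEdges_edgeVal : ExtendsEdges (edgeVal (n := n)) := ⟨edgeVal_mem_piece, fun _ _ => rfl⟩

namespace ExtendsEdges

variable {δ : BananaCell n → NCSeries (BananaCell n)}

theorem mem_ord (hδ : ExtendsEdges δ) (g : BananaCell n) : δ g ∈ ord _ 1 := piece_mem_ord (hδ.piece g)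

theorem mem_homDeg (hδ : ExtendsEdges δ) (g : BananaCell n) : δ g ∈ homDeg deg (deg g - 1) :=
  (hδ.piece g).2

variable [NeZero n]

theorem derivExt_eq (hδ : ExtendsEdges δ) {p : NCSeries (BananaCell n)}
    (hp : p ∈ lieSeries deg (star Set.univ)) : derivExt deg δ p = derivExt deg edgeVal p :=
  derivExt_congr hδ.mem_ord hδ.mem_homDeg extendsEdges_edgeVal.mem_ord
    extendsEdges_edgeVal.mem_homDeg hδ.edge hp

theorem flowEnd_eq (hδ : ExtendsEdges δ) {e : NCSeries (BananaCell n)}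
    (he : e ∈ lieSeries deg (star Set.univ)) (a : NCSeries (BananaCell n)) :
    flowEnd deg δ e a = flowEnd deg edgeVal e a := by
  rw [flowEnd, flowEnd, hδ.derivExt_eq he]

theorem derivExt_a (hδ : ExtendsEdges δ) : derivExt deg δ (of .a) = -(of .a * of .a) := by
  rw [derivExt_of, hδ.edge _ (a_mem_star _), edgeVal_a]

theorem derivExt_b (hδ : ExtendsEdges δ) : derivExt deg δ (of .b) = -(of .b * of .b) := by
  rw [derivExt_of, hδ.edge _ (b_mem_star _), edgeVal_b]

/-- Applying `(1 - e^{-E}) / E` to `∂e` gives `-e^{-E} a + b`; the first term cancels `e^{-E} a` in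
the flow and leaves `b`. -/
theorem flowsTo_e (hδ : ExtendsEdges δ) (i : ZMod n) :
    FlowsTo deg δ (of .a) (of (.e i)) (of .b) := by
  have hc : Contracting (adOp deg (of (.e i : BananaCell n))) := contracting_adOp (of_mem_ord _)
  rw [flowsTo_iff_flowEnd hδ.mem_ord (of_mem_ord _) (e_mem_homDeg i), flowEnd, derivExt_of,
    hδ.edge _ (e_mem_star (Set.mem_univ i)), edgeVal_e, map_add, map_neg, ← Module.End.mul_apply,
    ← Module.End.mul_apply, ← opEval_mul hc, ← opEval_mul hc, PowerSeries.expQuot_mul_bernoulli,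
    PowerSeries.expQuot_mul_bernoulli', opEval_evalNegHom, opEval_one, expOp_bracket_eq, adOp_neg,
    Module.End.one_apply, add_neg_cancel_left]

/-- On a vertex `∂²` vanishes by the Maurer-Cartan equation, on an edge because it flows between two
points. -/
theorem derivExt_derivExt (hδ : ExtendsEdges δ) {p : NCSeries (BananaCell n)}
    (hp : p ∈ lieSeries deg (star Set.univ)) : derivExt deg δ (derivExt deg δ p) = 0 := by
  have hsq {p : NCSeries (BananaCell n)} (hd : p ∈ homDeg deg (-1))
      (h : derivExt deg δ p = -(p * p)) : derivExt deg δ (derivExt deg δ p) = 0 := by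
    rw [h, map_neg, derivExt_mul, sgn_neg_one hd, h]
    noncomm_ring
  refine derivExt_derivExt_eq_zero hδ.mem_ord hδ.mem_homDeg (fun g hg => ?_) hp
  rw [← derivExt_of (deg := deg) (δ := δ) g]
  obtain (rfl | rfl) | ⟨i, -, rfl⟩ := hg
  · exact hsq a_mem_homDeg hδ.derivExt_a
  · exact hsq b_mem_homDeg hδ.derivExt_b
  · exact (hδ.flowsTo_e i).derivExt_derivExt hδ.mem_ord hδ.mem_homDeg (of_mem_ord _)
      (e_mem_homDeg i) a_mem_homDeg hδ.derivExt_a hδ.derivExt_b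

theorem flowEnd_point (hδ : ExtendsEdges δ) {e : NCSeries (BananaCell n)}
    (he : e ∈ lieSeries deg (star Set.univ)) (hd : e ∈ homDeg deg 0) :
    derivExt deg δ (flowEnd deg δ e (of .a)) =
      -(flowEnd deg δ e (of .a) * flowEnd deg δ e (of .a)) :=
  (flowsTo_flowEnd _ hδ.mem_ord (lieSeries_mem_ord he) hd).point (lieSeries_mem_ord he) hd
    a_mem_homDeg (derivExt_derivExt_exp hδ.mem_ord hδ.mem_homDeg (lieSeries_mem_ord he)
      (hδ.derivExt_derivExt he)) hδ.derivExt_a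

theorem flowEnd_mem_homDeg (hδ : ExtendsEdges δ) {e : NCSeries (BananaCell n)}
    (hd : e ∈ homDeg deg 0) : flowEnd deg δ e (of .a) ∈ homDeg deg (-1) :=
  NCSeries.flowEnd_mem_homDeg hδ.mem_homDeg hd a_mem_homDeg

theorem flowEnd_mem_lieSeries (hδ : ExtendsEdges δ) {I : Set (ZMod n)}
    {e : NCSeries (BananaCell n)} (he : e ∈ lieSeries deg (star I)) :
    flowEnd deg δ e (of .a) ∈ lieSeries deg (star I) := by
  refine NCSeries.flowEnd_mem_lieSeries he (of_mem_lieSeries (a_mem_star I)) ?_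
  refine derivExt_mem_lieSeries subset_rfl hδ.mem_ord hδ.mem_homDeg (fun g hg => ?_) he
  rw [hδ.edge g (star_mono (Set.subset_univ _) hg)]
  exact edgeVal_mem_lieSeries I hg

/-- Along `e_j` from `a` to `b` and back along `e_k` is a flow from `a` to itself, so its generator
is `∂_a`-closed. -/
theorem twist_loop (hδ : ExtendsEdges δ) (j k : ZMod n) : twist deg δ (of .a) (loop j k) = 0 := by
  rw [← flowsTo_self_iff hδ.mem_ord (loop_mem_ord j k) (loop_mem_homDeg j k)]
  exact (hδ.flowsTo_e j).trans (of_mem_ord _) (Submodule.neg_mem _ (of_mem_ord _)) (e_mem_homDeg j)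
    ((hδ.flowsTo_e k).symm (of_mem_ord _) (e_mem_homDeg k))

/-- The square of the differential on a cell, computed at a point. -/
theorem derivExt_derivExt_of_twist (hδ : ExtendsEdges δ) {e g r : NCSeries (BananaCell n)}
    (he : e ∈ lieSeries deg (star Set.univ)) (hd : e ∈ homDeg deg 0)
    (hg : twist deg δ (flowEnd deg δ e (of .a)) g = expOp (ad (-e)) r)
    (hr : twist deg δ (of .a) r = 0) : derivExt deg δ (derivExt deg δ g) = 0 := by
  have he1 := lieSeries_mem_ord he
  -- At the endpoint `x` of the flow `∂²` equals `∂_x²`. Here `∂_x g` is `r` conjugated by `e^e`,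
  -- and the conjugation carries `∂_a r = 0` to `x`.
  rw [← twist_twist hδ.mem_homDeg (hδ.flowEnd_mem_homDeg hd) (hδ.flowEnd_point he hd), hg, ad,
    expOp_bracket (Submodule.neg_mem _ he1) (Submodule.neg_mem _ hd), neg_neg,
    (flowsTo_flowEnd _ hδ.mem_ord he1 hd).twist_conj he1 hd, hr, mul_zero, zero_mul]

end ExtendsEdges

theorem half_faceAxis_mem_star (i : ZMod n) :
    (1 / 2 : ℚ) • faceAxis i ∈ lieSeries deg (star Set.univ) :=
  half_faceAxis_mem_lieSeries (e_mem_star (Set.mem_univ _)) (e_mem_star (Set.mem_univ _))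

variable [NeZero n]

/-- The values of a derivation of degree `-1` which has the required values on the vertices, the
edges and the bigons. -/
structure ExtendsFaces (δ : BananaCell n → NCSeries (BananaCell n)) : Prop extends
    ExtendsEdges δ where
  face : ∀ i, δ (.f i) = faceLoop i -
    bracket deg (flowEnd deg edgeVal ((1 / 2 : ℚ) • faceAxis i) (of .a)) (of (.f i))

namespace ExtendsFaces

variable {δ : BananaCell n → NCSeries (BananaCell n)}

theorem twist_f (hδ : ExtendsFaces δ) (i : ZMod n) :
    twist deg δ (flowEnd deg δ ((1 / 2 : ℚ) • faceAxis i) (of .a)) (of (.f i)) = faceLoop i := by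
  rw [twist_eq (hδ.flowEnd_mem_homDeg (half_faceAxis_mem_homDeg i)), derivExt_of, hδ.face,
    hδ.flowEnd_eq (half_faceAxis_mem_star i), sub_add_cancel]

/-- Transport of `∂_{x_i} f_i = faceLoop i` back to `a`: the conjugation that defines `f'_i` is
inverse to the one that carries the loop to the centre. -/
theorem twist_twistedFace (hδ : ExtendsFaces δ) (i : ZMod n) :
    twist deg δ (of .a) (twistedFace i) = loop i (i + 1) := by
  have h1 := half_faceAxis_mem_ord i
  have hd := half_faceAxis_mem_homDeg i
  have hneg : -((1 / 2 : ℚ) • faceAxis i) ∈ homDeg deg 0 := Submodule.neg_mem _ hd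
  have h := (flowsTo_flowEnd (of .a) hδ.mem_ord h1 hd).twist_conj h1 hd (twistedFace i)
  have hf : exp (-((1 / 2 : ℚ) • faceAxis i)) * twistedFace i * exp ((1 / 2 : ℚ) • faceAxis i) =
      of (.f i) := by
    rw [twistedFace, ad, expOp_bracket h1 hd]
    calc _ = (exp (-((1 / 2 : ℚ) • faceAxis i)) * exp ((1 / 2 : ℚ) • faceAxis i)) * of (.f i) *
          (exp (-((1 / 2 : ℚ) • faceAxis i)) * exp ((1 / 2 : ℚ) • faceAxis i)) := by noncomm_ring
      _ = _ := by rw [exp_neg_mul_exp h1, one_mul, mul_one]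
  have hc (z r : NCSeries (BananaCell n)) (hz : z ∈ ord _ 1) :
      exp z * (exp (-z) * r * exp z) * exp (-z) = r := by
    calc _ = (exp z * exp (-z)) * r * (exp z * exp (-z)) := by noncomm_ring
      _ = _ := by rw [exp_mul_exp_neg hz, one_mul, mul_one]
  rw [hf, hδ.twist_f, faceLoop_eq, ad, expOp_bracket (Submodule.neg_mem _ h1) hneg, neg_neg] at h
  rw [← hc _ (twist deg δ (of .a) (twistedFace i)) h1, ← h, hc _ _ h1]

theorem derivExt_derivExt_f (hδ : ExtendsFaces δ) (i : ZMod n) :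
    derivExt deg δ (derivExt deg δ (of (.f i))) = 0 :=
  hδ.derivExt_derivExt_of_twist (half_faceAxis_mem_star i) (half_faceAxis_mem_homDeg i)
    ((hδ.twist_f i).trans (faceLoop_eq i)) (hδ.twist_loop i (i + 1))

/-- The loops have degree 0 and are `∂_a`-closed, so `∂_a` commutes with their adjoint operators and
with any series in them. -/
theorem twist_evalLin_loop (hδ : ExtendsFaces δ) (Q : NCSeries (Fin 2)) (i j k l : ZMod n)
    (p : NCSeries (BananaCell n)) :
    twist deg δ (of .a) (evalLin ![adOp deg (loop i j), adOp deg (loop k l)] Q p) =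
      evalLin ![adOp deg (loop i j), adOp deg (loop k l)] Q (twist deg δ (of .a) p) := by
  refine map_evalLin (filtered_twist hδ.mem_ord _)
    (contracting_adOp_pair (loop_mem_ord _ _) (loop_mem_ord _ _)) (fun m q => ?_) Q p
  fin_cases m
  · exact twist_bracket (loop_mem_homDeg i j) (hδ.twist_loop i j) q
  · exact twist_bracket (loop_mem_homDeg k l) (hδ.twist_loop k l) q

/-- `∂_a` replaces `f'_i` by `ℓ_{i,i+1}`, and the identity for `Q` with `BCH(ℓ_{ji}, ℓ_{i,i+1}) =
ℓ_{j,i+1}` evaluates the first term. In the second term `ℓ_{i,i+1} = -ℓ_{i+1,i}`, and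
`BCH(ℓ_{j,i+1}, ℓ_{i+1,i}) = ℓ_{ji}` yields the same value. -/
theorem twist_correction (hδ : ExtendsFaces δ) {Q : NCSeries (Fin 2)} (hQ : IsBCHRemainder Q)
    (i j : ZMod n) : twist deg δ (of .a) (correction Q i j) =
      (2 : ℚ) • (loop j (i + 1) - loop j i - loop i (i + 1)) := by
  have key (i j k : ZMod n) : evalLin ![adOp deg (loop j i), adOp deg (loop i k)] Q (loop i k) =
      loop j k - loop j i - loop i k := by
    rw [← evalOp_bracket, ← bch_loop j i k, hQ.bch_eq (loop_mem_ord _ _) (loop_mem_ord _ _)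
      (loop_mem_homDeg j i) (loop_mem_homDeg i k)]
    abel
  rw [correction_eq, map_add, hδ.twist_evalLin_loop, hδ.twist_evalLin_loop, hδ.twist_twistedFace,
    key, ← neg_loop (i + 1) i, map_neg, key, ← neg_loop i (i + 1), two_smul]
  abel

/-- For fixed `j` the sums over `i` of `ℓ_{j,i+1}` and `ℓ_{ji}` agree by a cyclic shift. The
corrections thus contribute `-2` times the total face loop for each of the `n` values of `j`, and
`1/(2n)` makes this cancel the boundary of `∑ f'_i`. -/
theorem twist_solidBoundary (hδ : ExtendsFaces δ) {Q : NCSeries (Fin 2)} (hQ : IsBCHRemainder Q) :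
    twist deg δ (of .a) (solidBoundary n Q) = 0 := by
  have hn : (n : ℚ) ≠ 0 := Nat.cast_ne_zero.2 (NeZero.ne n)
  have h1 (i : ZMod n) : ∑ j : ZMod n with j ≠ i ∧ j ≠ i + 1,
      twist deg δ (of .a) (correction Q i j) =
        ∑ j, (2 : ℚ) • (loop j (i + 1) - loop j i - loop i (i + 1)) := by
    simp only [hδ.twist_correction hQ]
    -- For `j = i` and `j = i + 1` the summand `ℓ_{j,i+1} - ℓ_{ji} - ℓ_{i,i+1}` is zero, so `j` may
    -- run over all indices.
    refine Finset.sum_subset (Finset.filter_subset _ _) fun j _ hj => ?_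
    rw [Finset.mem_filter_univ, not_and_or, not_not, not_not] at hj
    rcases hj with rfl | rfl
    · rw [loop_self, sub_zero, sub_self, smul_zero]
    · rw [loop_self, ← neg_loop, zero_sub, neg_neg, sub_self, smul_zero]
  have h2 (j : ZMod n) : ∑ i : ZMod n, loop j (i + 1) = ∑ i, loop j i :=
    Equiv.sum_comp (Equiv.addRight 1) fun i => loop j i
  have h3 : ∑ i : ZMod n, ∑ j : ZMod n, (2 : ℚ) • (loop j (i + 1) - loop j i - loop i (i + 1)) =
      -((2 * n : ℚ) • ∑ i : ZMod n, loop i (i + 1)) := by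
    simp only [← Finset.smul_sum, Finset.sum_sub_distrib]
    rw [Finset.sum_comm, Finset.sum_comm (f := fun i j => loop j i)]
    simp only [h2, sub_self, zero_sub, Finset.sum_const, Finset.card_univ, ZMod.card]
    rw [← Finset.smul_sum, smul_neg, mul_smul, Nat.cast_smul_eq_nsmul]
  rw [solidBoundary, map_add, map_smul, map_sum, map_sum]
  simp only [map_sum, h1, h3, hδ.twist_twistedFace]
  rw [smul_neg, smul_smul, one_div_mul_cancel (mul_ne_zero two_ne_zero hn), one_smul,
    add_neg_cancel]

end ExtendsFaces

variable (Q : NCSeries (Fin 2)) (μ : NCSeries (ZMod n))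

/-- The values of the differential on the cells. -/
noncomputable def cellVal : BananaCell n → NCSeries (BananaCell n)
  | .f i => faceLoop i -
      bracket deg (flowEnd deg edgeVal ((1 / 2 : ℚ) • faceAxis i) (of .a)) (of (.f i))
  | .h => expOp (ad (-((1 / 2 : ℚ) • axis μ))) (solidBoundary n Q) -
      bracket deg (flowEnd deg edgeVal ((1 / 2 : ℚ) • axis μ) (of .a)) (of .h)
  | c => edgeVal c

variable {μ}

theorem half_axis_mem_star (hμ : μ ∈ lieSeries (fun _ => (0 : ℤ)) Set.univ) :
    (1 / 2 : ℚ) • axis μ ∈ lieSeries deg (star Set.univ) :=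
  Submodule.smul_mem _ _ (axis_mem_lieSeries (fun _ => e_mem_star (Set.mem_univ _)) hμ)

theorem half_axis_mem_homDeg : (1 / 2 : ℚ) • axis μ ∈ homDeg deg 0 :=
  Submodule.smul_mem _ _ (axis_mem_homDeg μ)

theorem cellVal_f_mem_lieSeries {i : ZMod n} :
    cellVal Q μ (.f i) ∈ lieSeries deg (insert (.f i) (star {i, i + 1})) := by
  have hi : (.e i : BananaCell n) ∈ star {i, i + 1} := e_mem_star (.inl rfl)
  have hi' : (.e (i + 1) : BananaCell n) ∈ star {i, i + 1} := e_mem_star (.inr rfl)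
  have hS := Set.subset_insert (.f i : BananaCell n) (star {i, i + 1})
  exact Submodule.sub_mem _ (faceLoop_mem_lieSeries (hS hi) (hS hi'))
    (bracket_mem_lieSeries _ (lieSeries_mono hS (extendsEdges_edgeVal.flowEnd_mem_lieSeries
      (half_faceAxis_mem_lieSeries hi hi'))) (of_mem_lieSeries (Set.mem_insert _ _)))

theorem cellVal_mem_lieSeries (hμ : μ ∈ lieSeries (fun _ => (0 : ℤ)) Set.univ)
    (c : BananaCell n) : cellVal Q μ c ∈ lieSeries deg Set.univ := by
  cases c with
  | a => exact (edgeVal_mem_piece .a).1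
  | b => exact (edgeVal_mem_piece .b).1
  | e i => exact (edgeVal_mem_piece (.e i)).1
  | f i => exact lieSeries_mono (Set.subset_univ _) (cellVal_f_mem_lieSeries Q)
  | h =>
    exact Submodule.sub_mem _
      (expOp_bracket_mem_lieSeries (Submodule.neg_mem _ (lieSeries_mono (Set.subset_univ _)
        (half_axis_mem_star hμ)))
        (solidBoundary_mem_lieSeries Q (fun _ => Set.mem_univ _) fun _ => Set.mem_univ _))
      (bracket_mem_lieSeries _ (lieSeries_mono (Set.subset_univ _)
        (extendsEdges_edgeVal.flowEnd_mem_lieSeries (half_axis_mem_star hμ)))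
        (of_mem_lieSeries (Set.mem_univ _)))

theorem cellVal_mem_homDeg (c : BananaCell n) : cellVal Q μ c ∈ homDeg deg (deg c - 1) := by
  cases c with
  | a => exact edgeVal_mem_homDeg .a
  | b => exact edgeVal_mem_homDeg .b
  | e i => exact edgeVal_mem_homDeg (.e i)
  | f i =>
    exact Submodule.sub_mem _ (faceLoop_mem_homDeg i) (bracket_mem_homDeg
      (extendsEdges_edgeVal.flowEnd_mem_homDeg (half_faceAxis_mem_homDeg i)) (f_mem_homDeg i))
  | h =>
    exact Submodule.sub_mem _ (expOp_bracket_mem_homDeg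
      (Submodule.neg_mem _ half_axis_mem_homDeg) (solidBoundary_mem_homDeg Q))
      (bracket_mem_homDeg (extendsEdges_edgeVal.flowEnd_mem_homDeg half_axis_mem_homDeg)
        h_mem_homDeg)

theorem cellVal_mem_piece (hμ : μ ∈ lieSeries (fun _ => (0 : ℤ)) Set.univ) (c : BananaCell n) :
    cellVal Q μ c ∈ piece deg (deg c - 1) :=
  mem_piece.2 ⟨cellVal_mem_lieSeries Q hμ c, cellVal_mem_homDeg Q c⟩

theorem extendsFaces_cellVal (hμ : μ ∈ lieSeries (fun _ => (0 : ℤ)) Set.univ) :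
    ExtendsFaces (cellVal Q μ) where
  piece := cellVal_mem_piece Q hμ
  edge g hg := by obtain (rfl | rfl) | ⟨i, -, rfl⟩ := hg <;> rfl
  face _ := rfl

theorem twist_h (hμ : μ ∈ lieSeries (fun _ => (0 : ℤ)) Set.univ) :
    twist deg (cellVal Q μ) (flowEnd deg (cellVal Q μ) ((1 / 2 : ℚ) • axis μ) (of .a)) (of .h) =
      expOp (ad (-((1 / 2 : ℚ) • axis μ))) (solidBoundary n Q) := by
  have hδ := extendsFaces_cellVal Q hμ
  rw [twist_eq (hδ.flowEnd_mem_homDeg half_axis_mem_homDeg), derivExt_of, cellVal,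
    hδ.flowEnd_eq (half_axis_mem_star hμ), sub_add_cancel]

theorem derivExt_derivExt_cellVal {Q : NCSeries (Fin 2)} (hQ : IsBCHRemainder Q)
    (hμ : μ ∈ lieSeries (fun _ => (0 : ℤ)) Set.univ) (c : BananaCell n) :
    derivExt deg (cellVal Q μ) (cellVal Q μ c) = 0 := by
  have hδ := extendsFaces_cellVal Q hμ
  rw [← derivExt_of (deg := deg) (δ := cellVal Q μ) c]
  cases c with
  | a => exact hδ.derivExt_derivExt (of_mem_lieSeries (a_mem_star _))
  | b => exact hδ.derivExt_derivExt (of_mem_lieSeries (b_mem_star _))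
  | e i => exact hδ.derivExt_derivExt (of_mem_lieSeries (e_mem_star (Set.mem_univ i)))
  | f i => exact hδ.derivExt_derivExt_f i
  | h =>
    exact hδ.derivExt_derivExt_of_twist (half_axis_mem_star hμ) half_axis_mem_homDeg
      (twist_h Q hμ) (hδ.twist_solidBoundary hQ)

end Banana

namespace NCSeries

variable {G : Type} {deg : G → ℤ}

theorem of_apply_singleton_eq_ite [DecidableEq G] (g c : G) :
    of g [c] = if c = g then 1 else 0 := by
  split_ifs with h
  · rw [h, of_apply_singleton]
  · exact of_apply_singleton_ne h

theorem expOp_bracket_sub_mem_ord {x p q : NCSeries G} (hx : x ∈ ord G 1) (hp : p ∈ ord G 1)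
    (h : p - q ∈ ord G 2) : expOp (bracket deg x) p - q ∈ ord G 2 := by
  have h1 := opEval_sub_smul_mem_ord (contracting_adOp (deg := deg) hx) (PowerSeries.exp ℚ) hp
  rw [PowerSeries.constantCoeff_exp, one_smul, ← expOp_bracket_eq] at h1
  simpa using Submodule.add_mem _ h1 h

end NCSeries

/-! ### The explicit formulas determine the differential -/

namespace Banana

variable {n : ℕ}

section Explicit

theorem mem_total_of_mem_star {e : NCSeries (BananaCell n)}
    (he : e ∈ lieSeries deg (star Set.univ)) (hd : e ∈ homDeg deg 0) : e ∈ total deg :=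
  piece_le_total deg 0 (mem_piece.2 ⟨lieSeries_mono (Set.subset_univ _) he, hd⟩)

variable [NeZero n] {D : Alg n →ₗ[ℚ] Alg n}

theorem flow_eq_flowEnd_edgeVal (hD : IsGradedDerivation D)
    (hδ : ExtendsEdges fun c => (D (FreeGLA.gen _ c)).1) {e : NCSeries (BananaCell n)}
    (he : e ∈ lieSeries deg (star Set.univ)) (hd : e ∈ homDeg deg 0) :
    flow D e (of .a) = flowEnd deg edgeVal e (of .a) := by
  rw [flow_eq_flowEnd _ (hD.diffAt_eq (mem_total_of_mem_star he hd)), hδ.flowEnd_eq he]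

theorem faceCentre_eq (hD : IsGradedDerivation D)
    (hδ : ExtendsEdges fun c => (D (FreeGLA.gen _ c)).1) (i : ZMod n) :
    faceCentre D i = flowEnd deg edgeVal ((1 / 2 : ℚ) • faceAxis i) (of .a) :=
  flow_eq_flowEnd_edgeVal hD hδ (half_faceAxis_mem_star i) (half_faceAxis_mem_homDeg i)

theorem centre_eq (hD : IsGradedDerivation D)
    (hδ : ExtendsEdges fun c => (D (FreeGLA.gen _ c)).1) {μ : NCSeries (ZMod n)}
    (hμ : μ ∈ lieSeries (fun _ => (0 : ℤ)) Set.univ) :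
    centre μ D = flowEnd deg edgeVal ((1 / 2 : ℚ) • axis μ) (of .a) :=
  flow_eq_flowEnd_edgeVal hD hδ (half_axis_mem_star hμ) half_axis_mem_homDeg

theorem twistedDiff_of (hD : IsGradedDerivation D) (x : NCSeries (BananaCell n))
    (c : BananaCell n) : twistedDiff D x (of c) = (D (FreeGLA.gen _ c)).1 + bracket deg x (of c) := by
  rw [twistedDiff, hD.diffAt_eq (piece_le_total _ _ (of_mem_piece _ c)), derivExt_of]

variable {Q : NCSeries (Fin 2)} {μ : NCSeries (ZMod n)}

/-- The formulas for `f_i` and `h` mention `D` through the centres, but these are flows along series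
in the edges. They depend only on the values at vertices and edges, so nothing is circular. -/
theorem IsExplicitDifferential.gen_eq (h : IsExplicitDifferential Q μ D)
    (hμ : μ ∈ lieSeries (fun _ => (0 : ℤ)) Set.univ) (c : BananaCell n) :
    (D (FreeGLA.gen _ c)).1 = cellVal Q μ c := by
  have hD := h.derivation
  have hδ : ExtendsEdges fun c => (D (FreeGLA.gen _ c)).1 := by
    refine ⟨hD.mem_piece, fun g hg => ?_⟩
    obtain (rfl | rfl) | ⟨i, -, rfl⟩ := hg
    exacts [h.d_a, h.d_b, h.d_e i]
  cases c with
  | a => exact h.d_a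
  | b => exact h.d_b
  | e i => exact h.d_e i
  | f i => rw [h.d_f, faceCentre_eq hD hδ]; rfl
  | h =>
    -- The formula for `h` is solved for `∂h` by applying `e^{-ad v/2}` to both sides.
    have hx := Submodule.neg_mem _ (lieSeries_mem_ord (half_axis_mem_star hμ))
    have hd := Submodule.neg_mem _ (half_axis_mem_homDeg (μ := μ))
    have h1 := expOp_bracket_neg_cancel hx hd (twistedDiff D (centre μ D) (of .h))
    rw [neg_neg, h.d_h, twistedDiff_of hD, centre_eq hD hδ hμ] at h1
    exact eq_sub_of_add_eq h1.symm

theorem isExplicitDifferential_deriv (hμ : μ ∈ lieSeries (fun _ => (0 : ℤ)) Set.univ) :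
    IsExplicitDifferential Q μ (FreeGLA.deriv (cellVal_mem_piece Q hμ)) := by
  have hD := FreeGLA.isGradedDerivation_deriv (cellVal_mem_piece Q hμ)
  have hg := FreeGLA.coe_deriv_gen (cellVal_mem_piece Q hμ)
  have hδ : ExtendsEdges fun c =>
      (FreeGLA.deriv (cellVal_mem_piece Q hμ) (FreeGLA.gen _ c)).1 := by
    simp only [hg]
    exact (extendsFaces_cellVal Q hμ).toExtendsEdges
  refine ⟨hD, hg _, hg _, fun i => hg _, fun i => ?_, ?_⟩
  · rw [hg, faceCentre_eq hD hδ]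
    rfl
  · rw [twistedDiff_of hD, hg, centre_eq hD hδ hμ, cellVal, sub_add_cancel]
    exact expOp_bracket_neg_cancel (lieSeries_mem_ord (half_axis_mem_star hμ)) half_axis_mem_homDeg _

theorem IsExplicitDifferential.eq_deriv (h : IsExplicitDifferential Q μ D)
    (hμ : μ ∈ lieSeries (fun _ => (0 : ℤ)) Set.univ) :
    D = FreeGLA.deriv (cellVal_mem_piece Q hμ) := by
  refine LinearMap.ext fun x => Subtype.ext ?_
  rw [h.derivation.eq_derivExt, FreeGLA.coe_deriv]
  simp only [h.gen_eq hμ]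

end Explicit

/-! ### The geometric boundary -/

section Geometric

theorem twistedFace_mem_ord (i : ZMod n) : twistedFace i ∈ ord (BananaCell n) 1 :=
  lieSeries_mem_ord (twistedFace_mem_lieSeries (Set.mem_univ _) (Set.mem_univ _) (Set.mem_univ _))

theorem twistedFace_sub_mem_ord (i : ZMod n) : twistedFace i - of (.f i) ∈ ord (BananaCell n) 2 :=
  expOp_bracket_sub_mem_ord (half_faceAxis_mem_ord i) (of_mem_ord _)
    (by rw [sub_self]; exact Submodule.zero_mem _)

/-- `Q` has no constant term, so every correction contains a bracket and does not affect the
geometric boundary. -/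
theorem correction_mem_ord {Q : NCSeries (Fin 2)} (hQ : IsBCHRemainder Q) (i j : ZMod n) :
    correction Q i j ∈ ord (BananaCell n) 2 := by
  have h (j k l m : ZMod n) : evalLin ![adOp deg (loop j k), adOp deg (loop l m)] Q
      (twistedFace i) ∈ ord (BananaCell n) 2 := by
    have h1 := evalLin_sub_smul_mem_ord
      (contracting_adOp_pair (deg := deg) (loop_mem_ord j k) (loop_mem_ord l m)) Q
      (twistedFace_mem_ord i)
    rwa [hQ.nil, zero_smul, sub_zero] at h1
  rw [correction_eq]
  exact Submodule.add_mem _ (h _ _ _ _) (h _ _ _ _)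

theorem faceLoop_sub_mem_ord (i : ZMod n) :
    faceLoop i - (of (.e i) - of (.e (i + 1))) ∈ ord (BananaCell n) 2 := by
  rw [faceLoop_eq, sub_eq_add_neg (of _)]
  exact expOp_bracket_sub_mem_ord (Submodule.neg_mem _ (half_faceAxis_mem_ord i))
    (loop_mem_ord _ _) (bch_sub_add_mem_ord (of_mem_ord _) (Submodule.neg_mem _ (of_mem_ord _)))

theorem edgeVal_e_sub_mem_ord (i : ZMod n) :
    edgeVal (.e i) - (of .b - of .a) ∈ ord (BananaCell n) 2 := by
  have hc : Contracting (adOp deg (of (.e i : BananaCell n))) := contracting_adOp (of_mem_ord _)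
  have ha := opEval_sub_smul_mem_ord hc (bernoulliPowerSeries ℚ)
    (of_mem_ord (.a : BananaCell n))
  have hb := opEval_sub_smul_mem_ord hc (bernoulli'PowerSeries ℚ)
    (of_mem_ord (.b : BananaCell n))
  have h0 : PowerSeries.constantCoeff (bernoulliPowerSeries ℚ) = 1 := by
    rw [← PowerSeries.coeff_zero_eq_constantCoeff_apply, bernoulliPowerSeries,
      PowerSeries.coeff_mk]
    simp
  have h0' : PowerSeries.constantCoeff (bernoulli'PowerSeries ℚ) = 1 := by
    rw [← PowerSeries.coeff_zero_eq_constantCoeff_apply, bernoulli'PowerSeries,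
      PowerSeries.coeff_mk]
    simp
  rw [h0, one_smul] at ha
  rw [h0', one_smul] at hb
  convert Submodule.sub_mem _ hb ha using 1
  rw [edgeVal_e]
  abel

variable [NeZero n]

theorem solidBoundary_sub_mem_ord {Q : NCSeries (Fin 2)} (hQ : IsBCHRemainder Q) :
    solidBoundary n Q - ∑ i : ZMod n, of (.f i) ∈ ord (BananaCell n) 2 := by
  rw [solidBoundary, add_sub_right_comm, ← Finset.sum_sub_distrib]
  exact Submodule.add_mem _ (Submodule.sum_mem _ fun i _ => twistedFace_sub_mem_ord i)
    (Submodule.smul_mem _ _ (Submodule.sum_mem _ fun i _ => Submodule.sum_mem _ fun j _ =>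
      correction_mem_ord hQ i j))

variable {Q : NCSeries (Fin 2)} {μ : NCSeries (ZMod n)}

theorem cellVal_apply_singleton (hQ : IsBCHRemainder Q)
    (hμ : μ ∈ lieSeries (fun _ => (0 : ℤ)) Set.univ) (c c' : BananaCell n) :
    cellVal Q μ c [c'] = (inc c c' : ℚ) := by
  classical
  have key {p q : NCSeries (BananaCell n)} (h : p - q ∈ ord _ 2) : p [c'] = q [c'] :=
    apply_eq_of_sub_mem_ord h (by simp)
  have hsq (g : BananaCell n) : -(of g * of g) - 0 ∈ ord (BananaCell n) 2 := by
    rw [sub_zero]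
    exact Submodule.neg_mem _ (mul_mem_ord (of_mem_ord g) (of_mem_ord g))
  -- The twisting term `[x, c]` contains a bracket and is invisible modulo length 2.
  have hb {p q r : NCSeries (BananaCell n)} (h : p - q ∈ ord _ 2)
      (he : r ∈ ord _ 1) (c : BananaCell n) : p - bracket deg r (of c) - q ∈ ord _ 2 := by
    rw [sub_right_comm]
    exact Submodule.sub_mem _ h (bracket_mem_ord he (of_mem_ord c))
  cases c with
  | a =>
    rw [cellVal, edgeVal_a, key (hsq _)]
    · cases c' <;> simp [inc, zero_apply]
    all_goals simp
  | b =>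
    rw [cellVal, edgeVal_b, key (hsq _)]
    · cases c' <;> simp [inc, zero_apply]
    all_goals simp
  | e i =>
    rw [cellVal, key (edgeVal_e_sub_mem_ord i)]
    · cases c' <;> simp [inc, sub_apply, of_apply_singleton_eq_ite]
    all_goals simp
  | f i =>
    rw [cellVal, key (hb (faceLoop_sub_mem_ord i) (lieSeries_mem_ord
      (extendsEdges_edgeVal.flowEnd_mem_lieSeries (half_faceAxis_mem_star i))) _)]
    cases c' <;> simp [inc, sub_apply, of_apply_singleton_eq_ite]
  | h =>
    have h1 := lieSeries_mem_ord (half_axis_mem_star hμ)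
    rw [cellVal, key (hb (expOp_bracket_sub_mem_ord (Submodule.neg_mem _ h1)
      (lieSeries_mem_ord (solidBoundary_mem_lieSeries Q (fun _ => Set.mem_univ _)
        fun _ => Set.mem_univ _)) (solidBoundary_sub_mem_ord hQ)) (lieSeries_mem_ord
      (extendsEdges_edgeVal.flowEnd_mem_lieSeries (half_axis_mem_star hμ))) _), sum_apply]
    cases c' <;> simp [inc, of_apply_singleton_eq_ite]

end Geometric

/-! ### Closures of cells -/

section Closure

open Relation

theorem star_subset_boundaryClosure {c : BananaCell n} {I : Set (ZMod n)} {i₀ : ZMod n}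
    (h₀ : i₀ ∈ I) (h : ∀ i ∈ I, .e i ∈ boundaryClosure inc c) :
    star I ⊆ boundaryClosure inc c := by
  rintro g ((rfl | rfl) | ⟨i, hi, rfl⟩)
  · exact (h i₀ h₀).tail (by simp [inc] : inc (.e i₀) .a ≠ 0)
  · exact (h i₀ h₀).tail (by simp [inc] : inc (.e i₀) .b ≠ 0)
  · exact h i hi

theorem star_subset_cellClosure_e (i : ZMod n) : star {i} ⊆ cellClosure inc (.e i) := by
  rintro g ((rfl | rfl) | ⟨j, rfl, rfl⟩)
  · exact ReflTransGen.single (by simp [inc] : inc (.e i) .a ≠ 0)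
  · exact ReflTransGen.single (by simp [inc] : inc (.e i) .b ≠ 0)
  · exact ReflTransGen.refl

theorem boundaryClosure_subset_cellClosure (c : BananaCell n) :
    boundaryClosure inc c ⊆ cellClosure inc c := fun _ h => TransGen.to_reflTransGen h

theorem add_one_ne (hn : 2 ≤ n) (i : ZMod n) : i + 1 ≠ i := by
  have : Fact (1 < n) := ⟨hn⟩
  intro h
  exact one_ne_zero (add_eq_left.1 h)

/-- For `n = 1` the two edges of the bigon would coincide and their incidence numbers cancel; this
is where `2 ≤ n` enters. -/
theorem inc_f_e (hn : 2 ≤ n) (i : ZMod n) : inc (.f i) (.e i) ≠ 0 ∧ inc (.f i) (.e (i + 1)) ≠ 0 := by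
  simp [inc, add_one_ne hn i, (add_one_ne hn i).symm]

theorem star_subset_boundaryClosure_f (hn : 2 ≤ n) (i : ZMod n) :
    star {i, i + 1} ⊆ boundaryClosure inc (.f i) := by
  refine star_subset_boundaryClosure (.inl rfl) ?_
  rintro j (rfl | rfl)
  exacts [TransGen.single (inc_f_e hn _).1, TransGen.single (inc_f_e hn _).2]

theorem f_mem_boundaryClosure_h (i : ZMod n) : .f i ∈ boundaryClosure inc (.h : BananaCell n) :=
  TransGen.single (by simp [inc] : inc .h (.f i) ≠ 0)

theorem e_mem_boundaryClosure_h (hn : 2 ≤ n) (i : ZMod n) : .e i ∈ boundaryClosure inc (.h : BananaCell n) :=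
  TransGen.tail (f_mem_boundaryClosure_h i) (inc_f_e hn i).1

theorem cellClosure_h (hn : 2 ≤ n) : cellClosure inc (.h : BananaCell n) = Set.univ := by
  refine Set.eq_univ_of_forall fun c => ?_
  have hs : star Set.univ ⊆ boundaryClosure inc (.h : BananaCell n) :=
    star_subset_boundaryClosure (Set.mem_univ 0) fun i _ => e_mem_boundaryClosure_h hn i
  cases c with
  | a => exact boundaryClosure_subset_cellClosure _ (hs (a_mem_star _))
  | b => exact boundaryClosure_subset_cellClosure _ (hs (b_mem_star _))
  | e i => exact boundaryClosure_subset_cellClosure _ (e_mem_boundaryClosure_h hn i)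
  | f i => exact boundaryClosure_subset_cellClosure _ (f_mem_boundaryClosure_h i)
  | h => exact ReflTransGen.refl

end Closure

/-! ### The model axioms and localisation -/

section Model

variable [NeZero n] {Q : NCSeries (Fin 2)} {μ : NCSeries (ZMod n)}

theorem cellVal_mem_lieSeries_cellClosure (hn : 2 ≤ n)
    (hμ : μ ∈ lieSeries (fun _ => (0 : ℤ)) Set.univ) (c : BananaCell n) :
    cellVal Q μ c ∈ lieSeries deg (cellClosure inc c) := by
  have hsq (g : BananaCell n) : -((1 / 2 : ℚ) • bracket deg (of g) (of g)) ∈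
      lieSeries deg (cellClosure inc g) :=
    have hg := of_mem_lieSeries (deg := deg) (S := cellClosure inc g) Relation.ReflTransGen.refl
    Submodule.neg_mem _ (Submodule.smul_mem _ _ (bracket_mem_lieSeries _ hg hg))
  cases c with
  | a => exact hsq .a
  | b => exact hsq .b
  | e i =>
    exact lieSeries_mono (star_subset_cellClosure_e i)
      (edgeVal_mem_lieSeries {i} (e_mem_star (Set.mem_singleton i)))
  | f i =>
    refine lieSeries_mono (Set.insert_subset Relation.ReflTransGen.refl ?_)
      (cellVal_f_mem_lieSeries Q)
    exact (star_subset_boundaryClosure_f hn i).trans (boundaryClosure_subset_cellClosure _)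
  | h =>
    rw [cellClosure_h hn]
    exact cellVal_mem_lieSeries Q hμ .h

theorem isModel_deriv (hn : 2 ≤ n) (hQ : IsBCHRemainder Q)
    (hμ : μ ∈ lieSeries (fun _ => (0 : ℤ)) Set.univ) :
    IsModel dim inc (FreeGLA.deriv (cellVal_mem_piece Q hμ)) where
  isDGLA := FreeGLA.isDGLA_deriv _ (derivExt_derivExt_cellVal hQ hμ)
  filtered := (FreeGLA.isGradedDerivation_deriv _).filtered
  vertex c hc := by
    have hδ := extendsFaces_cellVal Q hμ
    have h (g : BananaCell n) (hg : deg g = -1) : of g ∈ piece deg (-1) := hg ▸ of_mem_piece deg g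
    cases c with
    | a => exact (isPoint_deriv_iff _ (h _ rfl)).2 hδ.derivExt_a
    | b => exact (isPoint_deriv_iff _ (h _ rfl)).2 hδ.derivExt_b
    | e i => exact absurd hc (by simp [dim])
    | f i => exact absurd hc (by simp [dim])
    | h => exact absurd hc (by simp [dim])
  geometric c c' := (congrFun (FreeGLA.coe_deriv_gen _ c) [c']).trans
    (cellVal_apply_singleton hQ hμ c c')
  locality c := by
    rw [FreeGLA.coe_deriv_gen]
    exact cellVal_mem_lieSeries_cellClosure hn hμ c

theorem isPoint_flow {e : NCSeries (BananaCell n)}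
    (hμ : μ ∈ lieSeries (fun _ => (0 : ℤ)) Set.univ)
    (he : e ∈ lieSeries deg (star Set.univ)) (hd : e ∈ homDeg deg 0) :
    IsPoint (FreeGLA.deriv (cellVal_mem_piece Q hμ))
      (flow (FreeGLA.deriv (cellVal_mem_piece Q hμ)) e (of .a)) := by
  have hδ := extendsFaces_cellVal Q hμ
  rw [flow_eq_flowEnd _ (FreeGLA.diffAt_deriv _ (mem_total_of_mem_star he hd))]
  exact (isPoint_deriv_iff _ (mem_piece.2 ⟨lieSeries_mono (Set.subset_univ _)
    (hδ.flowEnd_mem_lieSeries he), hδ.flowEnd_mem_homDeg hd⟩)).2 (hδ.flowEnd_point he hd)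

theorem twistedDiff_flow {e : NCSeries (BananaCell n)}
    (hμ : μ ∈ lieSeries (fun _ => (0 : ℤ)) Set.univ)
    (he : e ∈ lieSeries deg (star Set.univ)) (hd : e ∈ homDeg deg 0) (c : BananaCell n) :
    twistedDiff (FreeGLA.deriv (cellVal_mem_piece Q hμ))
      (flow (FreeGLA.deriv (cellVal_mem_piece Q hμ)) e (of .a)) (of c) =
        twist deg (cellVal Q μ) (flowEnd deg (cellVal Q μ) e (of .a)) (of c) := by
  have hδ := extendsFaces_cellVal Q hμ
  rw [flow_eq_flowEnd _ (FreeGLA.diffAt_deriv _ (mem_total_of_mem_star he hd)), twistedDiff,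
    FreeGLA.diffAt_deriv _ (piece_le_total _ _ (of_mem_piece _ c)), twist_eq (hδ.flowEnd_mem_homDeg hd)]

/-- The cell `h` occurs in `∂h` only through `[x, h]`, which the twist at `x` removes; what is left
is a series in edges and bigons. -/
theorem isLocalisedAt_h (hn : 2 ≤ n) (hμ : μ ∈ lieSeries (fun _ => (0 : ℤ)) Set.univ) :
    IsLocalisedAt dim inc (FreeGLA.deriv (cellVal_mem_piece Q hμ)) .h
      (centre μ (FreeGLA.deriv (cellVal_mem_piece Q hμ))) := by
  refine ⟨by simp [dim], isPoint_flow hμ (half_axis_mem_star hμ) half_axis_mem_homDeg, ?_⟩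
  rw [centre, twistedDiff_flow hμ (half_axis_mem_star hμ) half_axis_mem_homDeg, twist_h Q hμ]
  exact expOp_bracket_mem_lieSeries (Submodule.neg_mem _ (Submodule.smul_mem _ _
    (axis_mem_lieSeries (e_mem_boundaryClosure_h hn) hμ)))
    (solidBoundary_mem_lieSeries Q (e_mem_boundaryClosure_h hn) f_mem_boundaryClosure_h)

theorem isLocalisedAt_f (hn : 2 ≤ n) (hμ : μ ∈ lieSeries (fun _ => (0 : ℤ)) Set.univ)
    (i : ZMod n) : IsLocalisedAt dim inc (FreeGLA.deriv (cellVal_mem_piece Q hμ)) (.f i)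
      (faceCentre (FreeGLA.deriv (cellVal_mem_piece Q hμ)) i) := by
  refine ⟨by simp [dim], isPoint_flow hμ (half_faceAxis_mem_star i) (half_faceAxis_mem_homDeg i), ?_⟩
  rw [faceCentre, twistedDiff_flow hμ (half_faceAxis_mem_star i) (half_faceAxis_mem_homDeg i),
    (extendsFaces_cellVal Q hμ).twist_f]
  exact lieSeries_mono (star_subset_boundaryClosure_f hn i)
    (faceLoop_mem_lieSeries (e_mem_star (.inl rfl)) (e_mem_star (.inr rfl)))

end Model

end Banana

/-! ### Signed permutations as automorphisms of the model -/

section Relabel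

variable {C : Type} {dim : C → ℕ} {π : Equiv.Perm C} {s : C → ℚ}

theorem relabel_of_eq (c : C) : relabel π s (of c) = s (π.symm c) • of (π.symm c) := by
  conv_lhs => rw [← π.apply_symm_apply c]
  exact relabel_of π s _

/-- A signed permutation of the generators preserving the degrees and the signs, as an automorphism
of the completed free graded Lie algebra. -/
noncomputable def relabelEquiv (hπ : ∀ c, cellDeg dim (π c) = cellDeg dim c)
    (hs : ∀ c, s c * s (π c) = 1) : FreeGLA (cellDeg dim) ≃ₗ[ℚ] FreeGLA (cellDeg dim) where
  toFun x := ⟨relabel π s x.1, relabel_mem_total hπ s x.2⟩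
  invFun x := ⟨relabel π.symm s x.1, relabel_mem_total (fun c => by
    conv_rhs => rw [← π.apply_symm_apply c, hπ]) s x.2⟩
  map_add' x y := Subtype.ext (map_add _ x.1 y.1)
  map_smul' r x := Subtype.ext (map_smul _ r x.1)
  left_inv x := Subtype.ext (relabel_relabel _ _ _ _ π.apply_symm_apply (fun c => by
    have := hs (π.symm c)
    rwa [π.apply_symm_apply, mul_comm] at this) x.1)
  right_inv x := Subtype.ext (relabel_relabel _ _ _ _ π.symm_apply_apply hs x.1)

/-- `relabel` sends the generator `π c` to `s c • c`, so on generators it acts by the inverse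
permutation, with the sign read at the image. -/
theorem isModelSymmetry_deriv [Fintype C] {δ : C → NCSeries C}
    (hδ : ∀ c, δ c ∈ piece (cellDeg dim) (cellDeg dim c - 1))
    (hπ : ∀ c, cellDeg dim (π c) = cellDeg dim c) (hs : ∀ c, s c * s (π c) = 1)
    (h : ∀ c, relabel π s (δ (π c)) = s c • δ c) :
    IsModelSymmetry (FreeGLA.deriv hδ) π.symm (fun c => s (π.symm c)) :=
  ⟨relabelEquiv hπ hs, fun m _ hx => filtered_relabel π s m _ hx,
    fun m _ hx => filtered_relabel π.symm s m _ hx,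
    fun _ _ hx => relabel_mem_piece hπ s hx,
    fun x y => Subtype.ext (relabel_bracket hπ s x.1 y.1),
    fun c => Subtype.ext (relabel_of_eq c),
    fun x => Subtype.ext (relabel_derivExt hπ hδ h (total_le_lieSeries x.2))⟩

end Relabel

namespace NCSeries

theorem relabel_average₂ {G : Type} {π : Equiv.Perm G} {s : G → ℚ} {x y : NCSeries G}
    (hx : x ∈ ord G 1) (hy : y ∈ ord G 1) :
    relabel π s (average₂ x y) = average₂ (relabel π s x) (relabel π s y) := by
  have hx' := Submodule.neg_mem _ hx
  rw [average₂, relabel_bch hx (Submodule.smul_mem _ _ (bch_mem_ord hx' hy)), map_smul,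
    relabel_bch hx' hy, map_neg, average₂]

end NCSeries

/-! ### Dihedral symmetry -/

namespace Banana

variable {n : ℕ}

/-- A signed permutation of the cells which fixes the vertices and the solid cell, and which acts
by `σ` on the edges and compatibly by `φ` on the bigons. -/
structure IsSymmetry (π : Equiv.Perm (BananaCell n)) (s : BananaCell n → ℚ)
    (σ φ : Equiv.Perm (ZMod n)) (ε : ℚ) : Prop where
  symm_a : π.symm .a = .a
  symm_b : π.symm .b = .b
  symm_e : ∀ i, π.symm (.e i) = .e (σ i)
  symm_f : ∀ i, π.symm (.f i) = .f (φ i)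
  symm_h : π.symm .h = .h
  sign_a : s .a = 1
  sign_b : s .b = 1
  sign_e : ∀ i, s (.e i) = 1
  sign_f : ∀ i, s (.f i) = ε
  sign_h : s .h = ε
  face : ∀ i, (ε = 1 ∧ σ i = φ i ∧ σ (i + 1) = φ i + 1) ∨
    (ε = -1 ∧ σ (i + 1) = φ i ∧ σ i = φ i + 1)

namespace IsSymmetry

variable {π : Equiv.Perm (BananaCell n)} {s : BananaCell n → ℚ} {σ φ : Equiv.Perm (ZMod n)} {ε : ℚ}

theorem deg_eq (H : IsSymmetry π s σ φ ε) (c : BananaCell n) : deg (π c) = deg c := by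
  have h (c : BananaCell n) : deg c = deg (π.symm c) := by
    cases c with
    | a => rw [H.symm_a]
    | b => rw [H.symm_b]
    | e i => rw [H.symm_e]; rfl
    | f i => rw [H.symm_f]; rfl
    | h => rw [H.symm_h]
  rw [h, π.symm_apply_apply]

theorem relabel_a (H : IsSymmetry π s σ φ ε) : relabel π s (of .a) = of .a := by
  rw [relabel_of_eq, H.symm_a, H.sign_a, one_smul]

theorem relabel_b (H : IsSymmetry π s σ φ ε) : relabel π s (of .b) = of .b := by
  rw [relabel_of_eq, H.symm_b, H.sign_b, one_smul]

theorem relabel_e (H : IsSymmetry π s σ φ ε) (i : ZMod n) :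
    relabel π s (of (.e i)) = of (.e (σ i)) := by
  rw [relabel_of_eq, H.symm_e, H.sign_e, one_smul]

theorem relabel_f (H : IsSymmetry π s σ φ ε) (i : ZMod n) :
    relabel π s (of (.f i)) = ε • of (.f (φ i)) := by
  rw [relabel_of_eq, H.symm_f, H.sign_f]

theorem relabel_h (H : IsSymmetry π s σ φ ε) : relabel π s (of .h) = ε • of .h := by
  rw [relabel_of_eq, H.symm_h, H.sign_h]

/-- A symmetry may exchange the two edges of a bigon; symmetry of the average absorbs this. -/
theorem relabel_faceAxis (H : IsSymmetry π s σ φ ε) (i : ZMod n) :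
    relabel π s (faceAxis i) = faceAxis (φ i) := by
  rw [faceAxis, relabel_average₂ (of_mem_ord _) (of_mem_ord _), H.relabel_e, H.relabel_e, faceAxis]
  rcases H.face i with ⟨-, h, h'⟩ | ⟨-, h, h'⟩
  · rw [h, h']
  · rw [h, h', average₂_comm (of_mem_ord _) (of_mem_ord _)]

theorem relabel_half_faceAxis (H : IsSymmetry π s σ φ ε) (i : ZMod n) :
    relabel π s ((1 / 2 : ℚ) • faceAxis i) = (1 / 2 : ℚ) • faceAxis (φ i) := by
  rw [map_smul, H.relabel_faceAxis]

theorem relabel_loop (H : IsSymmetry π s σ φ ε) (j k : ZMod n) :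
    relabel π s (loop j k) = loop (σ j) (σ k) := by
  rw [loop, relabel_bch (of_mem_ord _) (Submodule.neg_mem _ (of_mem_ord _)), map_neg, H.relabel_e,
    H.relabel_e, loop]

theorem relabel_face_loop (H : IsSymmetry π s σ φ ε) (i : ZMod n) :
    relabel π s (loop i (i + 1)) = ε • loop (φ i) (φ i + 1) := by
  rw [H.relabel_loop]
  rcases H.face i with ⟨hε, h, h'⟩ | ⟨hε, h, h'⟩
  · rw [h, h', hε, one_smul]
  · rw [h, h', hε, neg_smul, one_smul, neg_loop]

theorem relabel_twistedFace (H : IsSymmetry π s σ φ ε) (i : ZMod n) :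
    relabel π s (twistedFace i) = ε • twistedFace (φ i) := by
  rw [twistedFace, ad, relabel_expOp_bracket H.deg_eq (half_faceAxis_mem_ord i),
    H.relabel_half_faceAxis, H.relabel_f, expOp_bracket_smul, twistedFace]

theorem relabel_faceLoop (H : IsSymmetry π s σ φ ε) (i : ZMod n) :
    relabel π s (faceLoop i) = ε • faceLoop (φ i) := by
  rw [faceLoop_eq, ad, relabel_expOp_bracket H.deg_eq
    (Submodule.neg_mem _ (half_faceAxis_mem_ord i)), map_neg, H.relabel_half_faceAxis,
    H.relabel_face_loop, expOp_bracket_smul, faceLoop_eq]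

theorem relabel_evalLin_loop (H : IsSymmetry π s σ φ ε) (Q : NCSeries (Fin 2)) (i j k l : ZMod n)
    (p : NCSeries (BananaCell n)) :
    relabel π s (evalLin ![adOp deg (loop i j), adOp deg (loop k l)] Q p) =
      evalLin ![adOp deg (loop (σ i) (σ j)), adOp deg (loop (σ k) (σ l))] Q (relabel π s p) := by
  refine map_evalLin (filtered_relabel π s)
    (contracting_adOp_pair (loop_mem_ord _ _) (loop_mem_ord _ _)) (fun m q => ?_) Q p
  rw [← H.relabel_loop, ← H.relabel_loop]
  fin_cases m
  · exact relabel_bracket H.deg_eq s _ q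
  · exact relabel_bracket H.deg_eq s _ q

/-- An orientation-reversing symmetry exchanges the two edges of the bigon and with them the two
`Q`-terms. This is why the boundary of `h` contains both. -/
theorem relabel_correction (H : IsSymmetry π s σ φ ε) (Q : NCSeries (Fin 2)) (i j : ZMod n) :
    relabel π s (correction Q i j) = ε • correction Q (φ i) (σ j) := by
  rw [correction_eq, map_add, H.relabel_evalLin_loop, H.relabel_evalLin_loop,
    H.relabel_twistedFace, map_smul, map_smul, ← smul_add, correction_eq]
  rcases H.face i with ⟨-, h, h'⟩ | ⟨-, h, h'⟩
  · rw [h, h']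
  · rw [h, h', add_comm]

theorem relabel_of_symm (c : BananaCell n) {δ : BananaCell n → NCSeries (BananaCell n)}
    (h : ∀ c, relabel π s (δ c) = s (π.symm c) • δ (π.symm c)) :
    relabel π s (δ (π c)) = s c • δ c := by
  rw [h, π.symm_apply_apply]

theorem relabel_edgeVal (H : IsSymmetry π s σ φ ε) (c : BananaCell n) :
    relabel π s (edgeVal c) = s (π.symm c) • edgeVal (π.symm c) := by
  cases c with
  | a => rw [edgeVal_a, map_neg, relabel_mul, H.relabel_a, H.symm_a, H.sign_a, one_smul, edgeVal_a]
  | b => rw [edgeVal_b, map_neg, relabel_mul, H.relabel_b, H.symm_b, H.sign_b, one_smul, edgeVal_b]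
  | e i =>
    rw [edgeVal_e, map_add, map_neg, relabel_opEval_adOp H.deg_eq (of_mem_ord _),
      relabel_opEval_adOp H.deg_eq (of_mem_ord _), H.relabel_a, H.relabel_b, H.relabel_e, H.symm_e,
      H.sign_e, one_smul, edgeVal_e]
  | f i => rw [H.symm_f]; exact (map_zero _).trans (smul_zero _).symm
  | h => rw [H.symm_h]; exact (map_zero _).trans (smul_zero _).symm

variable [NeZero n]

theorem relabel_solidBoundary (H : IsSymmetry π s σ φ ε) (Q : NCSeries (Fin 2)) :
    relabel π s (solidBoundary n Q) = ε • solidBoundary n Q := by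
  have hsum (i : ZMod n) : ∑ j : ZMod n with j ≠ i ∧ j ≠ i + 1, correction Q (φ i) (σ j) =
      ∑ j : ZMod n with j ≠ φ i ∧ j ≠ φ i + 1, correction Q (φ i) j := by
    rw [Finset.sum_filter, Finset.sum_filter]
    refine Eq.trans ?_ (Equiv.sum_comp σ fun j =>
      if j ≠ φ i ∧ j ≠ φ i + 1 then correction Q (φ i) j else 0)
    refine Finset.sum_congr rfl fun j _ => if_congr ?_ rfl rfl
    rcases H.face i with ⟨-, h, h'⟩ | ⟨-, h, h'⟩
    · rw [← h', ← h, σ.injective.ne_iff, σ.injective.ne_iff]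
    · rw [← h', ← h, σ.injective.ne_iff, σ.injective.ne_iff, and_comm]
  rw [solidBoundary, map_add, map_smul, map_sum, map_sum]
  simp only [map_sum, H.relabel_correction, H.relabel_twistedFace, ← Finset.smul_sum, hsum]
  rw [Equiv.sum_comp φ fun i => twistedFace i,
    Equiv.sum_comp φ fun i => ∑ j : ZMod n with j ≠ i ∧ j ≠ i + 1, correction Q i j, smul_comm,
    ← smul_add]

/-- The edges are permuted by `σ`, and total symmetry of `μ` removes the permutation. -/
theorem relabel_axis (H : IsSymmetry π s σ φ ε) {μ : NCSeries (ZMod n)}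
    (hμ : ∀ (ρ : Equiv.Perm (ZMod n)) (w : List (ZMod n)), μ (w.map ρ) = μ w) :
    relabel π s (axis μ) = axis μ := by
  rw [axis_eq, map_substLin (filtered_relabel π s) (relabel_one π s) (relabel_mul π s)
    (fun i => of_mem_ord _)]
  simp only [H.relabel_e]
  exact substLin_comp_perm (fun i => of (BananaCell.e i)) (μ := μ) σ (hμ σ)

theorem relabel_flowEnd_edgeVal (H : IsSymmetry π s σ φ ε) {e : NCSeries (BananaCell n)}
    (he : e ∈ lieSeries deg (star Set.univ)) :
    relabel π s (flowEnd deg edgeVal e (of .a)) =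
      flowEnd deg edgeVal (relabel π s e) (of .a) := by
  rw [relabel_flowEnd H.deg_eq edgeVal_mem_piece
    (fun c => relabel_of_symm c H.relabel_edgeVal) (lieSeries_mono (Set.subset_univ _) he),
    H.relabel_a]

theorem relabel_cellVal (H : IsSymmetry π s σ φ ε) (Q : NCSeries (Fin 2)) {μ : NCSeries (ZMod n)}
    (hμ : IsUniversalAverage μ) (c : BananaCell n) :
    relabel π s (cellVal Q μ c) = s (π.symm c) • cellVal Q μ (π.symm c) := by
  cases c with
  | a =>
    have h := H.relabel_edgeVal .a
    rw [H.symm_a] at h ⊢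
    exact h
  | b =>
    have h := H.relabel_edgeVal .b
    rw [H.symm_b] at h ⊢
    exact h
  | e i =>
    have h := H.relabel_edgeVal (.e i)
    rw [H.symm_e] at h ⊢
    exact h
  | f i =>
    rw [cellVal, map_sub, H.relabel_faceLoop, relabel_bracket H.deg_eq, H.relabel_f,
      bracket_smul_right, H.relabel_flowEnd_edgeVal (half_faceAxis_mem_star i),
      H.relabel_half_faceAxis, ← smul_sub, H.symm_f, H.sign_f, cellVal]
  | h =>
    have hx := half_axis_mem_star hμ.lie
    rw [cellVal, map_sub, ad, relabel_expOp_bracket H.deg_eq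
      (Submodule.neg_mem _ (lieSeries_mem_ord hx)), relabel_bracket H.deg_eq, H.relabel_h,
      bracket_smul_right, H.relabel_flowEnd_edgeVal hx, map_neg, map_smul,
      H.relabel_axis hμ.symmetric, H.relabel_solidBoundary, expOp_bracket_smul, ← smul_sub,
      H.symm_h, H.sign_h, cellVal]

theorem isModelSymmetry (H : IsSymmetry π s σ φ ε) (Q : NCSeries (Fin 2)) {μ : NCSeries (ZMod n)}
    (hμ : IsUniversalAverage μ) :
    IsModelSymmetry (FreeGLA.deriv (cellVal_mem_piece Q hμ.lie)) π.symm
      (fun c => s (π.symm c)) := by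
  have hε : ε * ε = 1 := by rcases H.face 0 with ⟨h, -⟩ | ⟨h, -⟩ <;> rw [h] <;> norm_num
  refine isModelSymmetry_deriv _ H.deg_eq (fun c => ?_)
    fun c => relabel_of_symm c (H.relabel_cellVal Q hμ)
  obtain ⟨c, rfl⟩ := π.symm.surjective c
  rw [π.apply_symm_apply]
  cases c with
  | a => rw [H.symm_a, H.sign_a, one_mul]
  | b => rw [H.symm_b, H.sign_b, one_mul]
  | e i => rw [H.symm_e, H.sign_e, H.sign_e, one_mul]
  | f i => rw [H.symm_f, H.sign_f, H.sign_f, hε]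
  | h => rw [H.symm_h, H.sign_h, hε]

end IsSymmetry

/-! ### The dihedral group -/

theorem dihedralPerm_dihedralPerm (g : DihedralGroup n) (c : BananaCell n) :
    dihedralPerm g⁻¹ (dihedralPerm g c) = c := by
  cases g <;> cases c <;> simp [dihedralPerm]; ring

/-- The permutation of the cells given by an element of the dihedral group. -/
def dihedralEquiv (g : DihedralGroup n) : Equiv.Perm (BananaCell n) where
  toFun := dihedralPerm g
  invFun := dihedralPerm g⁻¹
  left_inv := dihedralPerm_dihedralPerm g
  right_inv c := by
    have := dihedralPerm_dihedralPerm g⁻¹ c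
    rwa [inv_inv] at this

theorem isSymmetry_r (k : ZMod n) :
    IsSymmetry (dihedralEquiv (.r k)).symm (dihedralSign (.r k)) (Equiv.addRight k)
      (Equiv.addRight k) 1 := by
  refine ⟨rfl, rfl, fun _ => rfl, fun _ => rfl, rfl, rfl, rfl, fun _ => rfl, fun _ => rfl, rfl,
    fun i => .inl ⟨rfl, rfl, ?_⟩⟩
  exact add_right_comm i 1 k

/-- The bigon between `e_i` and `e_{i+1}` goes to the one between `e_{-i-k}` and `e_{-i-k-1}`, whose
index is the smaller one, `-(i+k) - 1`, with reversed orientation. -/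
theorem isSymmetry_sr (k : ZMod n) :
    IsSymmetry (dihedralEquiv (.sr k)).symm (dihedralSign (.sr k))
      ((Equiv.addRight k).trans (Equiv.neg _))
      (((Equiv.addRight k).trans (Equiv.neg _)).trans (Equiv.subRight 1)) (-1) := by
  refine ⟨rfl, rfl, fun _ => rfl, fun _ => rfl, rfl, rfl, rfl, fun _ => rfl, fun _ => rfl, rfl,
    fun i => .inr ⟨rfl, ?_, ?_⟩⟩
  · change -(i + 1 + k) = -(i + k) - 1
    ring
  · change -(i + k) = -(i + k) - 1 + 1
    ring

theorem dihedralSign_dihedralPerm (g : DihedralGroup n) (c : BananaCell n) :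
    dihedralSign g (dihedralPerm g c) = dihedralSign g c := by
  cases g <;> cases c <;> rfl

theorem isModelSymmetry_dihedral [NeZero n] (Q : NCSeries (Fin 2)) {μ : NCSeries (ZMod n)}
    (hμ : IsUniversalAverage μ) (g : DihedralGroup n) :
    IsModelSymmetry (FreeGLA.deriv (cellVal_mem_piece Q hμ.lie)) (dihedralPerm g)
      (dihedralSign g) := by
  -- The general lemma reads the sign at the image cell; the sign depends only on the type of cell,
  -- which the permutation preserves.
  rw [← funext (dihedralSign_dihedralPerm g)]
  cases g with
  | r k => exact (isSymmetry_r k).isModelSymmetry Q hμ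
  | sr k => exact (isSymmetry_sr k).isModelSymmetry Q hμ

end Banana

theorem theorem1 (n : ℕ) [NeZero n] (hn : 2 ≤ n) :
    (∃ Q : NCSeries (Fin 2), IsBCHRemainder Q) ∧
    (∃ μ : NCSeries (ZMod n), IsUniversalAverage μ) ∧
    ∀ (Q : NCSeries (Fin 2)) (μ : NCSeries (ZMod n)), IsBCHRemainder Q → IsUniversalAverage μ →
      Banana.axis μ ∈ NCSeries.piece (cellDeg Banana.dim) 0 ∧
      (∀ i : ZMod n, Banana.faceAxis i ∈ NCSeries.piece (cellDeg Banana.dim) 0) ∧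
      ∃ D : Banana.Alg n →ₗ[ℚ] Banana.Alg n,
        Banana.IsExplicitDifferential Q μ D ∧
        (∀ D' : Banana.Alg n →ₗ[ℚ] Banana.Alg n,
          Banana.IsExplicitDifferential Q μ D' → D' = D) ∧
        IsModel Banana.dim Banana.inc D ∧
        (∀ g : DihedralGroup n,
          IsModelSymmetry D (Banana.dihedralPerm g) (Banana.dihedralSign g)) ∧
        IsLocalisedAt Banana.dim Banana.inc D .h (Banana.centre μ D) ∧
        ∀ i : ZMod n,
          IsLocalisedAt Banana.dim Banana.inc D (.f i) (Banana.faceCentre D i) := by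
  refine ⟨exists_isBCHRemainder, ⟨mean 0, isUniversalAverage_mean 0⟩, fun Q μ hQ hμ =>
    ⟨mem_piece.2 ⟨Banana.axis_mem_lieSeries (fun _ => Set.mem_univ _) hμ.lie,
      Banana.axis_mem_homDeg μ⟩,
    fun i => mem_piece.2 ⟨Banana.faceAxis_mem_lieSeries (Set.mem_univ _) (Set.mem_univ _),
      Banana.faceAxis_mem_homDeg i⟩,
    FreeGLA.deriv (Banana.cellVal_mem_piece Q hμ.lie),
    Banana.isExplicitDifferential_deriv hμ.lie, fun D' h => h.eq_deriv hμ.lie,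
    Banana.isModel_deriv hn hQ hμ.lie, Banana.isModelSymmetry_dihedral Q hμ,
    Banana.isLocalisedAt_h hn hμ.lie, Banana.isLocalisedAt_f hn hμ.lie⟩⟩
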